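/- **Setting.** Let $\Omega\subset\mathbb R^3$ be a bounded domain with $C^\infty$ boundary $\Gamma=\partial\Omega$, outward unit normal $\nu$ (column vector, $\nu_x=\nu(x)$) and surface measure $ds$. Let $\lambda,\mu,\nu_p,\nu_u,B,C,\phi,\rho_s,\rho_f,\kappa,\omega$ be real with $\mu>0$, $3\lambda+2\mu>0$ and $1-2\nu_p$, $1-2\nu_u$, $1+\nu_u$, $\nu_u-\nu_p$, $B$, $\phi$, $\rho_f$, $\kappa$, $\omega$ all non-zero. Put $\rho_a=C\phi\rho_f$, $\rho=(1-\phi)\rho_s+\phi\rho_f$, $$\alpha=\frac{3(\nu_u-\nu_p)}{B(1-2\nu_p)(1+\nu_u)},\qquad R=\frac{2\phi^2\mu B^2(1-2\nu_p)(1+\nu_u)^2}{9(\nu_u-\nu_p)(1-2\nu_u)},\qquad \beta=\frac{\omega\phi^2\rho_f\kappa}{i\phi^2+\omega\kappa(\rho_a+\phi\rho_f)},$$ $$q=\frac{\omega^2\phi^2\rho_f}{\beta R},\qquad \gamma=-\frac{i\omega\rho_f(\alpha-\beta)}{\beta},\qquad \epsilon=\frac{i\omega\gamma(\alpha-\beta)}{q(\lambda+2\mu)},\qquad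 k_p=\omega\sqrt{\tfrac{\rho-\beta\rho_f}{\lambda+2\mu}},\qquad k_s=\omega\sqrt{\tfrac{\rho-\beta\rho_f}{\mu}},$$ and let $k_1,k_2\in\mathbb C$ satisfy $k_1^2+k_2^2=q(1+\epsilon)+k_p^2$, $k_1^2k_2^2=qk_p^2$, $\operatorname{Im}k_1,\operatorname{Im}k_2\ge0$ and $k_1^2\ne k_2^2$. Let $\gamma_k(x,y)=\dfrac{e^{ik|x-y|}}{4\pi|x-y|}$ and $$E=\begin{bmatrix}E_{11}&E_{12}\\E_{21}^\top&E_{22}\end{bmatrix},\qquad E_{11}=\frac1\mu\gamma_{k_s}I+\frac1{(\rho-\beta\rho_f)\omega^2}\nabla_x\nabla_x^\top\Big(\gamma_{k_s}-\frac{k_p^2-k_2^2}{k_1^2-k_2^2}\gamma_{k_1}+\frac{k_p^2-k_1^2}{k_1^2-k_2^2}\gamma_{k_2}\Big),$$ $$E_{12}=\frac{i\omega\gamma\,\nabla_x[\gamma_{k_1}-\gamma_{k_2}]}{(\lambda+2\mu)(k_1^2-k_2^2)},\qquad E_{21}=-\frac{(\alpha-\beta)\nabla_x[\gamma_{k_1}-\gamma_{k_2}]}{(\lambda+2\mu)(k_1^2-k_2^2)},\qquad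 E_{22}=-\frac{(k_p^2-k_1^2)\gamma_{k_1}-(k_p^2-k_2^2)\gamma_{k_2}}{k_1^2-k_2^2}.$$ With $T(\partial,\nu)u=2\mu\,\partial_\nu u+\lambda\nu\,\nabla\cdot u+\mu\,\nu\times(\nabla\times u)$ let $$\widetilde T=\begin{bmatrix}T&-\alpha\nu\\-\rho_f\omega^2\nu^\top&\partial_\nu\end{bmatrix},\qquad \widetilde T^*=\begin{bmatrix}T&-\frac{\rho_f\omega^2\alpha}{\beta}\nu\\-\beta\nu^\top&\partial_\nu\end{bmatrix}.$$ The hyper-singular operator is $$N(U)(x)=\int_\Gamma\widetilde T(\partial_x,\nu_x)\big(\widetilde T^*(\partial_y,\nu_y)E(x,y)\big)^\top U(y)\,ds_y,\qquad x\in\Gamma,$$ in the sense of the Hadamard finite part (with respect to the cut-off $|y-x|\ge\varepsilon$, $\varepsilon\to0^+$). Write $N=\begin{bmatrix}N_1&N_2\\N_3&N_4\end{bmatrix}$ according to $U=(u^\top,p)^\top$, so that $N_3(u)$ is the scalar (last) component of $N((u^\top,0)^\top)$. The Günter derivative is $(M(\partial,\nu)u)_i=\sum_j m^{ij}u_j$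 with the tangential derivatives $m^{ij}=\nu_j\partial_i-\nu_i\partial_j$, i.e. $M(\partial,\nu)u=\partial_\nu u-\nu\,\nabla\cdot u+\nu\times\operatorname{curl}u$; for a matrix field $A$ on $\Gamma$ put $M(\partial,\nu):A=\sum_{i,j}m^{ij}A_{ij}$. **Theorem.** For every continuously differentiable $u:\Gamma\to\mathbb C^3$ and every $x\in\Gamma$ the finite part $N_3(u)(x)$ exists and $$N_3(u)=N_3^1(u)+N_3^2\big(M(\partial,\nu)u\big)+M(\partial,\nu):N_3^3\big(M(\partial,\nu)u\big)\quad\text{on }\Gamma,$$ where $$\begin{aligned} N_3^1(u)(x)=\;&\frac{i\omega\gamma}{k_1^2-k_2^2}\int_\Gamma\partial_{\nu_x}\big[k_1^2\gamma_{k_1}-k_2^2\gamma_{k_2}\big]\nu_y^\top u(y)\,ds_y-\rho_f\omega^2\int_\Gamma\big[\partial_{\nu_x}(\gamma_{k_s}-\gamma_{k_1})\nu_y^\top+\partial_{\nu_y}\gamma_{k_s}\,\nu_x^\top\big]u(y)\,ds_y\\ &+\Big(\frac{\rho_f\omega^2(k_2^2-q)}{k_1^2-k_2^2}-\frac{\rho_f^2\omega^4\alpha(\alpha-\beta)}{\beta(\lambda+2\mu)(k_1^2-k_2^2)}\Big)\int_\Gamma\partial_{\nu_x}\big[\gamma_{k_1}-\gamma_{k_2}\big]\nu_y^\top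 u(y)\,ds_y\\ &+\frac{\rho_f\omega^2\alpha}{\beta(k_1^2-k_2^2)}\int_\Gamma\partial_{\nu_x}\big[(k_p^2-k_1^2)\gamma_{k_1}-(k_p^2-k_2^2)\gamma_{k_2}\big]\nu_y^\top u(y)\,ds_y,\\ N_3^2(u)(x)=\;&-\rho_f\omega^2\int_\Gamma\nu_x^\top\big[2\mu E_{11}(x,y)-\gamma_{k_s}I\big]u(y)\,ds_y-\frac{2i\mu\omega\gamma}{(\lambda+2\mu)(k_1^2-k_2^2)}\int_\Gamma\big[k_1^2\gamma_{k_1}-k_2^2\gamma_{k_2}\big]\nu_x^\top u(y)\,ds_y,\\ N_3^3(u)(x)=\;&\frac{2i\mu\omega\gamma}{(\lambda+2\mu)(k_1^2-k_2^2)}\int_\Gamma u(y)\,\nabla_x^\top\big[\gamma_{k_1}-\gamma_{k_2}\big]\,ds_y \end{aligned}$$ (all $\gamma_k$ evaluated at $(x,y)$; $N_3^3(u)$ is matrix valued). Moreover $N_3^1,N_3^2,N_3^3$ are weakly singular: every component of their kernels is continuous for $x\ne y$ on $\Gamma$ and bounded there by $C|x-y|^{s-2}$ for some $C$ and some $s>0$.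 In particular the integrals in the identity converge absolutely, and the entries of $N_3^3(M(\partial,\nu)u)$ are differentiable on $\Gamma$. -/

import Mathlib

open scoped ContDiff Topology MeasureTheory Matrix

noncomputable section

namespace Poro

/-- Euclidean three-space. -/
abbrev E3 : Type := EuclideanSpace ℝ (Fin 3)

/-! ### The domain, its boundary and the outward normal -/

/-- `ψ` is a smooth function with non-zero gradient at `x` such that, near `x`, the set `Ω` is
`{ψ < 0}`. -/
def IsLocalDefiningFunction (Ω : Set E3) (x : E3) (ψ : E3 → ℝ) : Prop :=
  ContDiff ℝ ∞ ψ ∧ gradient ψ x ≠ 0 ∧ ∀ᶠ z in 𝓝 x, (z ∈ Ω ↔ ψ z < 0)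

/-- A bounded domain (non-empty connected open set) with smooth boundary. -/
structure IsSmoothBoundedDomain (Ω : Set E3) : Prop where
  isOpen : IsOpen Ω
  isConnected : IsConnected Ω
  isBounded : Bornology.IsBounded Ω
  smooth_boundary : ∀ x ∈ frontier Ω, ∃ ψ : E3 → ℝ, IsLocalDefiningFunction Ω x ψ

open Classical in
/-- The outward unit normal `∇ψ / |∇ψ|` at a boundary point, `ψ` being any local defining function
(the value does not depend on its choice). -/
def outwardNormal (Ω : Set E3) (x : E3) : E3 :=
  if h : ∃ ψ : E3 → ℝ, IsLocalDefiningFunction Ω x ψ then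
    ‖gradient h.choose x‖⁻¹ • gradient h.choose x
  else 0

/-- The surface measure `ds` on `Γ = ∂Ω`: the two-dimensional Hausdorff measure, normalised so
that it is Lebesgue measure on planes, restricted to `Γ`. -/
def surfaceMeasure (Ω : Set E3) : MeasureTheory.Measure E3 :=
  (μHE[2] : MeasureTheory.Measure E3).restrict (frontier Ω)

/-! ### Differential operators in space -/

/-- The partial derivative `∂_j f (x)`. -/
def pd (j : Fin 3) (f : E3 → ℂ) (x : E3) : ℂ :=
  fderiv ℝ f x (EuclideanSpace.single j 1)

/-- The derivative `n · ∇ f (x)` in the direction `n`. -/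
def dirDeriv (n : E3) (f : E3 → ℂ) (x : E3) : ℂ :=
  ∑ j, (n j : ℂ) * pd j f x

/-- The divergence of a vector field. -/
def divergence (u : E3 → Fin 3 → ℂ) (x : E3) : ℂ :=
  ∑ j, pd j (fun z => u z j) x

/-- The curl of a vector field. -/
def curl (u : E3 → Fin 3 → ℂ) (x : E3) : Fin 3 → ℂ :=
  ![pd 1 (fun z => u z 2) x - pd 2 (fun z => u z 1) x,
    pd 2 (fun z => u z 0) x - pd 0 (fun z => u z 2) x,
    pd 0 (fun z => u z 1) x - pd 1 (fun z => u z 0) x]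

/-- The Helmholtz fundamental solution `γ_k(x,y) = exp(ik|x-y|) / (4π|x-y|)`. -/
def helmholtz (k : ℂ) (x y : E3) : ℂ :=
  Complex.exp (Complex.I * k * (‖x - y‖ : ℂ)) / (4 * (Real.pi : ℂ) * (‖x - y‖ : ℂ))

/-! ### The poroelastic medium -/

/-- The physical parameters of a poroelastic medium together with the frequency `ω`. -/
structure Medium where
  /-- First Lamé parameter `λ`. -/
  lam : ℝ
  /-- Second Lamé parameter `μ`. -/
  mu : ℝ
  /-- Poisson ratio `ν_p`. -/
  nup : ℝ
  /-- Undrained Poisson ratio `ν_u`. -/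
  nuu : ℝ
  /-- Skempton pore-pressure coefficient `B`. -/
  B : ℝ
  /-- The constant `C` in the apparent mass density `ρ_a = C φ ρ_f`. -/
  C : ℝ
  /-- Porosity `φ`. -/
  phi : ℝ
  /-- Solid density `ρ_s`. -/
  rhos : ℝ
  /-- Fluid density `ρ_f`. -/
  rhof : ℝ
  /-- Permeability coefficient `κ`. -/
  kappa : ℝ
  /-- Frequency `ω`. -/
  omega : ℝ

namespace Medium

variable (P : Medium)

/-- The conditions on the Lamé parameters, and the non-vanishing of the parameters that occur in
denominators of the derived coefficients. -/
structure Admissible : Prop where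
  mu_pos : 0 < P.mu
  lame_pos : 0 < 3 * P.lam + 2 * P.mu
  nup_ne : 1 - 2 * P.nup ≠ 0
  nuu_ne : 1 - 2 * P.nuu ≠ 0
  nuu_ne' : 1 + P.nuu ≠ 0
  nuu_ne_nup : P.nuu ≠ P.nup
  B_ne : P.B ≠ 0
  phi_ne : P.phi ≠ 0
  rhof_ne : P.rhof ≠ 0
  kappa_ne : P.kappa ≠ 0
  omega_ne : P.omega ≠ 0

/-- Apparent mass density `ρ_a`. -/
def rhoa : ℝ := P.C * P.phi * P.rhof

/-- Bulk density `ρ`. -/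
def rho : ℝ := (1 - P.phi) * P.rhos + P.phi * P.rhof

/-- Compressibility `α`. -/
def alpha : ℝ := 3 * (P.nuu - P.nup) / (P.B * (1 - 2 * P.nup) * (1 + P.nuu))

/-- Constitutive coefficient `R`. -/
def R : ℝ :=
  2 * P.phi ^ 2 * P.mu * P.B ^ 2 * (1 - 2 * P.nup) * (1 + P.nuu) ^ 2
    / (9 * (P.nuu - P.nup) * (1 - 2 * P.nuu))

/-- The coefficient `β`. -/
def beta : ℂ :=
  (P.omega * P.phi ^ 2 * P.rhof * P.kappa : ℂ)
    / (Complex.I * (P.phi : ℂ) ^ 2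
        + (P.omega : ℂ) * P.kappa * ((P.rhoa : ℂ) + P.phi * P.rhof))

/-- The coefficient `q`. -/
def q : ℂ := (P.omega : ℂ) ^ 2 * (P.phi : ℂ) ^ 2 * P.rhof / (P.beta * P.R)

/-- The coefficient `γ`. -/
def gam : ℂ := -(Complex.I * P.omega * P.rhof * (P.alpha - P.beta) / P.beta)

/-- The coefficient `ε`. -/
def eps : ℂ :=
  Complex.I * P.omega * P.gam * (P.alpha - P.beta) / (P.q * (P.lam + 2 * P.mu))

/-- The wave number `k_p`. -/
def kp : ℂ := P.omega * ((P.rho - P.beta * P.rhof) / (P.lam + 2 * P.mu)) ^ (1 / 2 : ℂ)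

/-- The wave number `k_s`. -/
def ks : ℂ := P.omega * ((P.rho - P.beta * P.rhof) / P.mu) ^ (1 / 2 : ℂ)

/-- `k₁` and `k₂` are the wave numbers of the two compressional waves of the medium. -/
structure IsCompressionalPair (k1 k2 : ℂ) : Prop where
  sum_sq : k1 ^ 2 + k2 ^ 2 = P.q * (1 + P.eps) + P.kp ^ 2
  prod_sq : k1 ^ 2 * k2 ^ 2 = P.q * P.kp ^ 2
  im_nonneg₁ : 0 ≤ k1.im
  im_nonneg₂ : 0 ≤ k2.im

/-! ### The fundamental solution -/

variable (k1 k2 : ℂ)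

/-- The block `E₁₁`. -/
def E11 (x y : E3) : Matrix (Fin 3) (Fin 3) ℂ := fun i j =>
  (1 / (P.mu : ℂ)) * helmholtz P.ks x y * (1 : Matrix (Fin 3) (Fin 3) ℂ) i j
    + 1 / ((P.rho - P.beta * P.rhof) * (P.omega : ℂ) ^ 2)
      * pd i (fun z => pd j (fun w =>
          helmholtz P.ks w y
            - (P.kp ^ 2 - k2 ^ 2) / (k1 ^ 2 - k2 ^ 2) * helmholtz k1 w y
            + (P.kp ^ 2 - k1 ^ 2) / (k1 ^ 2 - k2 ^ 2) * helmholtz k2 w y) z) x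

/-- The block `E₁₂` (a column). -/
def E12 (x y : E3) : Fin 3 → ℂ := fun i =>
  Complex.I * P.omega * P.gam / ((P.lam + 2 * P.mu) * (k1 ^ 2 - k2 ^ 2))
    * pd i (fun z => helmholtz k1 z y - helmholtz k2 z y) x

/-- The block `E₂₁` (a column; its transpose is the lower left block). -/
def E21 (x y : E3) : Fin 3 → ℂ := fun i =>
  -((P.alpha - P.beta) / ((P.lam + 2 * P.mu) * (k1 ^ 2 - k2 ^ 2)))
    * pd i (fun z => helmholtz k1 z y - helmholtz k2 z y) x

/-- The entry `E₂₂`. -/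
def E22 (x y : E3) : ℂ :=
  -(1 / (k1 ^ 2 - k2 ^ 2))
    * ((P.kp ^ 2 - k1 ^ 2) * helmholtz k1 x y - (P.kp ^ 2 - k2 ^ 2) * helmholtz k2 x y)

/-- The fundamental solution `E = [E₁₁, E₁₂; E₂₁ᵀ, E₂₂]`. The indices `Sum.inl i` are those of the
displacement, `Sum.inr ()` is that of the pressure. -/
def fundSol (x y : E3) : Matrix (Fin 3 ⊕ Unit) (Fin 3 ⊕ Unit) ℂ :=
  Matrix.fromBlocks (P.E11 k1 k2 x y) (Matrix.of fun i _ => P.E12 k1 k2 x y i)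
    (Matrix.of fun _ j => P.E21 k1 k2 x y j) (Matrix.of fun _ _ => P.E22 k1 k2 x y)

/-! ### Boundary operators -/

/-- The traction `T(∂,n)u = 2μ ∂_n u + λ n (∇·u) + μ n × (∇×u)` at `x`. -/
def traction (n : E3) (u : E3 → Fin 3 → ℂ) (x : E3) : Fin 3 → ℂ := fun i =>
  2 * P.mu * dirDeriv n (fun z => u z i) x + P.lam * n i * divergence u x
    + P.mu * (crossProduct (fun j => (n j : ℂ)) (curl u x)) i

/-- The poroelastic boundary operator `T̃(∂,n)`. -/
def boundaryOp (n : E3) (U : E3 → Fin 3 ⊕ Unit → ℂ) (x : E3) : Fin 3 ⊕ Unit → ℂ :=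
  Sum.elim
    (fun i => P.traction n (fun z j => U z (Sum.inl j)) x i - P.alpha * n i * U x (Sum.inr ()))
    (fun _ => -(P.rhof * (P.omega : ℂ) ^ 2) * (∑ i, (n i : ℂ) * U x (Sum.inl i))
      + dirDeriv n (fun z => U z (Sum.inr ())) x)

/-- The adjoint boundary operator `T̃*(∂,n)`. -/
def adjBoundaryOp (n : E3) (U : E3 → Fin 3 ⊕ Unit → ℂ) (x : E3) : Fin 3 ⊕ Unit → ℂ :=
  Sum.elim
    (fun i => P.traction n (fun z j => U z (Sum.inl j)) x i
      - P.rhof * (P.omega : ℂ) ^ 2 * P.alpha / P.beta * n i * U x (Sum.inr ()))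
    (fun _ => -P.beta * (∑ i, (n i : ℂ) * U x (Sum.inl i))
      + dirDeriv n (fun z => U z (Sum.inr ())) x)

variable (Ω : Set E3)

/-- The kernel `(T̃*(∂_y,ν_y) E(x,y))ᵀ` of the double layer; `T̃*` acts on the columns of `E`. -/
def doubleLayerKernel (x y : E3) : Matrix (Fin 3 ⊕ Unit) (Fin 3 ⊕ Unit) ℂ :=
  (Matrix.of fun a b =>
    P.adjBoundaryOp (outwardNormal Ω y) (fun w c => P.fundSol k1 k2 x w c b) y a)ᵀ

/-- The kernel `T̃(∂_x,ν_x) (T̃*(∂_y,ν_y) E(x,y))ᵀ` of the hyper-singular operator `N`; `T̃` acts on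
the columns of the double layer kernel. -/
def hyperKernel (x y : E3) : Matrix (Fin 3 ⊕ Unit) (Fin 3 ⊕ Unit) ℂ :=
  Matrix.of fun a b =>
    P.boundaryOp (outwardNormal Ω x) (fun z c => P.doubleLayerKernel k1 k2 Ω z y c b) x a

end Medium

/-! ### Hadamard finite parts and the operator `N` -/

/-- `L` is the Hadamard finite part, as `ε → 0+`, of `I ε`: the limit that remains after the
divergent terms, a multiple of `1/ε` and a multiple of `log ε`, are discarded. If `I` converges,
it is the limit of `I`, that is, the principal value. -/
def HasFinitePart (I : ℝ → ℂ) (L : ℂ) : Prop :=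
  ∃ a b : ℂ, Filter.Tendsto (fun ε : ℝ => I ε - a / (ε : ℂ) - b * (Real.log ε : ℂ))
    (𝓝[>] 0) (𝓝 L)

namespace Medium

variable (P : Medium) (k1 k2 : ℂ) (Ω : Set E3)

/-- `V` is the component `a` of `N(U)(x)`, `x ∈ Γ`: the Hadamard finite part, as `ε → 0+`, of that
component of `∫_{Γ, |y-x| ≥ ε} T̃(∂_x,ν_x)(T̃*(∂_y,ν_y)E(x,y))ᵀ U(y) ds_y`. -/
def HasHyperSingularValue (U : E3 → Fin 3 ⊕ Unit → ℂ) (x : E3) (a : Fin 3 ⊕ Unit) (V : ℂ) : Prop :=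
  HasFinitePart
    (fun ε => ∫ y in (Metric.ball x ε)ᶜ, (P.hyperKernel k1 k2 Ω x y *ᵥ U y) a ∂(surfaceMeasure Ω))
    V

/-- `V` is the value at `x ∈ Γ` of `N₃(u)`, where `N₃` is the block of `N = [N₁, N₂; N₃, N₄]` that
sends displacements to the pressure component: the pressure component of `N((u,0))`. -/
def HasN3Value (u : E3 → Fin 3 → ℂ) (x : E3) (V : ℂ) : Prop :=
  P.HasHyperSingularValue k1 k2 Ω (fun y => Sum.elim (u y) 0) x (Sum.inr ()) V

end Medium

/-! ### Günter derivatives on the surface -/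

/-- The entry `m_ij = ν_j ∂_i - ν_i ∂_j` of the Günter derivative
`M(∂,ν)u = ∂_ν u - ν (∇·u) + ν × curl u`. It is the derivative along the tangent vector
`ν_j e_i - ν_i e_j`, hence only involves the values of `f` on the surface. -/
def gunterEntry (Ω : Set E3) (i j : Fin 3) (f : E3 → ℂ) (x : E3) : ℂ :=
  fderivWithin ℝ f (frontier Ω) x
    (outwardNormal Ω x j • EuclideanSpace.single i (1 : ℝ)
      - outwardNormal Ω x i • EuclideanSpace.single j (1 : ℝ))

/-- The Günter derivative `M(∂,ν)u` of a vector field on the surface. -/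
def gunter (Ω : Set E3) (u : E3 → Fin 3 → ℂ) (x : E3) : Fin 3 → ℂ := fun i =>
  ∑ j, gunterEntry Ω i j (fun z => u z j) x

/-- The scalar `M(∂,ν) : A = ∑ m_ij A_ij` for a matrix field `A` on the surface. -/
def gunterColon (Ω : Set E3) (A : E3 → Matrix (Fin 3) (Fin 3) ℂ) (x : E3) : ℂ :=
  ∑ i, ∑ j, gunterEntry Ω i j (fun z => A z i j) x

/-! ### Weakly singular kernels and the operators `N₃¹`, `N₃²`, `N₃³` -/

/-- `K` is a weakly singular kernel on the surface `Γ`: it is continuous off the diagonal and bounded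
by `C |x-y|^(s-2)` for some `s > 0`. -/
def IsWeaklySingular (Γ : Set E3) (K : E3 → E3 → ℂ) : Prop :=
  ContinuousOn (fun z : E3 × E3 => K z.1 z.2) {z | z.1 ∈ Γ ∧ z.2 ∈ Γ ∧ z.1 ≠ z.2} ∧
    ∃ C s : ℝ, 0 < s ∧ ∀ x ∈ Γ, ∀ y ∈ Γ, x ≠ y → ‖K x y‖ ≤ C * dist x y ^ (s - 2)

namespace Medium

variable (P : Medium) (k1 k2 : ℂ) (Ω : Set E3)

/-- The kernel (a row vector) of `N₃¹`. -/
def kerN31 (x y : E3) : Fin 3 → ℂ := fun j =>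
  Complex.I * P.omega * P.gam / (k1 ^ 2 - k2 ^ 2)
      * dirDeriv (outwardNormal Ω x)
          (fun z => k1 ^ 2 * helmholtz k1 z y - k2 ^ 2 * helmholtz k2 z y) x
      * outwardNormal Ω y j
    - P.rhof * (P.omega : ℂ) ^ 2
      * (dirDeriv (outwardNormal Ω x) (fun z => helmholtz P.ks z y - helmholtz k1 z y) x
            * outwardNormal Ω y j
          + dirDeriv (outwardNormal Ω y) (fun w => helmholtz P.ks x w) y * outwardNormal Ω x j)
    + (P.rhof * (P.omega : ℂ) ^ 2 * (k2 ^ 2 - P.q) / (k1 ^ 2 - k2 ^ 2)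
        - (P.rhof : ℂ) ^ 2 * (P.omega : ℂ) ^ 4 * P.alpha * (P.alpha - P.beta)
          / (P.beta * (P.lam + 2 * P.mu) * (k1 ^ 2 - k2 ^ 2)))
      * dirDeriv (outwardNormal Ω x) (fun z => helmholtz k1 z y - helmholtz k2 z y) x
      * outwardNormal Ω y j
    + P.rhof * (P.omega : ℂ) ^ 2 * P.alpha / (P.beta * (k1 ^ 2 - k2 ^ 2))
      * dirDeriv (outwardNormal Ω x)
          (fun z => (P.kp ^ 2 - k1 ^ 2) * helmholtz k1 z y
            - (P.kp ^ 2 - k2 ^ 2) * helmholtz k2 z y) x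
      * outwardNormal Ω y j

/-- The kernel (a row vector) of `N₃²`. -/
def kerN32 (x y : E3) : Fin 3 → ℂ := fun j =>
  -(P.rhof * (P.omega : ℂ) ^ 2)
      * (∑ i, (outwardNormal Ω x i : ℂ)
          * (2 * P.mu * P.E11 k1 k2 x y i j
              - helmholtz P.ks x y * (1 : Matrix (Fin 3) (Fin 3) ℂ) i j))
    - 2 * Complex.I * P.mu * P.omega * P.gam / ((P.lam + 2 * P.mu) * (k1 ^ 2 - k2 ^ 2))
      * (k1 ^ 2 * helmholtz k1 x y - k2 ^ 2 * helmholtz k2 x y) * outwardNormal Ω x j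

/-- The kernel (a row vector) of `N₃³`. -/
def kerN33 (x y : E3) : Fin 3 → ℂ := fun j =>
  2 * Complex.I * P.mu * P.omega * P.gam / ((P.lam + 2 * P.mu) * (k1 ^ 2 - k2 ^ 2))
    * pd j (fun z => helmholtz k1 z y - helmholtz k2 z y) x

/-- The operator `N₃¹`, from vector fields to scalar fields. -/
def N31 (u : E3 → Fin 3 → ℂ) (x : E3) : ℂ :=
  ∫ y, P.kerN31 k1 k2 Ω x y ⬝ᵥ u y ∂(surfaceMeasure Ω)

/-- The operator `N₃²`, from vector fields to scalar fields. -/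
def N32 (u : E3 → Fin 3 → ℂ) (x : E3) : ℂ :=
  ∫ y, P.kerN32 k1 k2 Ω x y ⬝ᵥ u y ∂(surfaceMeasure Ω)

/-- The operator `N₃³`, from vector fields to matrix fields: the integral of
`u(y) ∇_xᵀ[γ_{k₁}(x,y) - γ_{k₂}(x,y)]` times a constant. -/
def N33 (u : E3 → Fin 3 → ℂ) (x : E3) : Matrix (Fin 3) (Fin 3) ℂ := fun i j =>
  ∫ y, u y i * P.kerN33 k1 k2 x y j ∂(surfaceMeasure Ω)

end Medium

end Poro

end

open MeasureTheory Set Filter Metric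

noncomputable section

namespace Poro

/-! For a displacement, the last row of the kernel of `N` contains third derivatives of combinations
of Helmholtz kernels. They are of order `|x-y|⁻²`, just too singular for absolute integration over a
surface. The theorem holds because this worst part is a tangential derivative in `y`. Write the
traction as `T = 2μ M + (λ+2μ) ν div - μ ν × curl`, and use `Δγ_k = -k² γ_k` together with `μ k_s² =
(λ+2μ) k_p² = ω²(ρ - β ρ_f)` and `k₁² k₂² = q k_p²`. For `x ≠ y` and the component `u_j` the kernel
is then `kerN31` minus the sum over `i, l` of `ν_i(x) (ν_l(y) ∂_j - ν_j(y) ∂_l) K_il(x-y)`, where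
`K` is `kerK` (`kernel_component_identity`).

Both pieces are of order `1/|x-y|`. `K` involves Hessians only of combinations of Helmholtz kernels
whose coefficients sum to zero, so the leading singularities, which do not depend on the wave
number, cancel (`exists_comb_bound`). `kerN31` contains only normal derivatives of the `γ_k`, and
`|ν(x)·(x-y)| ≤ C|x-y|²` on a smooth surface (`exists_inner_normal_le`).

The product rule trades the derivative of `K` for `K (Mu)` plus exact terms `m^{jl}(K_il u_j)`
(`hyperKernel_mulVec`). The former is integrable. In it, the Hessian of `γ_{k₁} - γ_{k₂}` contracted
with `ν(x)` is a tangential derivative in `x` plus `ν(x)` times a Laplacian: the tangential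
derivative is pulled out of the integral and gives `M : N₃³`, the rest is `N₃²` (`integral_kerK`).

It remains to see that the exact terms, integrated over `|y-x| ≥ ε`, tend to zero. No boundary curve
is parametrised. For a radial factor `φ(|y-x|²)`, Stokes' formula on the closed surface
(`integral_gunterEntry`) is applied to `φ(max(|y-x|², ε²)) G`; the boundary term becomes `-φ(ε²)`
times the integral of `m^{jl} G` over the small ball. For the part of `K` with `φ(ε²) = O(1/ε)` the
area `O(ε²)` of the ball suffices. For the part `ψ(|d|²) d_a d_b`, with `d = x-y` and `ψ(ε²) =
O(ε⁻³)`, the crude bound `O(ε³)` does not, and one needs that the first moment of a small surface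
ball is `o(ε³)` (`isLittleO_first_moment`), which again follows from Stokes' formula. Hence the
finite part is an honest limit.

Since the surface measure is a Hausdorff measure, all of this rests on graph charts
(`exists_surfaceChart`) and an area formula for them (`comap_euclideanHausdorffMeasure`). -/

/-- The Euclidean plane. -/
abbrev E2 : Type := EuclideanSpace ℝ (Fin 2)

/-! ### The area formula: Hausdorff measure of a parametrised surface. -/

/-- The cross product in Euclidean three-space. -/
def cross (a b : E3) : E3 :=
  !₂[a 1 * b 2 - a 2 * b 1, a 2 * b 0 - a 0 * b 2, a 0 * b 1 - a 1 * b 0]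

lemma inner_E3 (a b : E3) : inner ℝ a b = a 0 * b 0 + a 1 * b 1 + a 2 * b 2 := by
  simp [PiLp.inner_apply, Fin.sum_univ_three, mul_comm]

lemma norm_sq_E3 (a : E3) : ‖a‖ ^ 2 = a 0 ^ 2 + a 1 ^ 2 + a 2 ^ 2 := by
  rw [← real_inner_self_eq_norm_sq, inner_E3]; ring

lemma norm_sq_E2 (v : E2) : ‖v‖ ^ 2 = v 0 ^ 2 + v 1 ^ 2 := by
  simp [EuclideanSpace.norm_sq_eq, Fin.sum_univ_two]

/-- The normal vector `∂₁Φ × ∂₂Φ` of a parametrised surface. -/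
def areaVec (Φ : E2 → E3) (p : E2) : E3 :=
  cross (fderiv ℝ Φ p (EuclideanSpace.single 0 1)) (fderiv ℝ Φ p (EuclideanSpace.single 1 1))

lemma norm_cross_sq (a b : E3) :
    ‖cross a b‖ ^ 2 = ‖a‖ ^ 2 * ‖b‖ ^ 2 - inner ℝ a b ^ 2 := by
  simp only [norm_sq_E3, inner_E3, cross]
  simp
  ring

lemma continuous_cross {X : Type*} [TopologicalSpace X] {f g : X → E3} (hf : Continuous f)
    (hg : Continuous g) : Continuous fun x => cross (f x) (g x) := by
  unfold cross
  have h : ∀ i, Continuous fun x => f x i := fun i => by fun_prop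
  have h' : ∀ i, Continuous fun x => g x i := fun i => by fun_prop
  refine (PiLp.continuous_toLp 2 _).comp (continuous_pi fun i => ?_)
  fin_cases i <;> simp <;> fun_prop

lemma continuous_areaVec {Φ : E2 → E3} (hΦ : ContDiff ℝ 1 Φ) : Continuous (areaVec Φ) := by
  have := hΦ.continuous_fderiv one_ne_zero
  exact continuous_cross (by fun_prop) (by fun_prop)

lemma E2_decomp (v : E2) :
    v = v 0 • EuclideanSpace.single 0 (1 : ℝ) + v 1 • EuclideanSpace.single 1 (1 : ℝ) := by
  ext i; fin_cases i <;> simp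

/-- A linear map from the plane to space is, up to an isometry, an endomorphism of the plane whose
determinant is the area of the image of the unit square. -/
lemma exists_endomorphism_of_immersion (A : E2 →L[ℝ] E3) (hA : ∀ v, ‖v‖ ≤ ‖A v‖) :
    ∃ M : E2 →L[ℝ] E2, (∀ v, ‖M v‖ = ‖A v‖) ∧
      |LinearMap.det (M : E2 →ₗ[ℝ] E2)|
        = ‖cross (A (EuclideanSpace.single 0 1)) (A (EuclideanSpace.single 1 1))‖ := by
  set a := A (EuclideanSpace.single 0 1)
  set b := A (EuclideanSpace.single 1 1)
  have ha : 0 < ‖a‖ := lt_of_lt_of_le (by simp) (hA (EuclideanSpace.single 0 1))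
  -- The upper triangular Gram–Schmidt factor of the pair `(a, b)`. By Lagrange's identity for `‖a ×
  -- b‖²` it has the same Gram matrix as `(a, b)`.
  set m : Matrix (Fin 2) (Fin 2) ℝ := !![‖a‖, inner ℝ a b / ‖a‖; 0, ‖cross a b‖ / ‖a‖]
  refine ⟨LinearMap.toContinuousLinearMap (Matrix.toEuclideanLin m), fun v => ?_, ?_⟩
  · rw [← sq_eq_sq₀ (norm_nonneg _) (norm_nonneg _), norm_sq_E2]
    have hv : A v = v 0 • a + v 1 • b := by
      conv_lhs => rw [E2_decomp v]
      simp [a, b]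
    rw [hv, norm_add_sq_real, norm_smul, norm_smul, mul_pow, mul_pow, inner_smul_left,
      inner_smul_right]
    have hc := norm_cross_sq a b
    simp [m, Matrix.toEuclideanLin, Matrix.mulVec, dotProduct, Fin.sum_univ_two]
    field_simp
    rw [hc]
    ring
  · have : LinearMap.det ((LinearMap.toContinuousLinearMap (Matrix.toEuclideanLin m) :
        E2 →L[ℝ] E2) : E2 →ₗ[ℝ] E2) = m.det := by
      simp [Matrix.toEuclideanLin_eq_toLin_orthonormal]
    rw [this, Matrix.det_fin_two]
    simp [m, abs_div]
    field_simp

section Hausdorff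

variable {X Y Z : Type*} [Nonempty X] [EMetricSpace Y] [MeasurableSpace Y] [BorelSpace Y]
  [EMetricSpace Z] [MeasurableSpace Z] [BorelSpace Z]

/-- The estimate forces `g` to be constant on the fibres of `f` in `S`, so `f p ↦ g p` is a
well-defined `K`-Lipschitz map of `f '' S` onto `g '' S`, even if `f` is not injective. Such a map
increases `d`-dimensional measure by at most `K ^ d`. -/
lemma euclideanHausdorffMeasure_image_le_of_edist_le {f : X → Y} {g : X → Z} {S : Set X}
    {K : NNReal} (d : ℕ) (h : ∀ p ∈ S, ∀ q ∈ S, edist (g p) (g q) ≤ K * edist (f p) (f q)) :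
    (μHE[d] : Measure Z) (g '' S) ≤ K ^ d * (μHE[d] : Measure Y) (f '' S) := by
  have hinv : ∀ p ∈ S, Function.invFunOn f S (f p) ∈ S ∧ f (Function.invFunOn f S (f p)) = f p :=
    fun p hp => Function.invFunOn_pos ⟨p, hp, rfl⟩
  have hL : LipschitzOnWith K (fun y => g (Function.invFunOn f S y)) (f '' S) := by
    rintro _ ⟨p, hp, rfl⟩ _ ⟨q, hq, rfl⟩
    have := h _ (hinv p hp).1 _ (hinv q hq).1
    rwa [(hinv p hp).2, (hinv q hq).2] at this
  have himg : (fun y => g (Function.invFunOn f S y)) '' (f '' S) = g '' S := by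
    rw [image_image]
    refine image_congr fun p hp => ?_
    have := h _ (hinv p hp).1 _ hp
    rw [(hinv p hp).2, edist_self, mul_zero] at this
    exact edist_le_zero.1 this
  have := hL.hausdorffMeasure_image_le (d := (d : ℝ)) (by positivity)
  rw [himg] at this
  simp only [Measure.euclideanHausdorffMeasure_def, Measure.smul_apply, ENNReal.smul_def,
    smul_eq_mul, ENNReal.rpow_natCast] at this ⊢
  calc _ ≤ _ * ((K : ENNReal) ^ d * μH[d] (f '' S)) := by gcongr
    _ = _ := by ring

end Hausdorff

/-- If, near every point, a measure is bounded by a multiple of another one, then so it is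
globally. -/
lemma measure_le_smul_of_locally {X : Type*} [TopologicalSpace X] [SecondCountableTopology X]
    [MeasurableSpace X] [OpensMeasurableSpace X] {μ ν : Measure X} {c : ENNReal}
    (h : ∀ x, ∃ U ∈ 𝓝 x, ∀ S ⊆ U, MeasurableSet S → μ S ≤ c * ν S) : μ ≤ c • ν := by
  choose U hU h using h
  obtain ⟨s, hs, hcov⟩ := TopologicalSpace.countable_cover_nhds
    (fun x => interior_mem_nhds.2 (hU x))
  refine Measure.le_iff.2 fun S hS => ?_
  rcases s.eq_empty_or_nonempty with rfl | hne
  · have : (univ : Set X) = ∅ := by rw [← hcov]; simp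
    have : S = ∅ := by rw [← subset_empty_iff, ← this]; exact subset_univ _
    simp [this]
  obtain ⟨e, rfl⟩ := hs.exists_eq_range hne
  -- A countable family of good neighbourhoods covers the space; made disjoint, it cuts `S` into
  -- pieces on which the local bound applies.
  set V : ℕ → Set X := disjointed fun n => interior (U (e n))
  have hVm : ∀ n, MeasurableSet (V n) := fun n =>
    MeasurableSet.disjointed (fun n => isOpen_interior.measurableSet) n
  have hVd : Pairwise (Function.onFun Disjoint fun n => S ∩ V n) := fun i j hij =>
    ((disjoint_disjointed _ hij).mono inter_subset_right inter_subset_right)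
  have hS' : S = ⋃ n, S ∩ V n := by
    rw [← inter_iUnion, iUnion_disjointed]
    rw [biUnion_range] at hcov
    rw [hcov, inter_univ]
  have hm : ∀ n, MeasurableSet (S ∩ V n) := fun n => hS.inter (hVm n)
  rw [hS', Measure.smul_apply, measure_iUnion hVd hm, measure_iUnion hVd hm, smul_eq_mul,
    ← ENNReal.tsum_mul_left]
  refine ENNReal.tsum_le_tsum fun n => h (e n) _ ?_ (hm n)
  exact inter_subset_right.trans ((disjointed_subset _ n).trans interior_subset)

/-- Let `K` decrease to 1. The exponent 3 is what the area formula produces: two powers from a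
bilipschitz comparison in dimension two and one from the oscillation of the area density. -/
lemma measure_eq_of_le_smul {X : Type*} [MeasurableSpace X] {μ ν : Measure X}
    (h : ∀ K : NNReal, 1 < K → μ ≤ ((K : ENNReal) ^ 3) • ν ∧ ν ≤ ((K : ENNReal) ^ 3) • μ) :
    μ = ν := by
  have key : ∀ a b : ENNReal, (∀ K : NNReal, 1 < K → a ≤ (K : ENNReal) ^ 3 * b) → a ≤ b := by
    intro a b hab
    have ht : Tendsto (fun K : NNReal => (K : ENNReal) ^ 3 * b) (𝓝[>] 1) (𝓝 (1 ^ 3 * b)) := by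
      refine ENNReal.Tendsto.mul_const (Tendsto.mono_left ?_ nhdsWithin_le_nhds) (by simp)
      have : Continuous fun K : NNReal => (K : ENNReal) ^ 3 := by fun_prop
      simpa using this.tendsto 1
    rw [one_pow, one_mul] at ht
    exact ge_of_tendsto ht (eventually_mem_nhdsWithin.mono fun K hK => hab K hK)
  refine le_antisymm (Measure.le_iff.2 fun S hS => ?_) (Measure.le_iff.2 fun S hS => ?_)
  · exact key _ _ fun K hK => by simpa using Measure.le_iff.1 (h K hK).1 S hS
  · exact key _ _ fun K hK => by simpa using Measure.le_iff.1 (h K hK).2 S hS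

lemma areaVec_ne_zero {Φ : E2 → E3} {p : E2} (h : ∀ v, ‖v‖ ≤ ‖fderiv ℝ Φ p v‖) :
    areaVec Φ p ≠ 0 := by
  obtain ⟨M, hM, hdet⟩ := exists_endomorphism_of_immersion _ h
  have hinj : LinearMap.ker (M : E2 →ₗ[ℝ] E2) = ⊥ := by
    refine LinearMap.ker_eq_bot'.2 fun v hv => ?_
    have h1 := hM v
    have : M v = 0 := hv
    rw [this, norm_zero] at h1
    exact norm_le_zero_iff.1 (h1 ▸ h v)
  have : LinearMap.det (M : E2 →ₗ[ℝ] E2) ≠ 0 := fun h0 =>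
    (LinearMap.bot_lt_ker_of_det_eq_zero h0).ne hinj.symm
  intro h0
  rw [show cross _ _ = areaVec Φ p from rfl, h0, norm_zero, abs_eq_zero] at hdet
  exact this hdet

/-- Near a point, a parametrised surface almost has the area of its tangent map. -/
lemma exists_nhds_area_le {Φ : E2 → E3} (hΦ : ContDiff ℝ 1 Φ)
    (hlow : ∀ p v, ‖v‖ ≤ ‖fderiv ℝ Φ p v‖) (p₀ : E2) {K : NNReal} (hK : 1 < K) :
    ∃ U ∈ 𝓝 p₀, ∀ S ⊆ U,
      (μHE[2] : Measure E3) (Φ '' S) ≤ K ^ 2 * (ENNReal.ofReal ‖areaVec Φ p₀‖ * volume S) ∧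
      ENNReal.ofReal ‖areaVec Φ p₀‖ * volume S ≤ K ^ 2 * (μHE[2] : Measure E3) (Φ '' S) := by
  set A := fderiv ℝ Φ p₀
  obtain ⟨M, hM, hdet⟩ := exists_endomorphism_of_immersion A (hlow p₀)
  have hK0 : (0 : ℝ) < K := lt_trans one_pos hK
  have hK1 : (1 : ℝ) < K := hK
  -- With this error constant in strict differentiability, chords of `Φ` have between `K⁻¹` and `2 -
  -- K⁻¹` times the length of the corresponding chords of `M`, and `2 - K⁻¹ ≤ K`. The error `η ‖p -
  -- q‖` can be measured by `‖M p - M q‖` because the tangent map does not shrink vectors.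
  set η : NNReal := 1 - K⁻¹
  have hη : (η : ℝ) = 1 - (K : ℝ)⁻¹ := by
    rw [NNReal.coe_sub (inv_le_one_of_one_le₀ hK.le)]; simp
  have hηpos : 0 < η := by
    rw [← NNReal.coe_pos, hη, sub_pos]; exact inv_lt_one_of_one_lt₀ hK1
  have hst : HasStrictFDerivAt Φ A p₀ := hΦ.contDiffAt.hasStrictFDerivAt one_ne_zero
  obtain ⟨U, hU, happ⟩ := hst.approximates_deriv_on_nhds (Or.inr hηpos)
  refine ⟨U, hU, fun S hS => ?_⟩
  have hvol : (μHE[2] : Measure E2) (M '' S) = ENNReal.ofReal ‖areaVec Φ p₀‖ * volume S := by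
    rw [EuclideanSpace.euclideanHausdorffMeasure_eq_volume]
    have := Measure.addHaar_image_continuousLinearMap (volume : Measure E2) M S
    rw [this]
    congr 2
  have hest : ∀ p ∈ S, ∀ q ∈ S, ‖Φ p - Φ q - A (p - q)‖ ≤ η * ‖M p - M q‖ := fun p hp q hq => by
    refine (happ p (hS hp) q (hS hq)).trans ?_
    rw [← map_sub, hM]
    exact mul_le_mul_of_nonneg_left (hlow _ _) η.2
  have hMA : ∀ p q, ‖A (p - q)‖ = ‖M p - M q‖ := fun p q => by rw [← map_sub, hM]
  rw [← hvol]
  constructor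
  · refine euclideanHausdorffMeasure_image_le_of_edist_le 2 fun p hp q hq => ?_
    rw [edist_dist, edist_dist, ← ENNReal.ofReal_coe_nnreal, ← ENNReal.ofReal_mul K.coe_nonneg]
    refine ENNReal.ofReal_le_ofReal ?_
    rw [dist_eq_norm, dist_eq_norm]
    have h1 := norm_add_le (Φ p - Φ q - A (p - q)) (A (p - q))
    rw [sub_add_cancel] at h1
    have h2 := hest p hp q hq
    rw [hMA] at h1
    rw [hη] at h2
    have h3 : (2 - (K : ℝ)⁻¹) ≤ K := by
      have h4 : (K : ℝ) * (K : ℝ)⁻¹ = 1 := mul_inv_cancel₀ hK0.ne'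
      have h5 : 0 < (K : ℝ)⁻¹ := by positivity
      nlinarith [sq_nonneg ((K : ℝ) - 1)]
    nlinarith [mul_le_mul_of_nonneg_right h3 (norm_nonneg (M p - M q))]
  · refine euclideanHausdorffMeasure_image_le_of_edist_le 2 fun p hp q hq => ?_
    rw [edist_dist, edist_dist, ← ENNReal.ofReal_coe_nnreal, ← ENNReal.ofReal_mul K.coe_nonneg]
    refine ENNReal.ofReal_le_ofReal ?_
    rw [dist_eq_norm, dist_eq_norm]
    have h1 := norm_sub_norm_le (A (p - q)) (A (p - q) - (Φ p - Φ q))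
    have h2 := hest p hp q hq
    rw [norm_sub_rev] at h2
    rw [sub_sub_cancel, hMA] at h1
    rw [hη] at h2
    have h3 : (K : ℝ)⁻¹ * ‖M p - M q‖ ≤ ‖Φ p - Φ q‖ := by linarith
    rwa [inv_mul_le_iff₀ hK0] at h3

/-- The area formula for parametrised surfaces that do not shrink distances. -/
lemma comap_euclideanHausdorffMeasure {Φ : E2 → E3} (hΦ : ContDiff ℝ 1 Φ)
    (hanti : AntilipschitzWith 1 Φ) (hlow : ∀ p v, ‖v‖ ≤ ‖fderiv ℝ Φ p v‖) :
    (μHE[2] : Measure E3).comap Φ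
      = (volume : Measure E2).withDensity fun p => ENNReal.ofReal ‖areaVec Φ p‖ := by
  have hemb : MeasurableEmbedding Φ :=
    hΦ.continuous.measurableEmbedding hanti.injective
  have hJ : Continuous fun p => ‖areaVec Φ p‖ := (continuous_areaVec hΦ).norm
  have hJm : Measurable fun p => ENNReal.ofReal ‖areaVec Φ p‖ := hJ.measurable.ennreal_ofReal
  have hloc : ∀ K : NNReal, 1 < K → ∀ p₀, ∃ U ∈ 𝓝 p₀, ∀ S ⊆ U, MeasurableSet S →
      (μHE[2] : Measure E3).comap Φ S ≤ (K : ENNReal) ^ 3 *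
        (volume : Measure E2).withDensity (fun p => ENNReal.ofReal ‖areaVec Φ p‖) S ∧
      (volume : Measure E2).withDensity (fun p => ENNReal.ofReal ‖areaVec Φ p‖) S
        ≤ (K : ENNReal) ^ 3 * (μHE[2] : Measure E3).comap Φ S := by
    intro K hK p₀
    have hK1 : (1 : ℝ) < K := hK
    have hpos : 0 < ‖areaVec Φ p₀‖ := norm_pos_iff.2 (areaVec_ne_zero (hlow p₀))
    obtain ⟨U, hU, hUS⟩ := exists_nhds_area_le hΦ hlow p₀ hK
    -- The density is continuous and non-zero at `p₀`, so near `p₀` it varies by a factor of at most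
    -- `K`. This is the third power of `K`.
    have h1 : ∀ᶠ p in 𝓝 p₀, ‖areaVec Φ p‖ < K * ‖areaVec Φ p₀‖ :=
      hJ.continuousAt.eventually_lt continuousAt_const (by nlinarith)
    have h2 : ∀ᶠ p in 𝓝 p₀, ‖areaVec Φ p₀‖ < K * ‖areaVec Φ p‖ :=
      continuousAt_const.eventually_lt (hJ.continuousAt.const_mul _) (by nlinarith)
    refine ⟨U ∩ {p | ‖areaVec Φ p‖ < K * ‖areaVec Φ p₀‖ ∧ ‖areaVec Φ p₀‖ < K * ‖areaVec Φ p‖},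
      inter_mem hU (h1.and h2), fun S hS hSm => ?_⟩
    obtain ⟨ha, hb⟩ := hUS S (hS.trans inter_subset_left)
    have hJ1 : ∀ p ∈ S, ENNReal.ofReal ‖areaVec Φ p‖ ≤ K * ENNReal.ofReal ‖areaVec Φ p₀‖ := by
      intro p hp
      rw [← ENNReal.ofReal_coe_nnreal, ← ENNReal.ofReal_mul K.coe_nonneg]
      exact ENNReal.ofReal_le_ofReal (hS hp).2.1.le
    have hJ2 : ∀ p ∈ S, ENNReal.ofReal ‖areaVec Φ p₀‖ ≤ K * ENNReal.ofReal ‖areaVec Φ p‖ := by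
      intro p hp
      rw [← ENNReal.ofReal_coe_nnreal, ← ENNReal.ofReal_mul K.coe_nonneg]
      exact ENNReal.ofReal_le_ofReal (hS hp).2.2.le
    rw [hemb.comap_apply, withDensity_apply _ hSm]
    have hi1 : ∫⁻ p in S, ENNReal.ofReal ‖areaVec Φ p‖
        ≤ K * (ENNReal.ofReal ‖areaVec Φ p₀‖ * volume S) := by
      refine (setLIntegral_mono measurable_const hJ1).trans ?_
      rw [setLIntegral_const, mul_assoc]
    have hi2 : ENNReal.ofReal ‖areaVec Φ p₀‖ * volume S
        ≤ K * ∫⁻ p in S, ENNReal.ofReal ‖areaVec Φ p‖ := by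
      rw [← setLIntegral_const, ← lintegral_const_mul _ hJm]
      exact setLIntegral_mono (hJm.const_mul _) hJ2
    constructor
    · calc _ ≤ _ := ha
        _ ≤ (K : ENNReal) ^ 2 * (K * ∫⁻ p in S, ENNReal.ofReal ‖areaVec Φ p‖) := by gcongr
        _ = _ := by ring
    · calc _ ≤ _ := hi1
        _ ≤ K * ((K : ENNReal) ^ 2 * (μHE[2] : Measure E3) (Φ '' S)) := by gcongr
        _ = _ := by ring
  refine measure_eq_of_le_smul fun K hK => ⟨?_, ?_⟩
  · exact measure_le_smul_of_locally fun p => by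
      obtain ⟨U, hU, h⟩ := hloc K hK p
      exact ⟨U, hU, fun S hS hm => (h S hS hm).1⟩
  · exact measure_le_smul_of_locally fun p => by
      obtain ⟨U, hU, h⟩ := hloc K hK p
      exact ⟨U, hU, fun S hS hm => (h S hS hm).2⟩

/-! ### Local defining functions and the outward normal. -/

lemma fderiv_eq_inner_gradient {ψ : E3 → ℝ} {x : E3} (h : DifferentiableAt ℝ ψ x) (v : E3) :
    fderiv ℝ ψ x v = inner ℝ (gradient ψ x) v := by
  have := h.hasGradientAt.hasFDerivAt.fderiv
  rw [this]; simp

lemma eventually_neg_of_inner_gradient_neg {ψ : E3 → ℝ} {x v : E3} (h : DifferentiableAt ℝ ψ x)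
    (h0 : ψ x = 0) (hv : inner ℝ (gradient ψ x) v < 0) :
    ∀ᶠ t : ℝ in 𝓝[>] 0, ψ (x + t • v) < 0 := by
  have hd : HasDerivAt (fun t : ℝ => ψ (x + t • v)) (inner ℝ (gradient ψ x) v) 0 := by
    rw [← fderiv_eq_inner_gradient h]
    have h1 : HasDerivAt (fun t : ℝ => x + t • v) v 0 := by
      simpa using ((hasDerivAt_id (0 : ℝ)).smul_const v).const_add x
    have h2 : HasFDerivAt ψ (fderiv ℝ ψ x) (x + (0 : ℝ) • v) := by simpa using h.hasFDerivAt
    exact h2.comp_hasDerivAt (0 : ℝ) h1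
  have hs := (hasDerivAt_iff_tendsto_slope.1 hd).mono_left
    (nhdsWithin_mono _ (fun t (ht : 0 < t) => ht.ne'))
  filter_upwards [hs.eventually_lt_const hv, self_mem_nhdsWithin] with t ht htpos
  rw [slope_def_field] at ht
  simp only [zero_smul, add_zero, h0, sub_zero] at ht
  have htp : (0 : ℝ) < t := htpos
  by_contra hcon
  exact absurd (div_nonneg (not_lt.1 hcon) htp.le) (not_le.2 ht)

lemma IsLocalDefiningFunction.differentiableAt {Ω : Set E3} {x : E3} {ψ : E3 → ℝ}
    (h : IsLocalDefiningFunction Ω x ψ) (z : E3) : DifferentiableAt ℝ ψ z :=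
  h.1.contDiffAt.differentiableAt (by simp)

lemma IsLocalDefiningFunction.continuous_gradient {Ω : Set E3} {x : E3} {ψ : E3 → ℝ}
    (h : IsLocalDefiningFunction Ω x ψ) : Continuous (gradient ψ) := by
  unfold gradient
  exact (LinearIsometryEquiv.continuous _).comp (h.1.continuous_fderiv (by simp))

/-- Where `ψ` is positive a neighbourhood misses `Ω`, and where it is negative the point lies in the
open set `Ω`, so `ψ` vanishes at frontier points. Conversely, from a zero of `ψ` with non-zero
gradient the direction `-∇ψ` leads into `Ω`, so the zero lies in the closure. -/
lemma IsLocalDefiningFunction.eventually {Ω : Set E3} (hΩ : IsOpen Ω) {x : E3} {ψ : E3 → ℝ}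
    (h : IsLocalDefiningFunction Ω x ψ) :
    ∀ᶠ z in 𝓝 x, IsLocalDefiningFunction Ω z ψ ∧ (z ∈ frontier Ω ↔ ψ z = 0) := by
  have h1 := h.continuous_gradient.continuousAt.eventually_ne h.2.1
  filter_upwards [h1, h.2.2.eventually_nhds] with z hz hzΩ
  refine ⟨⟨h.1, hz, hzΩ⟩, ?_⟩
  have hc : ContinuousAt ψ z := h.1.continuous.continuousAt
  constructor
  · intro hf
    rw [hΩ.frontier_eq] at hf
    refine le_antisymm ?_ ?_
    · by_contra hcon
      have h2 : ∀ᶠ w in 𝓝 z, w ∉ Ω := by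
        filter_upwards [hzΩ, hc.eventually_const_lt (not_le.1 hcon)] with w hw hw'
        rw [hw]; exact not_lt.2 hw'.le
      exact (mem_closure_iff_frequently.1 hf.1) h2
    · exact not_lt.1 fun hcon => hf.2 (hzΩ.self_of_nhds.2 hcon)
  · intro h0
    rw [hΩ.frontier_eq]
    refine ⟨?_, fun hcon => (hzΩ.self_of_nhds.1 hcon).ne h0⟩
    have hneg : inner ℝ (gradient ψ z) (-gradient ψ z) < 0 := by
      rw [inner_neg_right, real_inner_self_eq_norm_sq]
      have := norm_pos_iff.2 hz
      simp only [Left.neg_neg_iff]; positivity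
    have hev := eventually_neg_of_inner_gradient_neg (h.differentiableAt z) h0 hneg
    have ht : Tendsto (fun t : ℝ => z + t • (-gradient ψ z)) (𝓝[>] 0) (𝓝 z) := by
      have : Continuous fun t : ℝ => z + t • (-gradient ψ z) := by fun_prop
      simpa using (this.tendsto 0).mono_left nhdsWithin_le_nhds
    refine mem_closure_of_tendsto ht ?_
    filter_upwards [hev, ht.eventually hzΩ] with t h3 h4
    exact h4.2 h3

/-- If the two unit gradients `a'` and `b'` differed, moving from `x` along `b' - a'` would decrease
`ψ₁` and increase `ψ₂`: the points reached would lie in `Ω` according to one function and outside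
according to the other. -/
lemma normalize_gradient_eq {Ω : Set E3} (hΩ : IsOpen Ω) {x : E3} {ψ₁ ψ₂ : E3 → ℝ}
    (hx : x ∈ frontier Ω)
    (h₁ : IsLocalDefiningFunction Ω x ψ₁) (h₂ : IsLocalDefiningFunction Ω x ψ₂) :
    ‖gradient ψ₁ x‖⁻¹ • gradient ψ₁ x = ‖gradient ψ₂ x‖⁻¹ • gradient ψ₂ x := by
  set a := gradient ψ₁ x
  set b := gradient ψ₂ x
  have ha : 0 < ‖a‖ := norm_pos_iff.2 h₁.2.1
  have hb : 0 < ‖b‖ := norm_pos_iff.2 h₂.2.1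
  set a' := ‖a‖⁻¹ • a
  set b' := ‖b‖⁻¹ • b
  have ha' : ‖a'‖ = 1 := by simp [a', norm_smul, ha.ne']
  have hb' : ‖b'‖ = 1 := by simp [b', norm_smul, hb.ne']
  by_contra hne
  have hlt : inner ℝ a' b' < 1 := (real_inner_le_norm a' b').trans_eq (by rw [ha', hb', mul_one]) |>.lt_of_ne
    fun h => hne ((inner_eq_one_iff_of_norm_eq_one ha' hb').1 h)
  have haa : a = ‖a‖ • a' := by simp [a', smul_smul, ha.ne']
  have hbb : b = ‖b‖ • b' := by simp [b', smul_smul, hb.ne']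
  have h1 : inner ℝ a (b' - a') < 0 := by
    rw [haa, inner_smul_left, inner_sub_right, real_inner_self_eq_norm_sq, ha']
    simp only [conj_trivial]
    nlinarith
  have h2 : inner ℝ b (-(b' - a')) < 0 := by
    rw [hbb, inner_smul_left, inner_neg_right, inner_sub_right, real_inner_self_eq_norm_sq, hb',
      real_inner_comm]
    simp only [conj_trivial]
    nlinarith
  have e1 := eventually_neg_of_inner_gradient_neg (h₁.differentiableAt x)
    ((h₁.eventually hΩ).self_of_nhds.2.1 hx) h1
  have hneg : gradient (fun z => -ψ₂ z) x = -b := by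
    have := (h₂.differentiableAt x).hasGradientAt
    rw [hasGradientAt_iff_hasFDerivAt] at this
    have h3 := this.neg
    rw [← map_neg] at h3
    exact (hasGradientAt_iff_hasFDerivAt.2 h3).gradient
  have e2 := eventually_neg_of_inner_gradient_neg (ψ := fun z => -ψ₂ z) (x := x) (v := b' - a')
    (h₂.differentiableAt x).neg (by simp [(h₂.eventually hΩ).self_of_nhds.2.1 hx])
    (by rw [hneg, inner_neg_left, ← inner_neg_right]; exact h2)
  have ht : Tendsto (fun t : ℝ => x + t • (b' - a')) (𝓝[>] 0) (𝓝 x) := by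
    have : Continuous fun t : ℝ => x + t • (b' - a') := by fun_prop
    simpa using (this.tendsto 0).mono_left nhdsWithin_le_nhds
  obtain ⟨t, h3, h4, h5, h6⟩ :=
    (e1.and (e2.and ((ht.eventually h₁.2.2).and (ht.eventually h₂.2.2)))).exists
  have := h6.1 (h5.2 h3)
  linarith

lemma outwardNormal_eq {Ω : Set E3} (hΩ : IsOpen Ω) {x : E3} {ψ : E3 → ℝ}
    (hx : x ∈ frontier Ω) (h : IsLocalDefiningFunction Ω x ψ) :
    outwardNormal Ω x = ‖gradient ψ x‖⁻¹ • gradient ψ x := by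
  have hex : ∃ ψ : E3 → ℝ, IsLocalDefiningFunction Ω x ψ := ⟨ψ, h⟩
  rw [outwardNormal, dif_pos hex]
  exact normalize_gradient_eq hΩ hx hex.choose_spec h

lemma norm_outwardNormal {Ω : Set E3} (hΩ : IsSmoothBoundedDomain Ω) {x : E3}
    (hx : x ∈ frontier Ω) : ‖outwardNormal Ω x‖ = 1 := by
  obtain ⟨ψ, h⟩ := hΩ.smooth_boundary x hx
  rw [outwardNormal_eq hΩ.isOpen hx h, norm_smul, norm_inv, norm_norm,
    inv_mul_cancel₀ (norm_ne_zero_iff.2 h.2.1)]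

lemma continuousOn_outwardNormal {Ω : Set E3} (hΩ : IsSmoothBoundedDomain Ω) :
    ContinuousOn (outwardNormal Ω) (frontier Ω) := by
  intro x hx
  obtain ⟨ψ, h⟩ := hΩ.smooth_boundary x hx
  have hc : ContinuousAt (fun z => ‖gradient ψ z‖⁻¹ • gradient ψ z) x := by
    have := h.continuous_gradient.continuousAt (x := x)
    exact (this.norm.inv₀ (norm_ne_zero_iff.2 h.2.1)).smul this
  refine (hc.continuousWithinAt (s := frontier Ω)).congr_of_eventuallyEq ?_
    (outwardNormal_eq hΩ.isOpen hx h)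
  filter_upwards [self_mem_nhdsWithin, nhdsWithin_le_nhds (h.eventually hΩ.isOpen)] with z hz hz'
  exact outwardNormal_eq hΩ.isOpen hz hz'.1

lemma isCompact_frontier {Ω : Set E3} (hΩ : IsSmoothBoundedDomain Ω) : IsCompact (frontier Ω) :=
  Metric.isCompact_of_isClosed_isBounded isClosed_frontier
    (hΩ.isBounded.closure.subset frontier_subset_closure)

/-! ### Graph charts of the boundary. -/

/-- A graph chart of the boundary of `Ω` near `x₀`, over the tangent plane. -/
structure SurfaceChart (Ω : Set E3) (x₀ : E3) where
  /-- the parametrisation -/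
  map : E2 → E3
  /-- the projection to the parameter plane -/
  proj : E3 →L[ℝ] E2
  /-- the size of the chart -/
  r : ℝ
  /-- the orientation of the parametrisation -/
  sign : ℝ
  contDiff : ContDiff ℝ 2 map
  map_zero : map 0 = x₀
  norm_proj_le : ∀ v, ‖proj v‖ ≤ ‖v‖
  proj_map : ∀ p, proj (map p - x₀) = p
  r_pos : 0 < r
  map_mem : ∀ p, ‖map p - x₀‖ < r → map p ∈ frontier Ω
  map_proj : ∀ y ∈ frontier Ω, ‖y - x₀‖ < r → map (proj (y - x₀)) = y
  sign_sq : sign ^ 2 = 1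
  normal_eq : ∀ p, ‖map p - x₀‖ < r →
    ‖areaVec map p‖ • outwardNormal Ω (map p) = sign • areaVec map p

/-- With `N = a × b`, orthogonality gives `w × N = (w·b) a - (w·a) b = 0`, and `N × (w × N) = |N|² w
- (w·N) N`. The coefficients below are the components of `N × a` and `N × b`. -/
lemma smul_eq_inner_smul_cross {a b w : E3} (ha : inner ℝ w a = 0) (hb : inner ℝ w b = 0) :
    (‖cross a b‖ ^ 2) • w = (inner ℝ w (cross a b)) • cross a b := by
  rw [inner_E3] at ha hb
  ext i
  simp only [norm_sq_E3, inner_E3, PiLp.smul_apply, smul_eq_mul]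
  fin_cases i
  · simp [cross]
    linear_combination (((a 2 * b 0 - a 0 * b 2) * a 2 - (a 0 * b 1 - a 1 * b 0) * a 1)) * hb
      - ((a 2 * b 0 - a 0 * b 2) * b 2 - (a 0 * b 1 - a 1 * b 0) * b 1) * ha
  · simp [cross]
    linear_combination (((a 0 * b 1 - a 1 * b 0) * a 0 - (a 1 * b 2 - a 2 * b 1) * a 2)) * hb
      - ((a 0 * b 1 - a 1 * b 0) * b 0 - (a 1 * b 2 - a 2 * b 1) * b 2) * ha
  · simp [cross]
    linear_combination (((a 1 * b 2 - a 2 * b 1) * a 1 - (a 2 * b 0 - a 0 * b 2) * a 0)) * hb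
      - ((a 1 * b 2 - a 2 * b 1) * b 1 - (a 2 * b 0 - a 0 * b 2) * b 0) * ha

/-- `ι` is an isometry of the plane onto `n^⊥` and `π` is its adjoint. The orthonormal basis of
`n^⊥` is not oriented, so only the square of the triple product is known; its sign becomes the
orientation of the chart. -/
lemma exists_orthogonal_frame {n : E3} (hn : ‖n‖ = 1) :
    ∃ (ι : E2 →L[ℝ] E3) (π : E3 →L[ℝ] E2), (∀ p, ‖ι p‖ = ‖p‖) ∧ (∀ v, ‖π v‖ ≤ ‖v‖) ∧
      (∀ p, π (ι p) = p) ∧ (∀ p, inner ℝ n (ι p) = 0) ∧ π n = 0 ∧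
      (∀ v, v = ι (π v) + inner ℝ n v • n) ∧
      inner ℝ n (cross (ι (EuclideanSpace.single 0 1)) (ι (EuclideanSpace.single 1 1))) ^ 2
        = 1 := by
  have hn0 : n ≠ 0 := fun h => by simp [h] at hn
  have : Fact (Module.finrank ℝ E3 = 2 + 1) := ⟨by simp⟩
  let b := OrthonormalBasis.fromOrthogonalSpanSingleton (𝕜 := ℝ) 2 hn0
  let ι₀ : E2 →ₗᵢ[ℝ] E3 := (ℝ ∙ n)ᗮ.subtypeₗᵢ.comp b.repr.symm.toLinearIsometry
  let ι : E2 →L[ℝ] E3 := ι₀.toContinuousLinearMap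
  have hιn : ∀ p, ‖ι p‖ = ‖p‖ := fun p => ι₀.norm_map p
  have hιi : ∀ p q, inner ℝ (ι p) (ι q) = inner ℝ p q := fun p q => ι₀.inner_map_map p q
  have horth : ∀ p, inner ℝ n (ι p) = 0 := fun p =>
    Submodule.mem_orthogonal_singleton_iff_inner_right.1 (b.repr.symm p).2
  have hπ1 : ∀ p, ContinuousLinearMap.adjoint ι (ι p) = p := fun p => by
    refine ext_inner_left ℝ fun q => ?_
    rw [ContinuousLinearMap.adjoint_inner_right, hιi]
  have hπn : ContinuousLinearMap.adjoint ι n = 0 := by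
    refine ext_inner_left ℝ fun q => ?_
    rw [ContinuousLinearMap.adjoint_inner_right, real_inner_comm, horth, inner_zero_right]
  refine ⟨ι, ContinuousLinearMap.adjoint ι, hιn, fun v => ?_, hπ1, horth, hπn, fun v => ?_, ?_⟩
  · refine ContinuousLinearMap.le_of_opNorm_le _ (c := 1) ?_ v |>.trans (by simp)
    rw [LinearIsometryEquiv.norm_map]
    exact ι₀.norm_toContinuousLinearMap_le
  · have hmem : v - inner ℝ n v • n ∈ (ℝ ∙ n)ᗮ := by
      rw [Submodule.mem_orthogonal_singleton_iff_inner_right, inner_sub_right, inner_smul_right,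
        real_inner_self_eq_norm_sq, hn]
      ring
    have hw : ι (b.repr ⟨_, hmem⟩) = v - inner ℝ n v • n := by
      simp [ι, ι₀]
    have : ContinuousLinearMap.adjoint ι v = b.repr ⟨_, hmem⟩ := by
      rw [← hπ1 (b.repr ⟨_, hmem⟩), hw, map_sub, map_smul, hπn, smul_zero, sub_zero]
    rw [this, hw]; abel
  · set t₁ := ι (EuclideanSpace.single 0 1)
    set t₂ := ι (EuclideanSpace.single 1 1)
    have h1 : ‖cross t₁ t₂‖ ^ 2 = 1 := by
      rw [norm_cross_sq, hιn, hιn, hιi]; simp [PiLp.inner_apply]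
    have h2 := smul_eq_inner_smul_cross (horth (EuclideanSpace.single 0 1))
      (horth (EuclideanSpace.single 1 1))
    have h3 := congrArg (fun v => inner ℝ n v) h2
    simp only [inner_smul_right, real_inner_self_eq_norm_sq, hn] at h3
    change ‖cross t₁ t₂‖ ^ 2 * 1 ^ 2 = inner ℝ n (cross t₁ t₂) * inner ℝ n (cross t₁ t₂) at h3
    rw [h1] at h3
    linarith

/-- The map `H` keeps the tangential coordinates and replaces the normal one by `ψ / |∇ψ(x₀)|`, so
that its derivative at `x₀` is the identity and it flattens the surface. Its local inverse,
restricted to the tangent plane, exhibits the surface as a graph. The height is multiplied by a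
cut-off, so the chart is a graph over the whole plane, and bounds that come from the projection hold
without restriction of the parameter. -/
lemma exists_surfaceChart {Ω : Set E3} (hΩ : IsSmoothBoundedDomain Ω) {x₀ : E3}
    (hx : x₀ ∈ frontier Ω) : Nonempty (SurfaceChart Ω x₀) := by
  obtain ⟨ψ, h⟩ := hΩ.smooth_boundary x₀ hx
  set a := gradient ψ x₀ with ha_def
  have ha : 0 < ‖a‖ := norm_pos_iff.2 h.2.1
  set n := ‖a‖⁻¹ • a with hn_def
  have hn : ‖n‖ = 1 := by simp [n, norm_smul, ha.ne']
  have han : a = ‖a‖ • n := by simp [n, smul_smul, ha.ne']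
  have hnn : inner ℝ n n = 1 := by rw [real_inner_self_eq_norm_sq, hn, one_pow]
  obtain ⟨ι, π, hι, hπ, hπι, hnι, hπn, hdec, hs⟩ := exists_orthogonal_frame hn
  set s := inner ℝ n (cross (ι (EuclideanSpace.single 0 1)) (ι (EuclideanSpace.single 1 1)))
  -- the straightening map
  let H : E3 → E3 := fun z => (z - x₀) + (‖a‖⁻¹ * ψ z - inner ℝ n (z - x₀)) • n
  have hψx : ψ x₀ = 0 := (h.eventually hΩ.isOpen).self_of_nhds.2.1 hx
  have hH0 : H x₀ = 0 := by simp [H, hψx]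
  have hHs : ContDiff ℝ 2 H := by
    have : ContDiff ℝ 2 ψ := h.1.of_le (by norm_cast)
    have h' : ContDiff ℝ 2 fun z => inner ℝ n (z - x₀) :=
      (innerSL ℝ n).contDiff.comp (contDiff_id.sub contDiff_const)
    exact (contDiff_id.sub contDiff_const).add (((contDiff_const.mul this).sub h').smul contDiff_const)
  have hHd : HasFDerivAt H ((ContinuousLinearEquiv.refl ℝ E3 : E3 ≃L[ℝ] E3) : E3 →L[ℝ] E3) x₀ := by
    have h1 : HasFDerivAt (fun z => ‖a‖⁻¹ * ψ z - inner ℝ n (z - x₀))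
        (‖a‖⁻¹ • fderiv ℝ ψ x₀ - innerSL ℝ n) x₀ := by
      refine HasFDerivAt.sub ((h.differentiableAt x₀).hasFDerivAt.const_mul _) ?_
      exact (innerSL ℝ n).hasFDerivAt.comp x₀ ((hasFDerivAt_id x₀).sub_const x₀)
    have h2 := ((hasFDerivAt_id (𝕜 := ℝ) x₀).sub_const x₀).add (h1.smul_const n)
    refine h2.congr_fderiv ?_
    ext1 v
    have h3 : fderiv ℝ ψ x₀ v = inner ℝ a v := fderiv_eq_inner_gradient (h.differentiableAt x₀) v
    have h4 : ‖a‖⁻¹ * inner ℝ a v = inner ℝ n v := by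
      simp [n, inner_smul_left]
    simp [h3, h4]
  have hst := hHs.contDiffAt.hasStrictFDerivAt' hHd two_ne_zero
  set S := hHs.contDiffAt.localInverse hHd two_ne_zero with hSdef
  have hSs : ContDiffAt ℝ 2 S 0 := by
    have := hHs.contDiffAt.to_localInverse hHd two_ne_zero
    rwa [hH0] at this
  have hS0 : S 0 = x₀ := by
    have := hHs.contDiffAt.localInverse_apply_image hHd two_ne_zero
    rwa [hH0] at this
  have hHS : ∀ᶠ w in 𝓝 (0 : E3), H (S w) = w := by
    have := hst.eventually_right_inverse
    rwa [hH0] at this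
  have hSH : ∀ᶠ z in 𝓝 x₀, S (H z) = z := hst.eventually_left_inverse
  -- the height function
  let g : E2 → ℝ := fun p => inner ℝ n (S (ι p) - x₀)
  have hg : ContDiffAt ℝ 2 g 0 := by
    have h1 : ContDiffAt ℝ 2 (fun p => S (ι p)) 0 := by
      refine ContDiffAt.comp (g := S) (0 : E2) ?_ ι.contDiff.contDiffAt
      rwa [map_zero]
    exact (innerSL ℝ n).contDiff.contDiffAt.comp _ (h1.sub contDiffAt_const)
  have hιt : Tendsto ι (𝓝 0) (𝓝 0) := by simpa using ι.continuous.tendsto 0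
  have hSt : Tendsto S (𝓝 0) (𝓝 x₀) := by simpa [hS0] using hSs.continuousAt.tendsto
  have hev : ∀ᶠ p in 𝓝 (0 : E2), ContDiffAt ℝ 2 g p ∧ H (S (ι p)) = ι p ∧
      (S (ι p) ∈ frontier Ω ↔ ψ (S (ι p)) = 0) :=
    (hg.eventually (by simp)).and ((hιt.eventually hHS).and
      ((hιt.eventually (hSt.eventually (h.eventually hΩ.isOpen))).mono fun p hp => hp.2))
  obtain ⟨δ, hδ, hball⟩ := Metric.eventually_nhds_iff_ball.1 hev
  -- The cut-off is 1 for `‖p‖ ≤ δ/3`. Since `‖p‖ ≤ ‖Φ p - x₀‖`, a chart of size at most `δ/3` never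
  -- sees the modification.
  let η : ContDiffBump (0 : E2) := ⟨δ / 3, δ / 2, by positivity, by linarith⟩
  let f : E2 → ℝ := fun p => η p * g p
  have hf : ContDiff ℝ 2 f := by
    refine contDiff_iff_contDiffAt.2 fun p => ?_
    by_cases hp : p ∈ ball (0 : E2) δ
    · exact η.contDiff.contDiffAt.mul (hball p hp).1
    · have h1 : p ∈ (closedBall (0 : E2) (δ / 2))ᶜ := fun hc =>
        hp (closedBall_subset_ball (by linarith) hc)
      refine (contDiffAt_const (c := (0 : ℝ))).congr_of_eventuallyEq ?_
      filter_upwards [isClosed_closedBall.isOpen_compl.mem_nhds h1] with q hq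
      have : η q = 0 := η.zero_of_le_dist (by
        have := not_le.1 (fun hh => hq (mem_closedBall.2 hh)); exact this.le)
      simp [f, this]
  let Φ : E2 → E3 := fun p => x₀ + ι p + f p • n
  have hΦ : ContDiff ℝ 2 Φ := by fun_prop
  have hπΦ : ∀ p, π (Φ p - x₀) = p := fun p => by
    have : Φ p - x₀ = ι p + f p • n := by simp only [Φ]; abel
    rw [this, map_add, map_smul, hπn, hπι, smul_zero, add_zero]
  have hfg : ∀ p, ‖p‖ ≤ δ / 3 → f p = g p := fun p hp => by
    have : η p = 1 := η.one_of_mem_closedBall (by simpa using hp)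
    simp [f, this]
  have hSΦ : ∀ p, ‖p‖ ≤ δ / 3 → S (ι p) = Φ p ∧ ψ (S (ι p)) = 0 := fun p hp => by
    have hp' : p ∈ ball (0 : E2) δ := by rw [mem_ball_zero_iff]; linarith
    have e := (hball p hp').2.1
    set z := S (ι p) with hz
    have e1 : ‖a‖⁻¹ * ψ z = 0 := by
      have := congrArg (fun v => inner ℝ n v) e
      simp only [H, inner_add_right, inner_smul_right, hnn, hnι, mul_one] at this
      linarith
    constructor
    · have : z - x₀ = ι p + (inner ℝ n (z - x₀)) • n := by
        rw [← e]
        simp only [H, e1, zero_sub, neg_smul]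
        abel_nf
      have h3 : z = x₀ + ι p + (inner ℝ n (z - x₀)) • n := by
        rw [add_assoc, ← this]; abel
      rw [h3]
      simp only [Φ, hfg p hp]
      rfl
    · simpa [ha.ne'] using e1
  have hΦ0 : Φ 0 = x₀ := by
    have := (hSΦ 0 (by simp; positivity)).1
    rw [← this, map_zero, hS0]
  -- near `x₀`
  have hloc : ∀ᶠ z in 𝓝 x₀, S (H z) = z ∧ (IsLocalDefiningFunction Ω z ψ ∧
      (z ∈ frontier Ω ↔ ψ z = 0)) ∧ 0 < inner ℝ (gradient ψ z) n := by
    refine hSH.and ((h.eventually hΩ.isOpen).and ?_)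
    have hc : ContinuousAt (fun z => inner ℝ (gradient ψ z) n) x₀ :=
      (h.continuous_gradient.inner continuous_const).continuousAt
    refine hc.eventually_const_lt ?_
    change 0 < inner ℝ a n
    rw [han, inner_smul_left, hnn]; simpa using ha
  obtain ⟨r₀, hr₀, hr⟩ := Metric.eventually_nhds_iff_ball.1 hloc
  have hnorm : ∀ p, ‖p‖ ≤ ‖Φ p - x₀‖ := fun p => by
    conv_lhs => rw [← hπΦ p]
    exact hπ _
  refine ⟨⟨Φ, π, min r₀ (δ / 3), s, hΦ, hΦ0, hπ, hπΦ, lt_min hr₀ (by positivity), ?_, ?_, hs, ?_⟩⟩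
  · intro p hp
    have h1 : ‖p‖ ≤ δ / 3 := (hnorm p).trans (hp.le.trans (min_le_right _ _))
    have h2 : Φ p ∈ ball x₀ r₀ := by
      rw [mem_ball_iff_norm]; exact hp.trans_le (min_le_left _ _)
    exact (hr _ h2).2.1.2.2 ((hSΦ p h1).1 ▸ (hSΦ p h1).2)
  · intro y hy hyr
    have h2 : y ∈ ball x₀ r₀ := by
      rw [mem_ball_iff_norm]; exact hyr.trans_le (min_le_left _ _)
    have h1 : ‖π (y - x₀)‖ ≤ δ / 3 := (hπ _).trans (hyr.le.trans (min_le_right _ _))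
    rw [← (hSΦ _ h1).1]
    have h0 : ψ y = 0 := (hr y h2).2.1.2.1 hy
    have h3 : H y = ι (π (y - x₀)) := by
      simp only [H, h0, mul_zero, zero_sub]
      conv_lhs => rw [hdec (y - x₀)]
      simp only [inner_add_right, inner_smul_right, hnι, hnn]
      simp
    rw [← h3]
    exact (hr y h2).1
  · intro p hp
    have hp1 : ‖p‖ < δ / 3 := (hnorm p).trans_lt (hp.trans_le (min_le_right _ _))
    have h2 : Φ p ∈ ball x₀ r₀ := by
      rw [mem_ball_iff_norm]; exact hp.trans_le (min_le_left _ _)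
    obtain ⟨-, ⟨hdef, hfr⟩, hpos⟩ := hr _ h2
    have hmem : Φ p ∈ frontier Ω := hfr.2 ((hSΦ p hp1.le).1 ▸ (hSΦ p hp1.le).2)
    have hΦd : HasFDerivAt Φ (fderiv ℝ Φ p) p :=
      (hΦ.contDiffAt.differentiableAt two_ne_zero).hasFDerivAt
    have hfd : HasFDerivAt f (fderiv ℝ f p) p :=
      (hf.contDiffAt.differentiableAt two_ne_zero).hasFDerivAt
    have hΦv : ∀ v, fderiv ℝ Φ p v = ι v + fderiv ℝ f p v • n := fun v => by
      have h1 : HasFDerivAt Φ (ι + (fderiv ℝ f p).smulRight n) p :=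
        (ι.hasFDerivAt.const_add x₀).add (hfd.smul_const n)
      rw [h1.fderiv]; simp
    have hperp : ∀ v, inner ℝ (gradient ψ (Φ p)) (fderiv ℝ Φ p v) = 0 := fun v => by
      have h1 : HasFDerivAt (ψ ∘ Φ) ((fderiv ℝ ψ (Φ p)).comp (fderiv ℝ Φ p)) p :=
        (hdef.differentiableAt _).hasFDerivAt.comp p hΦd
      have h3 : (ψ ∘ Φ) =ᶠ[𝓝 p] fun _ => 0 := by
        filter_upwards [isOpen_ball.mem_nhds (mem_ball_zero_iff.2 hp1)] with q hq
        have hq' : ‖q‖ ≤ δ / 3 := (mem_ball_zero_iff.1 hq).le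
        have h5 := (hSΦ q hq').2
        rwa [(hSΦ q hq').1] at h5
      have h4 := h1.unique ((hasFDerivAt_const (0 : ℝ) p).congr_of_eventuallyEq h3)
      rw [← fderiv_eq_inner_gradient (hdef.differentiableAt _)]
      simpa using congrArg (fun L : E2 →L[ℝ] ℝ => L v) h4
    set G := gradient ψ (Φ p)
    have hG : 0 < ‖G‖ := norm_pos_iff.2 hdef.2.1
    set N := areaVec Φ p with hN
    -- The tangent vectors of the graph differ from those of the plane by multiples of `n`, which do
    -- not affect the `n`-component of their cross product.
    have hNn : inner ℝ n N = s := by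
      have hnι0 := hnι (EuclideanSpace.single 0 1)
      simp only [hN, areaVec, hΦv, s, inner_E3, cross]
      simp
      ring
    have hNne : 0 < ‖N‖ := norm_pos_iff.2 fun h0 => by
      rw [h0, inner_zero_right] at hNn
      rw [← hNn] at hs; simp at hs
    rw [outwardNormal_eq hΩ.isOpen hmem hdef]
    set ν := ‖G‖⁻¹ • G
    have hν : ‖ν‖ = 1 := by simp [ν, norm_smul, hG.ne']
    have hν1 : ∀ v, inner ℝ ν (fderiv ℝ Φ p v) = 0 := fun v => by
      simp [ν, inner_smul_left, hperp]
    have hνn : 0 < inner ℝ ν n := by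
      simp only [ν, inner_smul_left]
      exact mul_pos (by simpa using hG) hpos
    have key : (‖N‖ ^ 2) • ν = (inner ℝ ν N) • N := smul_eq_inner_smul_cross (hν1 _) (hν1 _)
    have e1 : ‖N‖ ^ 2 = inner ℝ ν N ^ 2 := by
      have := congrArg (fun v => inner ℝ ν v) key
      simp only [inner_smul_right, real_inner_self_eq_norm_sq, hν] at this
      linarith
    have e2 : ‖N‖ ^ 2 * inner ℝ ν n = inner ℝ ν N * s := by
      have := congrArg (fun v => inner ℝ n v) key
      simp only [inner_smul_right, hNn] at this
      rwa [real_inner_comm ν n] at this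
    -- Since `N` is parallel to `ν`, the product is `±‖N‖`. The sign comes from `ν·n > 0` and `N·n =
    -- s`.
    have e3 : inner ℝ ν N = s * ‖N‖ := by
      have hpos2 : 0 < inner ℝ ν N * s := e2 ▸ by positivity
      have hsq : (inner ℝ ν N * s) ^ 2 = ‖N‖ ^ 2 := by rw [mul_pow, hs, e1, mul_one]
      have := (sq_eq_sq₀ hpos2.le hNne.le).1 hsq
      calc inner ℝ ν N = inner ℝ ν N * s ^ 2 := by rw [hs, mul_one]
        _ = s * (inner ℝ ν N * s) := by ring
        _ = s * ‖N‖ := by rw [this]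
    rw [e3, sq, mul_smul, mul_comm s, mul_smul] at key
    exact smul_right_injective _ hNne.ne' key

/-! ### Günter derivatives in charts. -/

/-- The tangent vector `ν_j e_i - ν_i e_j` along which `gunterEntry` differentiates. -/
def gunterVec (Ω : Set E3) (i j : Fin 3) (x : E3) : E3 :=
  outwardNormal Ω x j • EuclideanSpace.single i (1 : ℝ)
      - outwardNormal Ω x i • EuclideanSpace.single j (1 : ℝ)

/-- Two expansions of the triple product `(a × b) × (e_i × e_j)`. -/
lemma cross_gunter (a b : E3) (i j : Fin 3) :
    cross a b j • EuclideanSpace.single i (1 : ℝ) - cross a b i • EuclideanSpace.single j (1 : ℝ)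
      = inner ℝ a (cross (EuclideanSpace.single i 1) (EuclideanSpace.single j 1)) • b
        - inner ℝ b (cross (EuclideanSpace.single i 1) (EuclideanSpace.single j 1)) • a := by
  simp only [inner_E3]
  ext k
  fin_cases i <;> fin_cases j <;> fin_cases k <;> simp [cross] <;> ring

namespace SurfaceChart

variable {Ω : Set E3} {x₀ : E3} (c : SurfaceChart Ω x₀)

/-- The parameter domain of a chart. -/
def dom : Set E2 := {p | ‖c.map p - x₀‖ < c.r}

lemma isOpen_dom : IsOpen c.dom := by
  have := c.contDiff.continuous
  exact isOpen_lt (by fun_prop) continuous_const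

lemma contDiff_one : ContDiff ℝ 1 c.map := c.contDiff.of_le (by norm_num)

lemma hasFDerivAt (p : E2) : HasFDerivAt c.map (fderiv ℝ c.map p) p :=
  (c.contDiff.contDiffAt.differentiableAt two_ne_zero).hasFDerivAt

lemma norm_le (p : E2) : ‖p‖ ≤ ‖c.map p - x₀‖ := by
  conv_lhs => rw [← c.proj_map p]
  exact c.norm_proj_le _

lemma zero_mem_dom : (0 : E2) ∈ c.dom := by simp [dom, c.map_zero, c.r_pos]

/-- The chart has a left inverse that is an affine contraction. -/
lemma antilipschitz : AntilipschitzWith 1 c.map :=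
  AntilipschitzWith.of_le_mul_dist fun p q => by
    rw [NNReal.coe_one, one_mul, dist_eq_norm, dist_eq_norm]
    have : p - q = c.proj (c.map p - c.map q) := by
      conv_lhs => rw [← c.proj_map p, ← c.proj_map q]
      rw [← map_sub]; congr 1; abel
    rw [this]; exact c.norm_proj_le _

lemma norm_le_fderiv (p v : E2) : ‖v‖ ≤ ‖fderiv ℝ c.map p v‖ := by
  have h1 : HasFDerivAt (fun p => c.proj (c.map p - x₀)) (c.proj.comp (fderiv ℝ c.map p)) p :=
    c.proj.hasFDerivAt.comp p ((c.hasFDerivAt p).sub_const x₀)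
  have h2 : (fun p => c.proj (c.map p - x₀)) = id := funext c.proj_map
  rw [h2] at h1
  have h3 := h1.unique (hasFDerivAt_id p)
  have h4 : c.proj (fderiv ℝ c.map p v) = v := congrArg (fun L : E2 →L[ℝ] E2 => L v) h3
  conv_lhs => rw [← h4]
  exact c.norm_proj_le _

lemma areaVec_pos (p : E2) : 0 < ‖areaVec c.map p‖ :=
  norm_pos_iff.2 (areaVec_ne_zero (c.norm_le_fderiv p))

lemma proj_mem_dom {y : E3} (hy : y ∈ frontier Ω) (hyr : ‖y - x₀‖ < c.r) :
    c.proj (y - x₀) ∈ c.dom := by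
  change ‖c.map (c.proj (y - x₀)) - x₀‖ < c.r
  rwa [c.map_proj y hy hyr]

lemma image_dom : c.map '' c.dom = frontier Ω ∩ ball x₀ c.r := by
  ext y
  constructor
  · rintro ⟨p, hp, rfl⟩
    exact ⟨c.map_mem p hp, mem_ball_iff_norm.2 hp⟩
  · rintro ⟨hy, hyr⟩
    rw [mem_ball_iff_norm] at hyr
    exact ⟨_, c.proj_mem_dom hy hyr, c.map_proj y hy hyr⟩

lemma measurableEmbedding : MeasurableEmbedding c.map :=
  c.contDiff.continuous.measurableEmbedding c.antilipschitz.injective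

lemma comap_measure : (μHE[2] : Measure E3).comap c.map
      = (volume : Measure E2).withDensity fun p => ENNReal.ofReal ‖areaVec c.map p‖ :=
  comap_euclideanHausdorffMeasure c.contDiff_one c.antilipschitz c.norm_le_fderiv

/-- The tangent vectors `ν_j e_i - ν_i e_j` in a chart. -/
lemma smul_gunterVec {p : E2} (hp : p ∈ c.dom) (i j : Fin 3) :
    ‖areaVec c.map p‖ • gunterVec Ω i j (c.map p) =
      fderiv ℝ c.map p (c.sign •
        (inner ℝ (fderiv ℝ c.map p (EuclideanSpace.single 0 1))
          (cross (EuclideanSpace.single i 1) (EuclideanSpace.single j 1)) •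
            EuclideanSpace.single 1 1
        - inner ℝ (fderiv ℝ c.map p (EuclideanSpace.single 1 1))
          (cross (EuclideanSpace.single i 1) (EuclideanSpace.single j 1)) •
            EuclideanSpace.single 0 1)) := by
  have h := c.normal_eq p hp
  have hk : ∀ k, ‖areaVec c.map p‖ * outwardNormal Ω (c.map p) k = c.sign * areaVec c.map p k :=
    fun k => by simpa using congrArg (fun v : E3 => v k) h
  rw [gunterVec, smul_sub, smul_smul, smul_smul, hk, hk, map_smul, map_sub, map_smul, map_smul,
    ← cross_gunter, mul_smul, mul_smul, ← smul_sub]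
  rfl

lemma hasFDerivAt_comp {f : E3 → ℂ} {f' : E3 →L[ℝ] ℂ} {p : E2} (hp : p ∈ c.dom)
    (hf : HasFDerivWithinAt f f' (frontier Ω) (c.map p)) :
    HasFDerivAt (f ∘ c.map) (f'.comp (fderiv ℝ c.map p)) p :=
  hf.comp_hasFDerivAt p (c.hasFDerivAt p)
    (Filter.mem_of_superset (c.isOpen_dom.mem_nhds hp) fun q hq => c.map_mem q hq)

end SurfaceChart

/-- The surface is not a set of unique differentiability in space, so `fderivWithin` is only one of
many derivatives of `f`. Composed with a chart, all of them give the same derivative in the plane,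
hence they agree on the tangent vector in question. -/
lemma gunterEntry_eq {Ω : Set E3} (hΩ : IsSmoothBoundedDomain Ω) {x : E3} (hx : x ∈ frontier Ω)
    {f : E3 → ℂ} {f' : E3 →L[ℝ] ℂ} (hf : HasFDerivWithinAt f f' (frontier Ω) x) (i j : Fin 3) :
    gunterEntry Ω i j f x = f' (gunterVec Ω i j x) := by
  obtain ⟨c⟩ := exists_surfaceChart hΩ hx
  have h0 := c.smul_gunterVec c.zero_mem_dom i j
  have hf2 := hf.differentiableWithinAt.hasFDerivWithinAt
  rw [← c.map_zero] at hf hf2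
  have h1 := (c.hasFDerivAt_comp c.zero_mem_dom hf).unique (c.hasFDerivAt_comp c.zero_mem_dom hf2)
  rw [c.map_zero] at h0 h1
  have h2 := fun v => congrArg (fun L : E2 →L[ℝ] ℂ => L v) h1
  simp only [ContinuousLinearMap.comp_apply] at h2
  have hpos := (c.areaVec_pos 0).ne'
  have h3 : ‖areaVec c.map 0‖ • fderivWithin ℝ f (frontier Ω) x (gunterVec Ω i j x)
      = ‖areaVec c.map 0‖ • f' (gunterVec Ω i j x) := by
    rw [← map_smul, ← map_smul, h0, h2]
  exact smul_right_injective _ hpos h3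

namespace SurfaceChart

variable {Ω : Set E3} {x₀ : E3} (c : SurfaceChart Ω x₀)

/-- Multiplied by the area density, the Günter derivative needs no division by the length of the
normal: it is the Jacobian determinant of the `e_i × e_j` coordinate of the chart and of `f ∘
c.map`, up to orientation. This form makes Stokes' formula an identity in the plane. -/
lemma areaVec_mul_gunterEntry (hΩ : IsSmoothBoundedDomain Ω) {f : E3 → ℂ} {p : E2}
    (hp : p ∈ c.dom) (hf : DifferentiableWithinAt ℝ f (frontier Ω) (c.map p)) (i j : Fin 3) :
    ‖areaVec c.map p‖ * gunterEntry Ω i j f (c.map p) =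
      c.sign * ((inner ℝ (fderiv ℝ c.map p (EuclideanSpace.single 0 1))
          (cross (EuclideanSpace.single i 1) (EuclideanSpace.single j 1)) : ℝ)
            * fderiv ℝ (f ∘ c.map) p (EuclideanSpace.single 1 1)
        - (inner ℝ (fderiv ℝ c.map p (EuclideanSpace.single 1 1))
          (cross (EuclideanSpace.single i 1) (EuclideanSpace.single j 1)) : ℝ)
            * fderiv ℝ (f ∘ c.map) p (EuclideanSpace.single 0 1)) := by
  have hf' := hf.hasFDerivWithinAt
  rw [gunterEntry_eq hΩ (c.map_mem p hp) hf', (c.hasFDerivAt_comp hp hf').fderiv]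
  have := congrArg (fun v => fderivWithin ℝ f (frontier Ω) (c.map p) v) (c.smul_gunterVec hp i j)
  simp only [map_smul, map_sub, Complex.real_smul] at this
  simpa using this

lemma contDiffOn_comp {f : E3 → ℂ} (hf : ContDiffOn ℝ 1 f (frontier Ω)) :
    ContDiffOn ℝ 1 (f ∘ c.map) c.dom :=
  hf.comp c.contDiff_one.contDiffOn fun p hp => c.map_mem p hp

lemma integral_eq {g : E3 → ℂ}
    (hg : ∀ y ∈ frontier Ω, c.r ≤ ‖y - x₀‖ → g y = 0) :
    ∫ y, g y ∂(surfaceMeasure Ω) = ∫ p in c.dom, ‖areaVec c.map p‖ * g (c.map p) := by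
  have hm : MeasurableSet (c.map '' c.dom) :=
    c.measurableEmbedding.measurableSet_image.2 c.isOpen_dom.measurableSet
  have h1 : ∫ y, g y ∂(surfaceMeasure Ω) = ∫ y in c.map '' c.dom, g y ∂μHE[2] := by
    rw [surfaceMeasure, c.image_dom]
    refine setIntegral_eq_of_subset_of_forall_sdiff_eq_zero isClosed_frontier.measurableSet
      inter_subset_left ?_
    rintro y ⟨hy, hy'⟩
    refine hg y hy (not_lt.1 fun h => hy' ⟨hy, mem_ball_iff_norm.2 h⟩)
  have h2 : (μHE[2] : Measure E3).restrict (c.map '' c.dom)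
      = (((μHE[2] : Measure E3).comap c.map).map c.map).restrict (c.map '' c.dom) := by
    rw [c.measurableEmbedding.map_comap, Measure.restrict_restrict hm,
      inter_eq_left.2 (image_subset_range _ _)]
  have hmeas : Measurable fun p => ENNReal.ofReal ‖areaVec c.map p‖ :=
    (continuous_areaVec c.contDiff_one).norm.measurable.ennreal_ofReal
  rw [h1, h2, c.measurableEmbedding.setIntegral_map, c.comap_measure,
    preimage_image_eq _ c.antilipschitz.injective, restrict_withDensity c.isOpen_dom.measurableSet,
    integral_withDensity_eq_integral_toReal_smul hmeas (by simp)]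
  simp

end SurfaceChart

/-- In a chart the entry is a quotient of continuous functions with non-vanishing denominator, the
area density. -/
lemma continuousOn_gunterEntry {Ω : Set E3} (hΩ : IsSmoothBoundedDomain Ω) {f : E3 → ℂ}
    (hf : ContDiffOn ℝ 1 f (frontier Ω)) (i j : Fin 3) :
    ContinuousOn (gunterEntry Ω i j f) (frontier Ω) := by
  intro x hx
  obtain ⟨c⟩ := exists_surfaceChart hΩ hx
  set e := cross (EuclideanSpace.single i 1) (EuclideanSpace.single j 1)
  let h : E2 → ℂ := fun p => ((‖areaVec c.map p‖ : ℝ) : ℂ)⁻¹ *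
    (c.sign * ((inner ℝ (fderiv ℝ c.map p (EuclideanSpace.single 0 1)) e : ℝ)
            * fderiv ℝ (f ∘ c.map) p (EuclideanSpace.single 1 1)
        - (inner ℝ (fderiv ℝ c.map p (EuclideanSpace.single 1 1)) e : ℝ)
            * fderiv ℝ (f ∘ c.map) p (EuclideanSpace.single 0 1)))
  have hF : ContinuousAt (fderiv ℝ (f ∘ c.map)) 0 :=
    ((c.contDiffOn_comp hf).continuousOn_fderiv_of_isOpen c.isOpen_dom le_rfl).continuousAt
      (c.isOpen_dom.mem_nhds c.zero_mem_dom)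
  have hΦ : Continuous (fderiv ℝ c.map) := c.contDiff_one.continuous_fderiv one_ne_zero
  have hJ : ContinuousAt (fun p => (((‖areaVec c.map p‖ : ℝ) : ℂ))⁻¹) 0 := by
    refine ContinuousAt.inv₀ ?_ (by exact_mod_cast (c.areaVec_pos 0).ne')
    exact (Complex.continuous_ofReal.comp (continuous_areaVec c.contDiff_one).norm).continuousAt
  have hh : ContinuousAt h 0 := by
    have h1 : ∀ v : E2, ContinuousAt (fun p => fderiv ℝ (f ∘ c.map) p v) 0 := fun v =>
      hF.clm_apply continuousAt_const
    have h2 : ∀ v : E2, ContinuousAt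
        (fun p => ((inner ℝ (fderiv ℝ c.map p v) e : ℝ) : ℂ)) 0 := fun v => by
      have : Continuous fun p => inner ℝ (fderiv ℝ c.map p v) e :=
        (hΦ.clm_apply continuous_const).inner continuous_const
      exact (Complex.continuous_ofReal.comp this).continuousAt
    exact hJ.mul (continuousAt_const.mul (((h2 _).mul (h1 _)).sub ((h2 _).mul (h1 _))))
  have hp : ContinuousAt (fun y => c.proj (y - x)) x := by fun_prop
  have hhc : ContinuousAt (fun y => h (c.proj (y - x))) x := by
    refine ContinuousAt.comp (g := h) ?_ hp
    simpa using hh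
  have heq : ∀ y ∈ frontier Ω, ‖y - x‖ < c.r → gunterEntry Ω i j f y = h (c.proj (y - x)) := by
    intro y hy hyr
    have hd := c.proj_mem_dom hy hyr
    have h1 := c.areaVec_mul_gunterEntry hΩ hd (f := f)
      (by rw [c.map_proj y hy hyr]; exact (hf.differentiableOn one_ne_zero) y hy) i j
    rw [c.map_proj y hy hyr] at h1
    simp only [h]
    rw [← h1, inv_mul_cancel_left₀]
    exact_mod_cast (c.areaVec_pos _).ne'
  refine (hhc.continuousWithinAt (s := frontier Ω)).congr_of_eventuallyEq ?_
    (heq x hx (by simpa using c.r_pos))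
  filter_upwards [self_mem_nhdsWithin, nhdsWithin_le_nhds (ball_mem_nhds x c.r_pos)] with y hy hyr
  exact heq y hy (mem_ball_iff_norm.1 hyr)

/-! ### The area of small surface balls. -/

lemma exists_measure_ball_le {Ω : Set E3} (hΩ : IsSmoothBoundedDomain Ω) {x : E3}
    (hx : x ∈ frontier Ω) : ∃ r > 0, ∃ C : ENNReal, C ≠ ⊤ ∧
      ∀ ε, 0 < ε → ε ≤ r → surfaceMeasure Ω (ball x ε) ≤ C * ENNReal.ofReal (ε ^ 2) := by
  obtain ⟨c⟩ := exists_surfaceChart hΩ hx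
  obtain ⟨M, hM⟩ := (isCompact_closedBall (0 : E2) c.r).exists_bound_of_continuousOn
    (continuous_areaVec c.contDiff_one).continuousOn
  refine ⟨c.r, c.r_pos, ENNReal.ofReal M * volume (ball (0 : E2) 1),
    ENNReal.mul_ne_top ENNReal.ofReal_ne_top measure_ball_lt_top.ne, fun ε hε hεr => ?_⟩
  rw [surfaceMeasure, Measure.restrict_apply isOpen_ball.measurableSet]
  -- The projection is a contraction, so the surface ball is covered by the part of the chart over a
  -- disc of the same radius.
  have hsub : ball x ε ∩ frontier Ω ⊆ c.map '' ball 0 ε := by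
    rintro y ⟨hy, hyΓ⟩
    rw [mem_ball_iff_norm] at hy
    exact ⟨_, mem_ball_zero_iff.2 ((c.norm_proj_le _).trans_lt hy),
      c.map_proj y hyΓ (hy.trans_le hεr)⟩
  calc _ ≤ (μHE[2] : Measure E3) (c.map '' ball 0 ε) := measure_mono hsub
    _ = (μHE[2] : Measure E3).comap c.map (ball 0 ε) := (c.measurableEmbedding.comap_apply _ _).symm
    _ = ∫⁻ p in ball 0 ε, ENNReal.ofReal ‖areaVec c.map p‖ := by
      rw [c.comap_measure, withDensity_apply _ isOpen_ball.measurableSet]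
    _ ≤ ∫⁻ p in ball (0 : E2) ε, ENNReal.ofReal M := by
      refine setLIntegral_mono measurable_const fun p hp => ENNReal.ofReal_le_ofReal ?_
      exact hM p (ball_subset_closedBall (ball_subset_ball hεr hp))
    _ = _ := by
      rw [setLIntegral_const, Measure.addHaar_ball _ _ hε.le]
      simp; ring

lemma isFiniteMeasure_surfaceMeasure {Ω : Set E3} (hΩ : IsSmoothBoundedDomain Ω) :
    IsFiniteMeasure (surfaceMeasure Ω) := by
  refine ⟨?_⟩
  have h1 : surfaceMeasure Ω (frontier Ω) < ⊤ := by
    refine (isCompact_frontier hΩ).measure_lt_top_of_nhdsWithin fun x hx => ?_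
    obtain ⟨r, hr, C, hC, h⟩ := exists_measure_ball_le hΩ hx
    exact ⟨ball x r, mem_nhdsWithin_of_mem_nhds (ball_mem_nhds x hr),
      (h r hr le_rfl).trans_lt (ENNReal.mul_lt_top hC.lt_top ENNReal.ofReal_lt_top)⟩
  simpa [surfaceMeasure] using h1

/-- Beyond the size of a chart the quadratic bound follows from the finiteness of the total area. -/
lemma exists_measureReal_ball_le {Ω : Set E3} (hΩ : IsSmoothBoundedDomain Ω) {x : E3}
    (hx : x ∈ frontier Ω) : ∃ C : ℝ, 0 ≤ C ∧
      ∀ ε, 0 < ε → (surfaceMeasure Ω).real (ball x ε) ≤ C * ε ^ 2 := by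
  have := isFiniteMeasure_surfaceMeasure hΩ
  obtain ⟨r, hr, C, hC, h⟩ := exists_measure_ball_le hΩ hx
  refine ⟨max C.toReal ((surfaceMeasure Ω).real univ / r ^ 2),
    le_max_of_le_left ENNReal.toReal_nonneg, fun ε hε => ?_⟩
  rcases le_or_gt ε r with hεr | hεr
  · have h1 := ENNReal.toReal_mono (ENNReal.mul_ne_top hC ENNReal.ofReal_ne_top) (h ε hε hεr)
    rw [ENNReal.toReal_mul, ENNReal.toReal_ofReal (by positivity)] at h1
    exact h1.trans (mul_le_mul_of_nonneg_right (le_max_left _ _) (by positivity))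
  · calc _ ≤ (surfaceMeasure Ω).real univ := measureReal_mono (subset_univ _)
      _ = (surfaceMeasure Ω).real univ / r ^ 2 * r ^ 2 := by field_simp
      _ ≤ (surfaceMeasure Ω).real univ / r ^ 2 * ε ^ 2 := by gcongr
      _ ≤ _ := by gcongr; exact le_max_right _ _

/-! ### Stokes' formula on the closed surface. -/

/-- A null-Lagrangian identity in the plane. -/
lemma integral_fderiv_mul_fderiv_sub {G F : E2 → ℂ} (hG : ContDiff ℝ 2 G) (hF : ContDiff ℝ 1 F)
    (hFc : HasCompactSupport F) (v w : E2) :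
    ∫ p, (fderiv ℝ G p v * fderiv ℝ F p w - fderiv ℝ G p w * fderiv ℝ F p v) = 0 := by
  have hG' : ContDiff ℝ 1 (fderiv ℝ G) := hG.fderiv_right (by norm_num)
  have hF' : Continuous (fderiv ℝ F) := hF.continuous_fderiv one_ne_zero
  have hGv : ∀ v, ContDiff ℝ 1 fun p => fderiv ℝ G p v := fun v => hG'.clm_apply contDiff_const
  have hGvw : ∀ v w, Continuous fun p => fderiv ℝ (fun q => fderiv ℝ G q v) p w := fun v w =>
    ((hGv v).continuous_fderiv one_ne_zero).clm_apply continuous_const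
  have hFv : ∀ v, Continuous fun p => fderiv ℝ F p v := fun v => hF'.clm_apply continuous_const
  have hcs : ∀ v, HasCompactSupport fun p => fderiv ℝ F p v := fun v => hFc.fderiv_apply ℝ v
  -- Integration by parts moves a derivative from `F` to `G`; the two mixed second derivatives of
  -- `G` then cancel by symmetry.
  have key : ∀ v w, Integrable (fun p => fderiv ℝ G p v * fderiv ℝ F p w) ∧
      ∫ p, fderiv ℝ G p v * fderiv ℝ F p w
        = -∫ p, fderiv ℝ (fun q => fderiv ℝ G q v) p w * F p := by
    intro v w
    have i1 : Integrable (fun p => fderiv ℝ G p v * fderiv ℝ F p w) :=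
      ((hGv v).continuous.mul (hFv w)).integrable_of_hasCompactSupport ((hcs w).mul_left)
    have i2 : Integrable (fun p => fderiv ℝ (fun q => fderiv ℝ G q v) p w * F p) :=
      ((hGvw v w).mul hF.continuous).integrable_of_hasCompactSupport hFc.mul_left
    have i3 : Integrable (fun p => fderiv ℝ G p v * F p) :=
      ((hGv v).continuous.mul hF.continuous).integrable_of_hasCompactSupport hFc.mul_left
    exact ⟨i1, integral_mul_fderiv_eq_neg_fderiv_mul_of_integrable i2 i1 i3
      (fun p _ => (hGv v).contDiffAt.differentiableAt one_ne_zero)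
      (fun p _ => hF.contDiffAt.differentiableAt one_ne_zero)⟩
  rw [integral_sub (key v w).1 (key w v).1, (key v w).2, (key w v).2]
  have hsymm : ∀ p, fderiv ℝ (fun q => fderiv ℝ G q v) p w
      = fderiv ℝ (fun q => fderiv ℝ G q w) p v := by
    intro p
    have hs : IsSymmSndFDerivAt ℝ G p := hG.contDiffAt.isSymmSndFDerivAt (by simp)
    have hd : DifferentiableAt ℝ (fderiv ℝ G) p := hG'.contDiffAt.differentiableAt one_ne_zero
    have e : ∀ a b : E2, fderiv ℝ (fun q => fderiv ℝ G q a) p b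
        = fderiv ℝ (fderiv ℝ G) p b a := fun a b => by
      rw [fderiv_clm_apply hd (differentiableAt_const a)]; simp
    rw [e, e]; exact hs w v
  simp only [hsymm]
  ring

/-- Stokes' formula for functions supported in a chart. -/
lemma SurfaceChart.integral_gunterEntry {Ω : Set E3} (hΩ : IsSmoothBoundedDomain Ω) {x₀ : E3}
    (c : SurfaceChart Ω x₀) {f : E3 → ℂ} (hf : ContDiffOn ℝ 1 f (frontier Ω)) {r' : ℝ}
    (hr' : r' < c.r) (hsupp : ∀ y ∈ frontier Ω, r' < ‖y - x₀‖ → f y = 0) (i j : Fin 3) :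
    ∫ y, gunterEntry Ω i j f y ∂(surfaceMeasure Ω) = 0 := by
  set e := cross (EuclideanSpace.single i 1) (EuclideanSpace.single j 1)
  have hc : Continuous c.map := c.contDiff.continuous
  have hgz : ∀ y ∈ frontier Ω, c.r ≤ ‖y - x₀‖ → gunterEntry Ω i j f y = 0 := by
    intro y hy hyr
    have hev : f =ᶠ[𝓝[frontier Ω] y] fun _ => 0 := by
      have h1 : {z : E3 | r' < ‖z - x₀‖} ∈ 𝓝 y :=
        (isOpen_lt continuous_const (by fun_prop)).mem_nhds (hr'.trans_le hyr)
      filter_upwards [self_mem_nhdsWithin, nhdsWithin_le_nhds h1] with z hz hz'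
      exact hsupp z hz hz'
    have h2 : HasFDerivWithinAt f (0 : E3 →L[ℝ] ℂ) (frontier Ω) y :=
      (hasFDerivWithinAt_const (0 : ℂ) y _).congr_of_eventuallyEq hev
        (hsupp y hy (hr'.trans_le hyr))
    rw [gunterEntry_eq hΩ hy h2]; simp
  rw [c.integral_eq hgz]
  -- the function in the chart
  let F : E2 → ℂ := c.dom.indicator (f ∘ c.map)
  have hFz : ∀ p, r' < ‖c.map p - x₀‖ → F p = 0 := by
    intro p hp
    by_cases hd : p ∈ c.dom
    · simp only [F, indicator_of_mem hd]
      exact hsupp _ (c.map_mem p hd) hp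
    · simp only [F, indicator_of_notMem hd]
  have hFdom : ∀ p ∈ c.dom, F =ᶠ[𝓝 p] f ∘ c.map := fun p hp => by
    filter_upwards [c.isOpen_dom.mem_nhds hp] with q hq
    simp only [F, indicator_of_mem hq]
  have hFout : ∀ p, p ∉ c.dom → F =ᶠ[𝓝 p] fun _ => 0 := fun p hp => by
    have h1 : {q : E2 | r' < ‖c.map q - x₀‖} ∈ 𝓝 p :=
      (isOpen_lt continuous_const (by fun_prop)).mem_nhds (hr'.trans_le (not_lt.1 hp))
    filter_upwards [h1] with q hq using hFz q hq
  -- Outside the parameter domain the chart is at distance at least `c.r > r'` from `x₀`, so `F`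
  -- vanishes near such points and the extension by zero is smooth enough.
  have hF : ContDiff ℝ 1 F := by
    refine contDiff_iff_contDiffAt.2 fun p => ?_
    by_cases hp : p ∈ c.dom
    · exact ((c.contDiffOn_comp hf).contDiffAt (c.isOpen_dom.mem_nhds hp)).congr_of_eventuallyEq
        (hFdom p hp)
    · exact contDiffAt_const.congr_of_eventuallyEq (hFout p hp)
  have hFc : HasCompactSupport F := by
    refine HasCompactSupport.of_support_subset_isCompact (isCompact_closedBall (0 : E2) r') ?_
    intro p hp
    by_contra hcon
    rw [mem_closedBall_zero_iff, not_le] at hcon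
    exact hp (hFz p (hcon.trans_le (c.norm_le p)))
  -- The coordinate along `e_i × e_j`: with it the integrand becomes the Jacobian determinant of
  -- `(G, F)` up to the orientation sign.
  let G : E2 → ℂ := fun p => ((inner ℝ (c.map p) e : ℝ) : ℂ)
  have hG : ContDiff ℝ 2 G :=
    Complex.ofRealCLM.contDiff.comp (c.contDiff.inner ℝ contDiff_const)
  have hGd : ∀ p v, fderiv ℝ G p v = ((inner ℝ (fderiv ℝ c.map p v) e : ℝ) : ℂ) := by
    intro p v
    have h1 : HasFDerivAt G (Complex.ofRealCLM.comp ((innerSL ℝ e).comp (fderiv ℝ c.map p))) p := by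
      have h2 := (innerSL ℝ e).hasFDerivAt.comp p (c.hasFDerivAt p)
      have h3 := Complex.ofRealCLM.hasFDerivAt.comp p h2
      refine h3.congr_of_eventuallyEq (Eventually.of_forall fun q => ?_)
      simp [G, real_inner_comm]
    rw [h1.fderiv]
    simp [real_inner_comm]
  have hFd : ∀ p, p ∉ c.dom → fderiv ℝ F p = 0 := fun p hp => by
    rw [(hFout p hp).fderiv_eq]; simp
  calc ∫ p in c.dom, ((‖areaVec c.map p‖ : ℝ) : ℂ) * gunterEntry Ω i j f (c.map p)
      = ∫ p in c.dom, c.sign * (fderiv ℝ G p (EuclideanSpace.single 0 1)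
          * fderiv ℝ F p (EuclideanSpace.single 1 1)
        - fderiv ℝ G p (EuclideanSpace.single 1 1)
          * fderiv ℝ F p (EuclideanSpace.single 0 1)) := by
        refine setIntegral_congr_fun c.isOpen_dom.measurableSet fun p hp => ?_
        rw [c.areaVec_mul_gunterEntry hΩ hp
          ((hf.differentiableOn one_ne_zero) _ (c.map_mem p hp)), (hFdom p hp).fderiv_eq, hGd, hGd]
    _ = ∫ p, c.sign * (fderiv ℝ G p (EuclideanSpace.single 0 1)
          * fderiv ℝ F p (EuclideanSpace.single 1 1)
        - fderiv ℝ G p (EuclideanSpace.single 1 1)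
          * fderiv ℝ F p (EuclideanSpace.single 0 1)) := by
        refine setIntegral_eq_integral_of_forall_compl_eq_zero fun p hp => ?_
        rw [hFd p hp]; simp
    _ = 0 := by
        rw [integral_const_mul, integral_fderiv_mul_fderiv_sub hG hF hFc, mul_zero]

lemma integrable_of_continuousOn {Ω : Set E3} (hΩ : IsSmoothBoundedDomain Ω) {g : E3 → ℂ}
    (hg : ContinuousOn g (frontier Ω)) : Integrable g (surfaceMeasure Ω) := by
  have := isFiniteMeasure_surfaceMeasure hΩ
  have h1 : IntegrableOn g (frontier Ω) (surfaceMeasure Ω) :=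
    hg.integrableOn_compact (isCompact_frontier hΩ)
  rwa [IntegrableOn, surfaceMeasure, Measure.restrict_restrict isClosed_frontier.measurableSet,
    inter_self] at h1

/-- Stokes' formula on the boundary of a smooth domain. -/
theorem integral_gunterEntry {Ω : Set E3} (hΩ : IsSmoothBoundedDomain Ω) {f : E3 → ℂ}
    (hf : ContDiffOn ℝ 1 f (frontier Ω)) (i j : Fin 3) :
    ∫ y, gunterEntry Ω i j f y ∂(surfaceMeasure Ω) = 0 := by
  let ch : ∀ x : frontier Ω, SurfaceChart Ω x := fun x => (exists_surfaceChart hΩ x.2).some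
  let χ : ∀ x : frontier Ω, ContDiffBump (x : E3) := fun x =>
    ⟨(ch x).r / 3, (ch x).r / 2, by linarith [(ch x).r_pos], by linarith [(ch x).r_pos]⟩
  obtain ⟨t, ht⟩ := (isCompact_frontier hΩ).elim_finite_subcover
    (fun x : frontier Ω => ball (x : E3) ((ch x).r / 3)) (fun x => isOpen_ball) fun x hx =>
      mem_iUnion.2 ⟨⟨x, hx⟩, mem_ball_self (by linarith [(ch ⟨x, hx⟩).r_pos])⟩
  -- Instead of a partition of unity, the factors `1 - χ_x` are multiplied in one at a time. Each
  -- changes the function by one supported in a chart, whose integral vanishes, while the full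
  -- product is zero on the surface.
  let P : Finset (frontier Ω) → E3 → ℂ := fun s y => ∏ x ∈ s, (1 - ((χ x y : ℝ) : ℂ))
  have hχ : ∀ x : frontier Ω, ContDiff ℝ 1 fun y => ((χ x y : ℝ) : ℂ) := fun x =>
    Complex.ofRealCLM.contDiff.comp (χ x).contDiff
  have hP : ∀ s, ContDiff ℝ 1 (P s) := fun s =>
    contDiff_prod fun x _ => contDiff_const.sub (hχ x)
  have hmul : ∀ s, ContDiffOn ℝ 1 (fun y => f y * P s y) (frontier Ω) := fun s =>
    hf.mul (hP s).contDiffOn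
  have hstep : ∀ s : Finset (frontier Ω),
      ∫ y, gunterEntry Ω i j (fun y => f y * P s y) y ∂(surfaceMeasure Ω)
        = ∫ y, gunterEntry Ω i j f y ∂(surfaceMeasure Ω) := by
    classical
    intro s
    induction s using Finset.induction_on with
    | empty => simp [P]
    | insert x s hxs ih =>
      have h0 : ContDiffOn ℝ 1 (fun y => f y * P s y * ((χ x y : ℝ) : ℂ)) (frontier Ω) :=
        (hmul s).mul (hχ x).contDiffOn
      have h1 := (ch x).integral_gunterEntry hΩ h0 (r' := (ch x).r / 2)
        (by linarith [(ch x).r_pos]) (fun y _ hyr => by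
          rw [(χ x).zero_of_le_dist (by rw [dist_eq_norm]; exact hyr.le)]; simp) i j
      have h2 : ∀ y ∈ frontier Ω, gunterEntry Ω i j (fun y => f y * P (insert x s) y) y
          = gunterEntry Ω i j (fun y => f y * P s y) y
            - gunterEntry Ω i j (fun y => f y * P s y * ((χ x y : ℝ) : ℂ)) y := by
        intro y hy
        have d1 := ((hmul s).differentiableOn one_ne_zero y hy).hasFDerivWithinAt
        have d2 := (h0.differentiableOn one_ne_zero y hy).hasFDerivWithinAt
        have d3 := d1.sub d2
        have e : (fun y => f y * P (insert x s) y)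
            = (fun y => f y * P s y) - fun y => f y * P s y * ((χ x y : ℝ) : ℂ) := by
          funext z
          simp only [P, Finset.prod_insert hxs, Pi.sub_apply]; ring
        rw [← e] at d3
        rw [gunterEntry_eq hΩ hy d1, gunterEntry_eq hΩ hy d2, gunterEntry_eq hΩ hy d3]
        simp
      have h3 : ∫ y, gunterEntry Ω i j (fun y => f y * P (insert x s) y) y ∂(surfaceMeasure Ω)
          = ∫ y, (gunterEntry Ω i j (fun y => f y * P s y) y
            - gunterEntry Ω i j (fun y => f y * P s y * ((χ x y : ℝ) : ℂ)) y)
              ∂(surfaceMeasure Ω) :=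
        setIntegral_congr_fun isClosed_frontier.measurableSet h2
      rw [h3, integral_sub (integrable_of_continuousOn hΩ (continuousOn_gunterEntry hΩ (hmul s) i j))
        (integrable_of_continuousOn hΩ (continuousOn_gunterEntry hΩ h0 i j)), h1, sub_zero, ih]
  rw [← hstep t]
  have hz : ∀ y ∈ frontier Ω, f y * P t y = 0 := by
    intro y hy
    obtain ⟨x, hx, hyx⟩ := mem_iUnion₂.1 (ht hy)
    have : P t y = 0 := Finset.prod_eq_zero hx (by
      rw [(χ x).one_of_mem_closedBall (ball_subset_closedBall hyx)]; simp)
    rw [this, mul_zero]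
  have : ∀ y ∈ frontier Ω, gunterEntry Ω i j (fun y => f y * P t y) y = 0 := by
    intro y hy
    have h2 : HasFDerivWithinAt (fun y => f y * P t y) (0 : E3 →L[ℝ] ℂ) (frontier Ω) y :=
      (hasFDerivWithinAt_const (0 : ℂ) y _).congr_of_eventuallyEq
        (eventually_mem_nhdsWithin.mono hz) (hz y hy)
    rw [gunterEntry_eq hΩ hy h2]; simp
  exact (setIntegral_congr_fun isClosed_frontier.measurableSet this).trans (by simp)

/-! ### The normal component of a chord. -/

lemma exists_local_inner_normal_le {Ω : Set E3} (hΩ : IsSmoothBoundedDomain Ω) {x₀ : E3}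
    (hx : x₀ ∈ frontier Ω) : ∃ r > 0, ∃ C : ℝ, 0 ≤ C ∧ ∀ x ∈ frontier Ω, ∀ y ∈ frontier Ω,
      x ∈ ball x₀ r → y ∈ ball x₀ r → |inner ℝ (outwardNormal Ω x) (x - y)| ≤ C * ‖x - y‖ ^ 2 := by
  obtain ⟨ψ, h⟩ := hΩ.smooth_boundary x₀ hx
  have ha : 0 < ‖gradient ψ x₀‖ := norm_pos_iff.2 h.2.1
  have hfd : ContDiff ℝ 1 (fderiv ℝ ψ) := h.1.fderiv_right (by norm_cast)
  obtain ⟨K, t, ht, hK⟩ := hfd.contDiffAt.exists_lipschitzOnWith (x := x₀)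
  have hb : ∀ᶠ z in 𝓝 x₀, ‖gradient ψ x₀‖ / 2 < ‖gradient ψ z‖ :=
    h.continuous_gradient.norm.continuousAt.eventually_const_lt (by linarith)
  obtain ⟨r, hr, hball⟩ := Metric.eventually_nhds_iff_ball.1
    ((h.eventually hΩ.isOpen).and (hb.and ht))
  refine ⟨r, hr, 2 / ‖gradient ψ x₀‖ * K, by positivity, fun x hxΓ y hyΓ hxb hyb => ?_⟩
  obtain ⟨⟨hdx, hfx⟩, hgx, hxt⟩ := hball x hxb
  obtain ⟨⟨hdy, hfy⟩, hgy, hyt⟩ := hball y hyb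
  have hpos : 0 < ‖gradient ψ x‖ := lt_trans (by positivity) hgx
  -- On this convex set the derivative of `ψ` differs from its value at `x` by at most `K ‖y - x‖`.
  -- As `ψ` vanishes at both `x` and `y`, its first-order Taylor term along the chord is
  -- quadratically small.
  have hconv : Convex ℝ (ball x₀ r ∩ closedBall x ‖y - x‖) :=
    (convex_ball _ _).inter (convex_closedBall _ _)
  have h1 := hconv.norm_image_sub_le_of_norm_hasFDerivWithin_le' (f := ψ) (f' := fderiv ℝ ψ)
    (φ := fderiv ℝ ψ x) (C := K * ‖y - x‖) (x := x) (y := y)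
    (fun z _ => (h.differentiableAt z).hasFDerivAt.hasFDerivWithinAt)
    (fun z hz => by
      have h2 := hK.dist_le_mul z (hball z hz.1).2.2 x hxt
      rw [dist_eq_norm, dist_eq_norm] at h2
      refine h2.trans (mul_le_mul_of_nonneg_left ?_ K.2)
      simpa [dist_eq_norm] using hz.2)
    ⟨hxb, by simp⟩ ⟨hyb, by simp [dist_eq_norm]⟩
  rw [hfy.1 hyΓ, hfx.1 hxΓ, fderiv_eq_inner_gradient (h.differentiableAt x), sub_self, zero_sub,
    norm_neg, Real.norm_eq_abs] at h1
  rw [outwardNormal_eq hΩ.isOpen hxΓ hdx, inner_smul_left, ← neg_sub y x, inner_neg_right, norm_neg]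
  simp only [conj_trivial, mul_neg, abs_neg, abs_mul, abs_inv, abs_norm]
  calc ‖gradient ψ x‖⁻¹ * |inner ℝ (gradient ψ x) (y - x)|
      ≤ (‖gradient ψ x₀‖ / 2)⁻¹ * (K * ‖y - x‖ * ‖y - x‖) := by gcongr
    _ = _ := by field_simp

/-- On a smooth closed surface, the normal component of a chord is quadratically small. -/
lemma exists_inner_normal_le {Ω : Set E3} (hΩ : IsSmoothBoundedDomain Ω) :
    ∃ C : ℝ, 0 ≤ C ∧ ∀ x ∈ frontier Ω, ∀ y ∈ frontier Ω,
      |inner ℝ (outwardNormal Ω x) (x - y)| ≤ C * ‖x - y‖ ^ 2 := by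
  have hloc := fun x : frontier Ω => exists_local_inner_normal_le hΩ x.2
  choose r hr C hC h using hloc
  obtain ⟨t, ht⟩ := (isCompact_frontier hΩ).elim_finite_subcover
    (fun x : frontier Ω => ball (x : E3) (r x)) (fun x => isOpen_ball) fun x hx =>
      mem_iUnion.2 ⟨⟨x, hx⟩, mem_ball_self (hr _)⟩
  have ht' : frontier Ω ⊆ ⋃ i : t, ball ((i : frontier Ω) : E3) (r i) := fun y hy => by
    obtain ⟨i, hi, hy'⟩ := mem_iUnion₂.1 (ht hy)
    exact mem_iUnion.2 ⟨⟨i, hi⟩, hy'⟩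
  -- Points closer than a Lebesgue number lie in a common ball of the finite cover. For the others
  -- the trivial bound `‖x - y‖` is at most `‖x - y‖² / δ`.
  obtain ⟨δ, hδ, hleb⟩ := lebesgue_number_lemma_of_metric (isCompact_frontier hΩ)
    (fun _ => isOpen_ball) ht'
  have hsum : 0 ≤ ∑ x ∈ t, C x := Finset.sum_nonneg fun x _ => hC x
  refine ⟨(∑ x ∈ t, C x) + 1 / δ, by positivity, fun x hx y hy => ?_⟩
  rcases lt_or_ge ‖x - y‖ δ with hlt | hge
  · obtain ⟨⟨i, hi⟩, hsub⟩ := hleb x hx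
    refine (h i x hx y hy (hsub (mem_ball_self hδ))
      (hsub (by rwa [mem_ball, dist_comm, dist_eq_norm]))).trans ?_
    refine mul_le_mul_of_nonneg_right ?_ (by positivity)
    have := Finset.single_le_sum (fun x _ => hC x) hi
    have h2 : 0 < 1 / δ := by positivity
    linarith
  · have h1 := abs_real_inner_le_norm (outwardNormal Ω x) (x - y)
    rw [norm_outwardNormal hΩ hx, one_mul] at h1
    refine h1.trans ?_
    have h2 : ‖x - y‖ ≤ 1 / δ * ‖x - y‖ ^ 2 := by
      rw [div_mul_eq_mul_div, one_mul, le_div_iff₀ hδ]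
      nlinarith [norm_nonneg (x - y)]
    nlinarith [sq_nonneg ‖x - y‖]

/-! ### Stokes' formula outside a small ball. -/

lemma hasDerivAt_max_zero_sq (x : ℝ) : HasDerivAt (fun x : ℝ => max x 0 ^ 2) (2 * max x 0) x := by
  rcases lt_trichotomy x 0 with hx | rfl | hx
  · rw [max_eq_right hx.le, mul_zero]
    refine (hasDerivAt_const x (0 : ℝ)).congr_of_eventuallyEq ?_
    filter_upwards [eventually_lt_nhds hx] with y hy
    simp [max_eq_right hy.le]
  · rw [max_self, mul_zero, hasDerivAt_iff_isLittleO_nhds_zero]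
    have h1 : (fun h : ℝ => max (0 + h) 0 ^ 2 - max 0 0 ^ 2 - h • (0 : ℝ))
        =O[𝓝 0] fun h : ℝ => h ^ 2 := by
      refine Asymptotics.IsBigO.of_bound 1 (Eventually.of_forall fun h => ?_)
      simp only [zero_add, max_self, smul_zero, sub_zero, one_mul, norm_pow, Real.norm_eq_abs]
      have : |max h 0| ≤ |h| := by
        rcases le_total h 0 with h0 | h0 <;> simp [h0]
      simpa using pow_le_pow_left₀ (abs_nonneg _) this 2
    exact h1.trans_isLittleO (Asymptotics.isLittleO_pow_id one_lt_two)
  · rw [max_eq_left hx.le]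
    have h1 : HasDerivAt (fun x : ℝ => x ^ 2) (2 * x) x := by simpa using hasDerivAt_pow 2 x
    refine h1.congr_of_eventuallyEq ?_
    filter_upwards [eventually_gt_nhds hx] with y hy
    simp [max_eq_left (le_of_lt hy)]

/-- A continuously differentiable approximation of `max a t`. -/
def smoothMax (a : ℝ) (n : ℕ) (t : ℝ) : ℝ :=
  a + (max (1 + (n + 1) * (t - a)) 0 ^ 2 - max ((n + 1) * (t - a)) 0 ^ 2) / (2 * (n + 1))

/-- The derivative of `smoothMax`. -/
def smoothMaxDeriv (a : ℝ) (n : ℕ) (t : ℝ) : ℝ :=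
  max (1 + (n + 1) * (t - a)) 0 - max ((n + 1) * (t - a)) 0

lemma hasDerivAt_smoothMax (a : ℝ) (n : ℕ) (t : ℝ) :
    HasDerivAt (smoothMax a n) (smoothMaxDeriv a n t) t := by
  have h0 : HasDerivAt (fun t : ℝ => ((n : ℝ) + 1) * (t - a)) ((n : ℝ) + 1) t := by
    simpa using ((hasDerivAt_id t).sub_const a).const_mul ((n : ℝ) + 1)
  have h1 := (hasDerivAt_max_zero_sq _).comp t (h0.const_add 1)
  have h2 := (hasDerivAt_max_zero_sq _).comp t h0
  have h3 := ((h1.sub h2).div_const (2 * ((n : ℝ) + 1))).const_add a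
  refine h3.congr_deriv ?_
  have : (n : ℝ) + 1 ≠ 0 := by positivity
  simp only [smoothMaxDeriv]
  field_simp

lemma smoothMaxDeriv_mem (a : ℝ) (n : ℕ) (t : ℝ) :
    0 ≤ smoothMaxDeriv a n t ∧ smoothMaxDeriv a n t ≤ 1 := by
  unfold smoothMaxDeriv
  set s := ((n : ℝ) + 1) * (t - a)
  constructor
  · rw [sub_nonneg]; exact max_le_max (by linarith) le_rfl
  · rw [sub_le_iff_le_add]
    refine max_le ?_ ?_
    · linarith [le_max_left s 0]
    · linarith [le_max_right s 0]

lemma continuous_smoothMaxDeriv (a : ℝ) (n : ℕ) : Continuous (smoothMaxDeriv a n) := by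
  unfold smoothMaxDeriv; fun_prop

/-- The derivative rises from 0 to 1 on `[a - 1/(n+1), a]`, entirely to the left of `a`. Hence it
equals 1 already at `t = a`, and the pointwise limits exist everywhere: nothing has to be known
about the area of the sphere `|y - x| = ε` within the surface. -/
lemma smoothMax_of_le {a t : ℝ} (n : ℕ) (h : a ≤ t) :
    smoothMax a n t = t + 1 / (2 * (n + 1)) ∧ smoothMaxDeriv a n t = 1 := by
  have hs : 0 ≤ ((n : ℝ) + 1) * (t - a) := mul_nonneg (by positivity) (by linarith)
  have hn : (n : ℝ) + 1 ≠ 0 := by positivity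
  unfold smoothMax smoothMaxDeriv
  rw [max_eq_left hs, max_eq_left (by linarith)]
  constructor
  · field_simp; ring
  · ring

lemma smoothMax_of_lt {a t : ℝ} (h : t < a) :
    ∀ᶠ n : ℕ in atTop, smoothMax a n t = a ∧ smoothMaxDeriv a n t = 0 := by
  obtain ⟨N, hN⟩ := exists_nat_gt (1 / (a - t))
  filter_upwards [eventually_ge_atTop N] with n hn
  have hn' : (N : ℝ) ≤ n := by exact_mod_cast hn
  have h1 : 1 < ((n : ℝ) + 1) * (a - t) := by
    rw [div_lt_iff₀ (by linarith)] at hN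
    nlinarith
  have h2 : ((n : ℝ) + 1) * (t - a) = -(((n : ℝ) + 1) * (a - t)) := by ring
  unfold smoothMax smoothMaxDeriv
  rw [h2, max_eq_right (by linarith), max_eq_right (by linarith)]
  simp

lemma le_smoothMax (a : ℝ) (n : ℕ) (t : ℝ) : a ≤ smoothMax a n t := by
  unfold smoothMax
  set s := ((n : ℝ) + 1) * (t - a)
  have h1 : max s 0 ≤ max (1 + s) 0 := max_le_max (by linarith) le_rfl
  have h2 := pow_le_pow_left₀ (le_max_right s 0) h1 2
  have : 0 ≤ (max (1 + s) 0 ^ 2 - max s 0 ^ 2) / (2 * ((n : ℝ) + 1)) :=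
    div_nonneg (by linarith) (by positivity)
  linarith

lemma smoothMax_le {a t R : ℝ} (n : ℕ) (ha : a ≤ R) (ht : t ≤ R) : smoothMax a n t ≤ R + 1 := by
  have hmono : Monotone (smoothMax a n) :=
    monotone_of_deriv_nonneg (fun t => (hasDerivAt_smoothMax a n t).differentiableAt) fun t => by
      rw [(hasDerivAt_smoothMax a n t).deriv]; exact (smoothMaxDeriv_mem a n t).1
  refine (hmono ht).trans ?_
  rw [(smoothMax_of_le n ha).1]
  have : 1 / (2 * ((n : ℝ) + 1)) ≤ 1 := by
    rw [div_le_one (by positivity)]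
    have : (0 : ℝ) ≤ n := by positivity
    linarith
  linarith

lemma hasFDerivAt_norm_sub_sq (x y : E3) :
    HasFDerivAt (fun z : E3 => ‖z - x‖ ^ 2) (2 • innerSL ℝ (y - x)) y := by
  have h1 : HasFDerivAt (fun z : E3 => z - x) (ContinuousLinearMap.id ℝ E3) y :=
    (hasFDerivAt_id y).sub_const x
  simpa using h1.norm_sq

lemma continuousOn_gunterVec {Ω : Set E3} (hΩ : IsSmoothBoundedDomain Ω) (i j : Fin 3) :
    ContinuousOn (gunterVec Ω i j) (frontier Ω) := by
  have h := continuousOn_outwardNormal hΩ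
  have hk : ∀ k, ContinuousOn (fun y => outwardNormal Ω y k) (frontier Ω) := fun k =>
    (EuclideanSpace.proj (𝕜 := ℝ) k).continuous.comp_continuousOn h
  exact ((hk j).smul continuousOn_const).sub ((hk i).smul continuousOn_const)

/-- The Günter derivative of `φ(|y-x|²) G(y)`. -/
lemma gunterEntry_radial_mul {Ω : Set E3} (hΩ : IsSmoothBoundedDomain Ω) {x y : E3}
    (hy : y ∈ frontier Ω) {φ : ℝ → ℂ} {φ' : ℂ} (hφ : HasDerivAt φ φ' (‖y - x‖ ^ 2)) {G : E3 → ℂ}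
    (hG : DifferentiableWithinAt ℝ G (frontier Ω) y) (i j : Fin 3) :
    gunterEntry Ω i j (fun z => φ (‖z - x‖ ^ 2) * G z) y =
      φ' * ((2 * inner ℝ (y - x) (gunterVec Ω i j y) : ℝ) : ℂ) * G y
        + φ (‖y - x‖ ^ 2) * gunterEntry Ω i j G y := by
  have h1 := (hφ.hasFDerivAt.comp y (hasFDerivAt_norm_sub_sq x y)).hasFDerivWithinAt
    (s := frontier Ω)
  have h2 := h1.mul hG.hasFDerivWithinAt
  have h3 : HasFDerivWithinAt (fun z => φ (‖z - x‖ ^ 2) * G z) _ (frontier Ω) y := h2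
  rw [gunterEntry_eq hΩ hy h3, gunterEntry_eq hΩ hy hG.hasFDerivWithinAt, inner_sub_left]
  simp
  ring

lemma integrableOn_compl_ball {Ω : Set E3} (hΩ : IsSmoothBoundedDomain Ω) {x : E3} {ε : ℝ}
    {g : E3 → ℂ} (hg : ContinuousOn g (frontier Ω ∩ (ball x ε)ᶜ)) :
    IntegrableOn g (ball x ε)ᶜ (surfaceMeasure Ω) := by
  have := isFiniteMeasure_surfaceMeasure hΩ
  have hK : IsCompact (frontier Ω ∩ (ball x ε)ᶜ) :=
    (isCompact_frontier hΩ).inter_right isOpen_ball.isClosed_compl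
  have h1 : IntegrableOn g (frontier Ω ∩ (ball x ε)ᶜ) (surfaceMeasure Ω) :=
    hg.integrableOn_compact hK
  have h2 : (surfaceMeasure Ω).restrict (ball x ε)ᶜ
      = (surfaceMeasure Ω).restrict (frontier Ω ∩ (ball x ε)ᶜ) := by
    rw [surfaceMeasure, Measure.restrict_restrict isOpen_ball.isClosed_compl.measurableSet,
      Measure.restrict_restrict hK.isClosed.measurableSet]
    congr 1
    ext y; simp; tauto
  rwa [IntegrableOn, h2]

lemma setIntegral_congr_surface {Ω : Set E3} {s : Set E3} (hs : MeasurableSet s) {f g : E3 → ℂ}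
    (h : ∀ y ∈ frontier Ω, y ∈ s → f y = g y) :
    ∫ y in s, f y ∂(surfaceMeasure Ω) = ∫ y in s, g y ∂(surfaceMeasure Ω) := by
  rw [surfaceMeasure, Measure.restrict_restrict hs]
  exact setIntegral_congr_fun (hs.inter isClosed_frontier.measurableSet) fun y hy => h y hy.2 hy.1

lemma ae_mem_frontier (Ω : Set E3) : ∀ᵐ y ∂(surfaceMeasure Ω), y ∈ frontier Ω :=
  ae_restrict_mem isClosed_frontier.measurableSet

/-- Stokes' formula outside a ball, for a function that is a radial function times a regular one:
the boundary term is expressed through an integral over the ball. -/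
theorem setIntegral_compl_ball_gunterEntry {Ω : Set E3} (hΩ : IsSmoothBoundedDomain Ω) (x : E3)
    {ε : ℝ} (hε : 0 < ε) {φ φ' : ℝ → ℂ} (hφ : ∀ t, 0 < t → HasDerivAt φ (φ' t) t)
    (hφ' : ContinuousOn φ' (Ioi 0)) {G : E3 → ℂ} (hG : ContDiffOn ℝ 1 G (frontier Ω))
    (i j : Fin 3) :
    ∫ y in (ball x ε)ᶜ, gunterEntry Ω i j (fun z => φ (‖z - x‖ ^ 2) * G z) y ∂(surfaceMeasure Ω)
      = -(φ (ε ^ 2) * ∫ y in ball x ε, gunterEntry Ω i j G y ∂(surfaceMeasure Ω)) := by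
  have hε2 : 0 < ε ^ 2 := by positivity
  have hφc : ContinuousOn φ (Ioi 0) := fun t ht => (hφ t ht).continuousAt.continuousWithinAt
  set ρ : E3 → ℝ := fun y => ‖y - x‖ ^ 2 with hρ
  have hρc : Continuous ρ := by fun_prop
  set m : E3 → ℂ := fun y => ((2 * inner ℝ (y - x) (gunterVec Ω i j y) : ℝ) : ℂ)
  have hmc : ContinuousOn m (frontier Ω) := by
    refine Complex.continuous_ofReal.comp_continuousOn (continuousOn_const.mul ?_)
    exact ContinuousOn.inner (by fun_prop) (continuousOn_gunterVec hΩ i j)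
  have hgG := continuousOn_gunterEntry hΩ hG i j
  have hGc := hG.continuousOn
  have hGd := hG.differentiableOn one_ne_zero
  -- the approximations
  let D : ℕ → E3 → ℂ := fun n y =>
    φ' (smoothMax (ε ^ 2) n (ρ y)) * (smoothMaxDeriv (ε ^ 2) n (ρ y) : ℂ) * m y * G y
      + φ (smoothMax (ε ^ 2) n (ρ y)) * gunterEntry Ω i j G y
  -- The pointwise limit of `D n` on the surface. The non-strict inequality assigns the sphere to
  -- the exterior, in agreement with the complement of an open ball.
  let D₀ : E3 → ℂ := fun y => if ε ^ 2 ≤ ρ y then φ' (ρ y) * m y * G y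
      + φ (ρ y) * gunterEntry Ω i j G y else φ (ε ^ 2) * gunterEntry Ω i j G y
  have hsm : ∀ n, Continuous (smoothMax (ε ^ 2) n) := fun n =>
    continuous_iff_continuousAt.2 fun t => (hasDerivAt_smoothMax _ n t).continuousAt
  have hpos : ∀ n t, 0 < smoothMax (ε ^ 2) n t := fun n t => hε2.trans_le (le_smoothMax _ n t)
  have hcomp : ∀ (n : ℕ) (t : ℝ), HasDerivAt (fun t => φ (smoothMax (ε ^ 2) n t))
      (φ' (smoothMax (ε ^ 2) n t) * (smoothMaxDeriv (ε ^ 2) n t : ℂ)) t := fun n t => by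
    have := (hφ _ (hpos n t)).scomp t (hasDerivAt_smoothMax (ε ^ 2) n t)
    refine this.congr_deriv ?_
    rw [Complex.real_smul, mul_comm]
  have hderivc : ∀ n, Continuous fun t =>
      φ' (smoothMax (ε ^ 2) n t) * (smoothMaxDeriv (ε ^ 2) n t : ℂ) := fun n =>
    (hφ'.comp_continuous (hsm n) fun t => hpos n t).mul
      (Complex.continuous_ofReal.comp (continuous_smoothMaxDeriv _ n))
  have hint : ∀ n, Integrable (D n) (surfaceMeasure Ω) ∧ ∫ y, D n y ∂(surfaceMeasure Ω) = 0 := by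
    intro n
    have hcd : ContDiff ℝ 1 fun t => φ (smoothMax (ε ^ 2) n t) := by
      refine contDiff_one_iff_deriv.2 ⟨fun t => (hcomp n t).differentiableAt, ?_⟩
      have : deriv (fun t => φ (smoothMax (ε ^ 2) n t)) = _ := funext fun t => (hcomp n t).deriv
      rw [this]; exact hderivc n
    have hρs : ContDiff ℝ 1 ρ := (contDiff_id.sub contDiff_const).norm_sq ℝ
    have hf : ContDiffOn ℝ 1 (fun y => φ (smoothMax (ε ^ 2) n (ρ y)) * G y) (frontier Ω) :=
      (hcd.comp hρs).contDiffOn.mul hG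
    have heq : ∀ y ∈ frontier Ω,
        gunterEntry Ω i j (fun y => φ (smoothMax (ε ^ 2) n (ρ y)) * G y) y = D n y := fun y hy =>
      gunterEntry_radial_mul hΩ hy (hcomp n _) (hGd y hy) i j
    have h1 := integral_gunterEntry hΩ hf i j
    have h2 := integrable_of_continuousOn hΩ (continuousOn_gunterEntry hΩ hf i j)
    have hae : gunterEntry Ω i j (fun y => φ (smoothMax (ε ^ 2) n (ρ y)) * G y)
        =ᵐ[surfaceMeasure Ω] D n := (ae_mem_frontier Ω).mono heq
    exact ⟨h2.congr hae, (integral_congr_ae hae).symm.trans h1⟩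
  -- All values of the smoothed maximum lie in a fixed compact interval away from 0, where `φ` and
  -- `φ'` are bounded; this provides the dominating function.
  obtain ⟨R, hR⟩ := (isCompact_frontier hΩ).bddAbove_image hρc.continuousOn
  set R' := max R (ε ^ 2)
  obtain ⟨M, hM⟩ := (isCompact_Icc (a := ε ^ 2) (b := R' + 1)).exists_bound_of_continuousOn
    (hφ'.mono fun t ht => hε2.trans_le ht.1)
  obtain ⟨M', hM'⟩ := (isCompact_Icc (a := ε ^ 2) (b := R' + 1)).exists_bound_of_continuousOn
    (hφc.mono fun t ht => hε2.trans_le ht.1)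
  have hmem : ∀ y ∈ frontier Ω, ∀ n, smoothMax (ε ^ 2) n (ρ y) ∈ Icc (ε ^ 2) (R' + 1) :=
    fun y hy n => ⟨le_smoothMax _ _ _, smoothMax_le n (le_max_right _ _)
      ((hR (mem_image_of_mem _ hy)).trans (le_max_left _ _))⟩
  have hlim : Tendsto (fun n => ∫ y, D n y ∂(surfaceMeasure Ω)) atTop
      (𝓝 (∫ y, D₀ y ∂(surfaceMeasure Ω))) := by
    refine tendsto_integral_of_dominated_convergence
      (fun y => M * ‖m y * G y‖ + M' * ‖gunterEntry Ω i j G y‖)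
      (fun n => (hint n).1.aestronglyMeasurable) ?_ ?_ ?_
    · exact ((integrable_of_continuousOn hΩ (hmc.mul hGc)).norm.const_mul M).add
        ((integrable_of_continuousOn hΩ hgG).norm.const_mul M')
    · intro n
      filter_upwards [ae_mem_frontier Ω] with y hy
      refine (norm_add_le _ _).trans (add_le_add ?_ ?_)
      · rw [mul_assoc, norm_mul, norm_mul]
        have h1 := hM _ (hmem y hy n)
        have h2 : ‖(smoothMaxDeriv (ε ^ 2) n (ρ y) : ℂ)‖ ≤ 1 := by
          rw [Complex.norm_real, Real.norm_eq_abs, abs_of_nonneg (smoothMaxDeriv_mem _ _ _).1]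
          exact (smoothMaxDeriv_mem _ _ _).2
        refine mul_le_mul_of_nonneg_right ?_ (norm_nonneg _)
        calc _ ≤ M * 1 := mul_le_mul h1 h2 (norm_nonneg _) ((norm_nonneg _).trans h1)
          _ = M := mul_one M
      · rw [norm_mul]
        exact mul_le_mul_of_nonneg_right (hM' _ (hmem y hy n)) (norm_nonneg _)
    · filter_upwards [ae_mem_frontier Ω] with y hy
      by_cases h : ε ^ 2 ≤ ρ y
      · have hτ : Tendsto (fun n : ℕ => smoothMax (ε ^ 2) n (ρ y)) atTop (𝓝 (ρ y)) := by
          have h1 : Tendsto (fun n : ℕ => ρ y + 1 / (2 * ((n : ℝ) + 1))) atTop (𝓝 (ρ y + 1 / 2 * 0)) := by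
            refine tendsto_const_nhds.add ?_
            refine (tendsto_one_div_add_atTop_nhds_zero_nat.const_mul (1 / 2 : ℝ)).congr fun n => ?_
            field_simp
          rw [mul_zero, add_zero] at h1
          exact h1.congr fun n => (smoothMax_of_le n h).1.symm
        have hρy : 0 < ρ y := hε2.trans_le h
        have c1 := ((hφ'.continuousAt (Ioi_mem_nhds hρy)).tendsto.comp hτ)
        have c2 := ((hφc.continuousAt (Ioi_mem_nhds hρy)).tendsto.comp hτ)
        simp only [D, D₀, if_pos h]
        have h3 : ∀ n, smoothMaxDeriv (ε ^ 2) n (ρ y) = 1 := fun n => (smoothMax_of_le n h).2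
        simp only [h3, Complex.ofReal_one, mul_one]
        exact ((c1.mul_const _).mul_const _).add (c2.mul_const _)
      · simp only [D, D₀, if_neg h]
        refine tendsto_const_nhds.congr' ?_
        filter_upwards [smoothMax_of_lt (not_le.1 h)] with n hn
        rw [hn.1, hn.2]; simp
  have hzero : ∫ y, D₀ y ∂(surfaceMeasure Ω) = 0 :=
    tendsto_nhds_unique hlim (by simp only [(hint _).2]; exact tendsto_const_nhds)
  have hball : ∀ y, y ∈ ball x ε ↔ ¬ ε ^ 2 ≤ ρ y := fun y => by
    rw [mem_ball_iff_norm, not_le, hρ, sq_lt_sq₀ (norm_nonneg _) hε.le]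
  have e1 : ∫ y in (ball x ε)ᶜ, D₀ y ∂(surfaceMeasure Ω) = ∫ y in (ball x ε)ᶜ,
      gunterEntry Ω i j (fun z => φ (‖z - x‖ ^ 2) * G z) y ∂(surfaceMeasure Ω) := by
    refine setIntegral_congr_surface isOpen_ball.measurableSet.compl fun y hy hy' => ?_
    have h : ε ^ 2 ≤ ρ y := not_not.1 fun hh => hy' ((hball y).2 hh)
    simp only [D₀, if_pos h]
    exact (gunterEntry_radial_mul hΩ hy (hφ _ (hε2.trans_le h)) (hGd y hy) i j).symm
  have e2 : ∫ y in ball x ε, D₀ y ∂(surfaceMeasure Ω)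
      = φ (ε ^ 2) * ∫ y in ball x ε, gunterEntry Ω i j G y ∂(surfaceMeasure Ω) := by
    rw [← integral_const_mul]
    refine setIntegral_congr_surface isOpen_ball.measurableSet fun y hy hy' => ?_
    simp only [D₀, if_neg ((hball y).1 hy')]
  have i1 : IntegrableOn D₀ (ball x ε)ᶜ (surfaceMeasure Ω) := by
    refine integrableOn_compl_ball hΩ ?_
    have hc : ContinuousOn (fun y => φ' (ρ y) * m y * G y + φ (ρ y) * gunterEntry Ω i j G y)
        (frontier Ω ∩ (ball x ε)ᶜ) := by
      have hmaps : MapsTo ρ (frontier Ω ∩ (ball x ε)ᶜ) (Ioi 0) := fun y hy =>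
        hε2.trans_le (not_not.1 fun hh => hy.2 ((hball y).2 hh))
      exact (((hφ'.comp hρc.continuousOn hmaps).mul (hmc.mono inter_subset_left)).mul
        (hGc.mono inter_subset_left)).add ((hφc.comp hρc.continuousOn hmaps).mul
          (hgG.mono inter_subset_left))
    refine hc.congr fun y hy => ?_
    have h : ε ^ 2 ≤ ρ y := not_not.1 fun hh => hy.2 ((hball y).2 hh)
    simp only [D₀, if_pos h]
  have i2 : IntegrableOn D₀ (ball x ε) (surfaceMeasure Ω) := by
    have h1 : IntegrableOn (fun y => φ (ε ^ 2) * gunterEntry Ω i j G y) (ball x ε)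
      (surfaceMeasure Ω) := ((integrable_of_continuousOn hΩ hgG).const_mul _).integrableOn
    exact h1.congr_fun (fun y hy => by simp only [D₀, if_neg ((hball y).1 hy)])
      isOpen_ball.measurableSet
  -- The total is zero, so the exterior integral is minus the interior one. In the ball the radial
  -- factor is frozen at `φ (ε ^ 2)`.
  have hsplit := setIntegral_union (μ := surfaceMeasure Ω) (f := D₀)
    (disjoint_compl_right (a := ball x ε)) isOpen_ball.measurableSet.compl i2 i1
  rw [union_compl_self, setIntegral_univ, hzero, e1, e2] at hsplit
  linear_combination -hsplit

/-! ### Vanishing of the boundary terms. -/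

open Asymptotics

lemma isBigO_setIntegral_ball {Ω : Set E3} (hΩ : IsSmoothBoundedDomain Ω) {x : E3}
    (hx : x ∈ frontier Ω) {g : E3 → ℂ} (hg : ContinuousOn g (frontier Ω)) :
    (fun ε => ∫ y in ball x ε, g y ∂(surfaceMeasure Ω)) =O[𝓝[>] 0] fun ε : ℝ => ε ^ 2 := by
  have := isFiniteMeasure_surfaceMeasure hΩ
  obtain ⟨C, hC, hball⟩ := exists_measureReal_ball_le hΩ hx
  obtain ⟨M, hM⟩ := (isCompact_frontier hΩ).exists_bound_of_continuousOn hg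
  refine IsBigO.of_bound (M * C) (eventually_mem_nhdsWithin.mono fun ε (hε : 0 < ε) => ?_)
  have h1 : ∀ᵐ y ∂((surfaceMeasure Ω).restrict (ball x ε)), ‖g y‖ ≤ M :=
    ae_restrict_of_ae ((ae_mem_frontier Ω).mono hM)
  have h2 := norm_setIntegral_le_of_norm_le_const_ae (measure_lt_top _ _) h1
  have hM0 : 0 ≤ M := (norm_nonneg _).trans (hM x hx)
  calc _ ≤ M * (surfaceMeasure Ω).real (ball x ε) := h2
    _ ≤ M * (C * ε ^ 2) := mul_le_mul_of_nonneg_left (hball ε hε) hM0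
    _ = M * C * ‖ε ^ 2‖ := by rw [Real.norm_of_nonneg (by positivity)]; ring

lemma isLittleO_setIntegral_ball {Ω : Set E3} (hΩ : IsSmoothBoundedDomain Ω) {x : E3}
    (hx : x ∈ frontier Ω) {g : E3 → ℂ} (hg : g =o[𝓝[frontier Ω] x] fun y => ‖y - x‖) :
    (fun ε => ∫ y in ball x ε, g y ∂(surfaceMeasure Ω)) =o[𝓝[>] 0] fun ε : ℝ => ε ^ 3 := by
  have := isFiniteMeasure_surfaceMeasure hΩ
  obtain ⟨C, hC, hball⟩ := exists_measureReal_ball_le hΩ hx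
  refine IsLittleO.of_bound fun c hc => ?_
  have h0 := hg.bound (c := c / (C + 1)) (by positivity)
  obtain ⟨δ, hδ, hδ'⟩ := Metric.mem_nhdsWithin_iff.1 h0
  filter_upwards [Ioo_mem_nhdsGT hδ] with ε hε
  have hε0 : 0 < ε := hε.1
  have h1 : ∀ᵐ y ∂((surfaceMeasure Ω).restrict (ball x ε)), ‖g y‖ ≤ c / (C + 1) * ε := by
    filter_upwards [ae_restrict_of_ae (ae_mem_frontier Ω),
      ae_restrict_mem isOpen_ball.measurableSet] with y hy hyb
    have h2 := hδ' ⟨ball_subset_ball hε.2.le hyb, hy⟩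
    simp only [mem_ofPred_eq, norm_norm] at h2
    refine h2.trans (mul_le_mul_of_nonneg_left ?_ (by positivity))
    exact (mem_ball_iff_norm.1 hyb).le
  have h2 := norm_setIntegral_le_of_norm_le_const_ae (measure_lt_top _ _) h1
  calc _ ≤ c / (C + 1) * ε * (surfaceMeasure Ω).real (ball x ε) := h2
    _ ≤ c / (C + 1) * ε * (C * ε ^ 2) :=
        mul_le_mul_of_nonneg_left (hball ε hε0) (by positivity)
    _ = c * (C / (C + 1)) * ε ^ 3 := by ring
    _ ≤ c * 1 * ε ^ 3 := by
        gcongr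
        rw [div_le_one (by positivity)]; linarith
    _ = c * ‖ε ^ 3‖ := by rw [Real.norm_of_nonneg (by positivity)]; ring

lemma norm_coord_le (v : E3) (k : Fin 3) : ‖((v k : ℝ) : ℂ)‖ ≤ ‖v‖ := by
  rw [Complex.norm_real]
  exact PiLp.norm_apply_le v k

lemma isLittleO_mul_coord {Ω : Set E3} {x : E3} {h : E3 → ℂ}
    (hh : Tendsto h (𝓝[frontier Ω] x) (𝓝 0)) (k : Fin 3) :
    (fun y => h y * (((y - x) k : ℝ) : ℂ)) =o[𝓝[frontier Ω] x] fun y => ‖y - x‖ := by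
  have h1 : h =o[𝓝[frontier Ω] x] fun _ => (1 : ℝ) := (isLittleO_one_iff ℝ).2 hh
  have h2 : (fun y : E3 => (((y - x) k : ℝ) : ℂ)) =O[𝓝[frontier Ω] x] fun y => ‖y - x‖ :=
    IsBigO.of_bound 1 (Eventually.of_forall fun y => by
      rw [one_mul, norm_norm]; exact norm_coord_le _ _)
  simpa using h1.mul_isBigO h2

lemma continuousOn_normal_coord {Ω : Set E3} (hΩ : IsSmoothBoundedDomain Ω) (k : Fin 3) :
    ContinuousOn (fun y => ((outwardNormal Ω y k : ℝ) : ℂ)) (frontier Ω) :=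
  Complex.continuous_ofReal.comp_continuousOn
    ((EuclideanSpace.proj (𝕜 := ℝ) k).continuous.comp_continuousOn (continuousOn_outwardNormal hΩ))

lemma continuousOn_gunterVec_coord {Ω : Set E3} (hΩ : IsSmoothBoundedDomain Ω) (i j k : Fin 3) :
    ContinuousOn (fun y => ((gunterVec Ω i j y k : ℝ) : ℂ)) (frontier Ω) :=
  Complex.continuous_ofReal.comp_continuousOn
    ((EuclideanSpace.proj (𝕜 := ℝ) k).continuous.comp_continuousOn (continuousOn_gunterVec hΩ i j))

lemma continuous_coord_sub (x : E3) (k : Fin 3) :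
    Continuous fun y : E3 => (((y - x) k : ℝ) : ℂ) := by fun_prop

/-- Take `φ(t) = t` and `G = 1` in Stokes' formula outside the ball. The boundary term contains a
derivative of the constant 1, so the exterior integral of `m^{ij}|y-x|²` is zero, and with it the
interior one. -/
lemma setIntegral_ball_gunter_radius {Ω : Set E3} (hΩ : IsSmoothBoundedDomain Ω) (x : E3)
    {ε : ℝ} (hε : 0 < ε) (i j : Fin 3) :
    ∫ y in ball x ε, ((inner ℝ (y - x) (gunterVec Ω i j y) : ℝ) : ℂ) ∂(surfaceMeasure Ω) = 0 := by
  have h1 : ContDiffOn ℝ 1 (fun _ : E3 => (1 : ℂ)) (frontier Ω) := contDiffOn_const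
  have hd : ∀ t : ℝ, HasDerivAt (fun t : ℝ => (t : ℂ)) 1 t := fun t => Complex.ofRealCLM.hasDerivAt
  have hone : ∀ y ∈ frontier Ω, gunterEntry Ω i j (fun _ => (1 : ℂ)) y = 0 := fun y hy => by
    rw [gunterEntry_eq hΩ hy (hasFDerivWithinAt_const (1 : ℂ) y _)]; simp
  have h2 := setIntegral_compl_ball_gunterEntry hΩ x hε (φ := fun t => (t : ℂ)) (φ' := fun _ => 1)
    (fun t _ => hd t) continuousOn_const h1 i j
  rw [setIntegral_congr_surface isOpen_ball.measurableSet (fun y hy _ => hone y hy)] at h2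
  simp only [integral_zero, mul_zero, neg_zero] at h2
  have hcd : ContDiff ℝ 1 (fun z : E3 => ((‖z - x‖ ^ 2 : ℝ) : ℂ) * 1) :=
    (Complex.ofRealCLM.contDiff.comp ((contDiff_id.sub contDiff_const).norm_sq ℝ)).mul
      contDiff_const
  have h3 := integral_gunterEntry hΩ hcd.contDiffOn i j
  have hint := integrable_of_continuousOn hΩ (continuousOn_gunterEntry hΩ hcd.contDiffOn i j)
  rw [← integral_add_compl isOpen_ball.measurableSet hint, h2, add_zero] at h3
  rw [setIntegral_congr_surface (g := fun y =>
    2 * ((inner ℝ (y - x) (gunterVec Ω i j y) : ℝ) : ℂ)) isOpen_ball.measurableSet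
    (fun y hy _ => by
      have := gunterEntry_radial_mul hΩ (x := x) hy (hd _) (h1.differentiableOn one_ne_zero y hy) i j
      rw [this, hone y hy]; push_cast; ring), integral_const_mul] at h3
  simpa using h3

lemma inner_gunterVec (Ω : Set E3) (d y : E3) (i j : Fin 3) :
    inner ℝ d (gunterVec Ω i j y) = outwardNormal Ω y j * d i - outwardNormal Ω y i * d j := by
  rw [gunterVec, inner_sub_right, inner_smul_right, inner_smul_right]
  simp [EuclideanSpace.inner_single_right]

/-- The first moment of a small surface ball is of higher order than expected. -/
lemma isLittleO_first_moment {Ω : Set E3} (hΩ : IsSmoothBoundedDomain Ω) {x : E3}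
    (hx : x ∈ frontier Ω) (k : Fin 3) :
    (fun ε => ∫ y in ball x ε, (((y - x) k : ℝ) : ℂ) ∂(surfaceMeasure Ω))
      =o[𝓝[>] 0] fun ε : ℝ => ε ^ 3 := by
  set ν := outwardNormal Ω with hν
  -- Contracting `ν_b(y) d_k - ν_k(y) d_b`, `d = y - x`, with `ν_b(x)` gives `(ν(x)·ν(y)) d_k -
  -- ν_k(y) (ν(x)·d)`. Its ball integral vanishes, and `g` is what separates it from `d_k`. Both
  -- terms of `g` are `o(|d|)`: one by continuity of the normal, the other because `ν(x)·d` is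
  -- quadratic.
  let g : E3 → ℂ := fun y => ((1 - inner ℝ (ν x) (ν y) : ℝ) : ℂ) * (((y - x) k : ℝ) : ℂ)
    + ((ν y k * inner ℝ (ν x) (y - x) : ℝ) : ℂ)
  have hνc := continuousOn_outwardNormal hΩ
  have hcoord : ∀ k, Continuous fun y : E3 => (y - x) k := fun k => by fun_prop
  have hdec : ∀ y, (((y - x) k : ℝ) : ℂ)
      = g y + ∑ b, ((ν x b : ℝ) : ℂ) * ((inner ℝ (y - x) (gunterVec Ω k b y) : ℝ) : ℂ) := by
    intro y
    simp only [g, inner_gunterVec, ← hν]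
    simp only [inner_E3, Fin.sum_univ_three]
    push_cast
    ring
  have heq : ∀ ε > 0, ∫ y in ball x ε, (((y - x) k : ℝ) : ℂ) ∂(surfaceMeasure Ω)
      = ∫ y in ball x ε, g y ∂(surfaceMeasure Ω) := by
    intro ε hε
    have hi : ∀ b, Integrable (fun y =>
        ((ν x b : ℝ) : ℂ) * ((inner ℝ (y - x) (gunterVec Ω k b y) : ℝ) : ℂ))
        (surfaceMeasure Ω) := fun b => by
      refine integrable_of_continuousOn hΩ (continuousOn_const.mul ?_)
      exact Complex.continuous_ofReal.comp_continuousOn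
        (ContinuousOn.inner (by fun_prop) (continuousOn_gunterVec hΩ k b))
    have hg : Integrable g (surfaceMeasure Ω) := by
      refine integrable_of_continuousOn hΩ ?_
      refine ContinuousOn.add (ContinuousOn.mul ?_ (continuous_coord_sub x k).continuousOn) ?_
      · exact Complex.continuous_ofReal.comp_continuousOn
          (continuousOn_const.sub (continuousOn_const.inner hνc))
      · refine Complex.continuous_ofReal.comp_continuousOn (ContinuousOn.mul ?_ (by fun_prop))
        exact (EuclideanSpace.proj (𝕜 := ℝ) k).continuous.comp_continuousOn hνc
    simp only [hdec]
    rw [integral_add hg.integrableOn (integrable_finsetSum _ fun b _ => (hi b).integrableOn),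
      integral_finsetSum _ fun b _ => (hi b).integrableOn]
    simp only [integral_const_mul, setIntegral_ball_gunter_radius hΩ x hε]
    simp
  have hlo : g =o[𝓝[frontier Ω] x] fun y => ‖y - x‖ := by
    refine IsLittleO.add (isLittleO_mul_coord ?_ k) ?_
    · have hc : ContinuousWithinAt (fun y => ((1 - inner ℝ (ν x) (ν y) : ℝ) : ℂ)) (frontier Ω) x :=
        (Complex.continuous_ofReal.comp_continuousOn
          (continuousOn_const.sub (continuousOn_const.inner hνc))) x hx
      have h0 : ((1 - inner ℝ (ν x) (ν x) : ℝ) : ℂ) = 0 := by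
        rw [real_inner_self_eq_norm_sq, norm_outwardNormal hΩ hx]; simp
      have := hc.tendsto
      rwa [h0] at this
    · obtain ⟨C, hC, hCb⟩ := exists_inner_normal_le hΩ
      have h1 : (fun y => ((ν y k * inner ℝ (ν x) (y - x) : ℝ) : ℂ))
          =O[𝓝[frontier Ω] x] fun y => ‖y - x‖ ^ 2 := by
        refine IsBigO.of_bound C (eventually_mem_nhdsWithin.mono fun y hy => ?_)
        have h2 := hCb x hx y hy
        rw [← neg_sub, inner_neg_right, abs_neg, norm_neg] at h2
        have h3 : |ν y k| ≤ 1 := by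
          have := PiLp.norm_apply_le (ν y) k
          rwa [norm_outwardNormal hΩ hy] at this
        rw [Complex.norm_real, Real.norm_eq_abs, abs_mul, norm_pow, norm_norm,
          norm_sub_rev, ← norm_neg, neg_sub]
        rw [norm_sub_rev, ← norm_neg, neg_sub] at h2
        calc _ ≤ 1 * _ := mul_le_mul_of_nonneg_right h3 (abs_nonneg _)
          _ ≤ _ := by rw [one_mul]; simpa [norm_sub_rev] using h2
      refine h1.trans_isLittleO ?_
      have ht : Tendsto (fun y : E3 => ‖y - x‖) (𝓝[frontier Ω] x) (𝓝 0) := by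
        have : Continuous fun y : E3 => ‖y - x‖ := by fun_prop
        simpa using (this.tendsto x).mono_left nhdsWithin_le_nhds
      exact (isLittleO_pow_id one_lt_two).comp_tendsto ht
  exact (isLittleO_setIntegral_ball hΩ hx hlo).congr'
    (eventually_mem_nhdsWithin.mono fun ε hε => (heq ε hε).symm) EventuallyEq.rfl

/-- The boundary term of a kernel `φ(|y-x|²)` of order `1/|y-x|` vanishes in the limit. -/
theorem tendsto_setIntegral_compl_ball_gunterEntry {Ω : Set E3} (hΩ : IsSmoothBoundedDomain Ω)
    {x : E3} (hx : x ∈ frontier Ω) {φ φ' : ℝ → ℂ} (hφ : ∀ t, 0 < t → HasDerivAt φ (φ' t) t)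
    (hφ' : ContinuousOn φ' (Ioi 0))
    (hφO : (fun ε : ℝ => φ (ε ^ 2)) =O[𝓝[>] 0] fun ε : ℝ => ε⁻¹) {u : E3 → ℂ}
    (hu : ContDiffOn ℝ 1 u (frontier Ω)) (i j : Fin 3) :
    Tendsto (fun ε => ∫ y in (ball x ε)ᶜ,
      gunterEntry Ω i j (fun z => φ (‖z - x‖ ^ 2) * u z) y ∂(surfaceMeasure Ω))
      (𝓝[>] 0) (𝓝 0) := by
  -- The boundary term is `O(ε⁻¹)` times `O(ε²)`.
  have h1 := hφO.mul (isBigO_setIntegral_ball hΩ hx (continuousOn_gunterEntry hΩ hu i j))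
  have h2 : (fun ε : ℝ => ε⁻¹ * ε ^ 2) =ᶠ[𝓝[>] 0] fun ε => ε :=
    eventually_mem_nhdsWithin.mono fun ε (hε : 0 < ε) => by field_simp
  have h3 : Tendsto (fun ε : ℝ => ε) (𝓝[>] 0) (𝓝 0) := nhdsWithin_le_nhds
  have h4 := ((h1.congr' EventuallyEq.rfl h2).trans_tendsto h3).neg
  rw [neg_zero] at h4
  exact h4.congr' (eventually_mem_nhdsWithin.mono fun ε hε =>
    (setIntegral_compl_ball_gunterEntry hΩ x hε hφ hφ' hu i j).symm)

/-- By the product rule the integrand is linear in `y - x` with continuous coefficients, up to a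
quadratic term from the derivative of `u`. Freezing the coefficients at `x` costs `o(|y-x|)`, and
what remains are first moments. The gain over the obvious `O(ε³)` is needed to beat a factor of size
`ε⁻³`. -/
lemma isLittleO_setIntegral_ball_gunterEntry {Ω : Set E3} (hΩ : IsSmoothBoundedDomain Ω)
    {x : E3} (hx : x ∈ frontier Ω) {u : E3 → ℂ} (hu : ContDiffOn ℝ 1 u (frontier Ω))
    (k l i j : Fin 3) :
    (fun ε => ∫ y in ball x ε, gunterEntry Ω i j
      (fun z => (((z - x) k : ℝ) : ℂ) * (((z - x) l : ℝ) : ℂ) * u z) y ∂(surfaceMeasure Ω))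
      =o[𝓝[>] 0] fun ε : ℝ => ε ^ 3 := by
  let a : Fin 3 → E3 → ℂ := fun k y => u y * ((gunterVec Ω i j y k : ℝ) : ℂ)
  have hac : ∀ k, ContinuousOn (a k) (frontier Ω) := fun k =>
    hu.continuousOn.mul (continuousOn_gunterVec_coord hΩ i j k)
  have hgc := continuousOn_gunterEntry hΩ hu i j
  have hcoord := continuous_coord_sub x
  let g : E3 → ℂ := fun y => (a k y - a k x) * (((y - x) l : ℝ) : ℂ)
    + (a l y - a l x) * (((y - x) k : ℝ) : ℂ)
    + (((y - x) k : ℝ) : ℂ) * gunterEntry Ω i j u y * (((y - x) l : ℝ) : ℂ)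
  have hform : ∀ y ∈ frontier Ω, gunterEntry Ω i j
      (fun z => (((z - x) k : ℝ) : ℂ) * (((z - x) l : ℝ) : ℂ) * u z) y
      = g y + (a k x * (((y - x) l : ℝ) : ℂ) + a l x * (((y - x) k : ℝ) : ℂ)) := by
    intro y hy
    have hd : ∀ k : Fin 3, HasFDerivWithinAt (fun z : E3 => (((z - x) k : ℝ) : ℂ))
        (Complex.ofRealCLM.comp (EuclideanSpace.proj (𝕜 := ℝ) k)) (frontier Ω) y := fun k => by
      have h1 : HasFDerivAt (fun z : E3 => (z - x) k) (EuclideanSpace.proj (𝕜 := ℝ) k) y :=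
        (EuclideanSpace.proj (𝕜 := ℝ) k).hasFDerivAt.comp y ((hasFDerivAt_id y).sub_const x)
      exact (Complex.ofRealCLM.hasFDerivAt.comp y h1).hasFDerivWithinAt
    have hud := (hu.differentiableOn one_ne_zero y hy).hasFDerivWithinAt
    have h2 : HasFDerivWithinAt
      (fun z => (((z - x) k : ℝ) : ℂ) * (((z - x) l : ℝ) : ℂ) * u z) _ (frontier Ω) y :=
      ((hd k).mul (hd l)).mul hud
    rw [gunterEntry_eq hΩ hy h2]
    simp only [g, a, gunterEntry_eq hΩ hy hud]
    simp
    ring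
  have hg : g =o[𝓝[frontier Ω] x] fun y => ‖y - x‖ := by
    have ht : ∀ k, Tendsto (fun y => a k y - a k x) (𝓝[frontier Ω] x) (𝓝 0) := fun k => by
      have := ((hac k) x hx).tendsto.sub_const (a k x)
      rwa [sub_self] at this
    refine ((isLittleO_mul_coord (ht k) l).add (isLittleO_mul_coord (ht l) k)).add
      (isLittleO_mul_coord ?_ l)
    have := (((hcoord k).continuousOn.mul hgc) x hx).tendsto
    simpa [Pi.mul_def] using this
  have hgi : Integrable g (surfaceMeasure Ω) := integrable_of_continuousOn hΩ <|
    ((((hac k).sub continuousOn_const).mul (hcoord l).continuousOn).add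
      (((hac l).sub continuousOn_const).mul (hcoord k).continuousOn)).add
      (((hcoord k).continuousOn.mul hgc).mul (hcoord l).continuousOn)
  have hci : ∀ k, Integrable (fun y : E3 => (((y - x) k : ℝ) : ℂ)) (surfaceMeasure Ω) := fun k =>
    integrable_of_continuousOn hΩ (hcoord k).continuousOn
  have heq : ∀ ε, ∫ y in ball x ε, gunterEntry Ω i j
      (fun z => (((z - x) k : ℝ) : ℂ) * (((z - x) l : ℝ) : ℂ) * u z) y ∂(surfaceMeasure Ω)
      = ∫ y in ball x ε, g y ∂(surfaceMeasure Ω)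
        + (a k x * ∫ y in ball x ε, (((y - x) l : ℝ) : ℂ) ∂(surfaceMeasure Ω)
          + a l x * ∫ y in ball x ε, (((y - x) k : ℝ) : ℂ) ∂(surfaceMeasure Ω)) := by
    intro ε
    have hsum : Integrable (fun y : E3 => a k x * (((y - x) l : ℝ) : ℂ)
        + a l x * (((y - x) k : ℝ) : ℂ)) (surfaceMeasure Ω) :=
      ((hci l).const_mul _).add ((hci k).const_mul _)
    rw [setIntegral_congr_surface isOpen_ball.measurableSet fun y hy _ => hform y hy,
      integral_add hgi.integrableOn hsum.integrableOn,
      integral_add ((hci l).const_mul _).integrableOn ((hci k).const_mul _).integrableOn,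
      integral_const_mul, integral_const_mul]
  simp only [heq]
  exact (isLittleO_setIntegral_ball hΩ hx hg).add
    (((isLittleO_first_moment hΩ hx l).const_mul_left _).add
      ((isLittleO_first_moment hΩ hx k).const_mul_left _))

/-- The boundary term of a kernel `φ(|y-x|²) (y-x)_k (y-x)_l` of order `1/|y-x|` vanishes in the
limit. -/
theorem tendsto_setIntegral_compl_ball_gunterEntry' {Ω : Set E3} (hΩ : IsSmoothBoundedDomain Ω)
    {x : E3} (hx : x ∈ frontier Ω) {φ φ' : ℝ → ℂ} (hφ : ∀ t, 0 < t → HasDerivAt φ (φ' t) t)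
    (hφ' : ContinuousOn φ' (Ioi 0))
    (hφO : (fun ε : ℝ => φ (ε ^ 2)) =O[𝓝[>] 0] fun ε : ℝ => (ε ^ 3)⁻¹) {u : E3 → ℂ}
    (hu : ContDiffOn ℝ 1 u (frontier Ω)) (k l i j : Fin 3) :
    Tendsto (fun ε => ∫ y in (ball x ε)ᶜ, gunterEntry Ω i j (fun z => φ (‖z - x‖ ^ 2) *
      ((((z - x) k : ℝ) : ℂ) * (((z - x) l : ℝ) : ℂ) * u z)) y ∂(surfaceMeasure Ω))
      (𝓝[>] 0) (𝓝 0) := by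
  have hG : ContDiffOn ℝ 1 (fun z : E3 => (((z - x) k : ℝ) : ℂ) * (((z - x) l : ℝ) : ℂ) * u z)
      (frontier Ω) := by
    have hd : ∀ k : Fin 3, ContDiff ℝ 1 (fun z : E3 => (((z - x) k : ℝ) : ℂ)) := fun k =>
      Complex.ofRealCLM.contDiff.comp
        ((EuclideanSpace.proj (𝕜 := ℝ) k).contDiff.comp (contDiff_id.sub contDiff_const))
    exact ((hd k).mul (hd l)).contDiffOn.mul hu
  have h1 := hφO.mul_isLittleO (isLittleO_setIntegral_ball_gunterEntry hΩ hx hu k l i j)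
  have h2 : (fun ε : ℝ => (ε ^ 3)⁻¹ * ε ^ 3) =ᶠ[𝓝[>] 0] fun _ => 1 :=
    eventually_mem_nhdsWithin.mono fun ε (hε : 0 < ε) => by field_simp
  have h4 := ((isLittleO_one_iff ℝ).1 (h1.congr' EventuallyEq.rfl h2)).neg
  rw [neg_zero] at h4
  exact h4.congr' (eventually_mem_nhdsWithin.mono fun ε hε =>
    (setIntegral_compl_ball_gunterEntry hΩ x hε hφ hφ' hG i j).symm)

/-! ### Radial derivatives of the Helmholtz kernel. -/

open Asymptotics

/-- The polynomials that occur in the derivatives of `exp(ikr)/r`. -/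
def helmPoly : ℕ → ℂ → ℂ
  | 0, _ => 1
  | 1, z => z - 1
  | 2, z => z ^ 2 - 3 * z + 3
  -- Meant for index 3. Larger indices also take this value, but the recursion below is asserted
  -- only up to index 3.
  | _, z => z ^ 3 - 6 * z ^ 2 + 15 * z - 15

/-- The `n`-th radial derivative `(r⁻¹ d/dr)ⁿ` of `exp(ikr)/(4πr)`, as a function of `t = r²`. -/
def helmRad (n : ℕ) (k : ℂ) (t : ℝ) : ℂ :=
  helmPoly n (Complex.I * k * (√t : ℂ)) * Complex.exp (Complex.I * k * (√t : ℂ))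
    / (4 * (Real.pi : ℂ) * (√t : ℂ) ^ (2 * n + 1))

/-- With `z = ikr` the polynomials satisfy `p_{n+1} = z (p_n' + p_n) - (2n+1) p_n`. The factor 1/2
arises because `r⁻¹ d/dr` is twice the derivative in `t = r²`. -/
lemma hasDerivAt_helmRad (n : ℕ) (hn : n < 3) (k : ℂ) {t : ℝ} (ht : 0 < t) :
    HasDerivAt (helmRad n k) (helmRad (n + 1) k t / 2) t := by
  have hs : 0 < √t := Real.sqrt_pos.2 ht
  have hs' : ((√t : ℝ) : ℂ) ≠ 0 := by exact_mod_cast hs.ne'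
  have hpi : (Real.pi : ℂ) ≠ 0 := by exact_mod_cast Real.pi_ne_zero
  have h1 : HasDerivAt (fun t : ℝ => ((√t : ℝ) : ℂ)) (1 / (2 * ((√t : ℝ) : ℂ))) t := by
    have := (Real.hasDerivAt_sqrt ht.ne').ofReal_comp
    simpa using this
  have hP : ∀ z : ℂ, ∃ P', HasDerivAt (helmPoly n) P' z ∧
      helmPoly (n + 1) z = z * (P' + helmPoly n z) - (2 * n + 1) * helmPoly n z := by
    intro z
    interval_cases n
    · exact ⟨0, hasDerivAt_const z 1, by simp only [helmPoly]; push_cast; ring⟩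
    · exact ⟨1, (hasDerivAt_id z).sub_const 1, by simp only [helmPoly]; push_cast; ring⟩
    · refine ⟨2 * z - 3, ?_, by simp only [helmPoly]; push_cast; ring⟩
      have := ((hasDerivAt_pow 2 z).sub ((hasDerivAt_id z).const_mul (3 : ℂ))).add_const (3 : ℂ)
      exact this.congr_deriv (by simp)
  obtain ⟨P', hP', hrec⟩ := hP (Complex.I * k * ((√t : ℝ) : ℂ))
  have h2 := h1.const_mul (Complex.I * k)
  have h3 := (hP'.comp t h2).mul h2.cexp
  have h4 := (h1.pow (2 * n + 1)).const_mul (4 * (Real.pi : ℂ))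
  have h5 := h3.div h4 (mul_ne_zero (mul_ne_zero (by norm_num) hpi) (pow_ne_zero _ hs'))
  refine h5.congr_deriv ?_
  simp only [helmRad, hrec, Function.comp, Pi.mul_apply, Pi.pow_apply]
  have e1 : 2 * (n + 1) + 1 = 2 * n + 3 := by ring
  rw [e1]
  simp only [Nat.add_sub_cancel]
  have e2 : ((√t : ℝ) : ℂ) ^ (2 * n + 3) = ((√t : ℝ) : ℂ) ^ (2 * n) * ((√t : ℝ) : ℂ) ^ 3 := by ring
  have e3 : ((√t : ℝ) : ℂ) ^ (2 * n + 1) = ((√t : ℝ) : ℂ) ^ (2 * n) * ((√t : ℝ) : ℂ) := by ring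
  rw [e2, e3]
  have h6 : ((√t : ℝ) : ℂ) ^ (2 * n) ≠ 0 := pow_ne_zero _ hs'
  push_cast
  field_simp

lemma continuousOn_helmRad (n : ℕ) (k : ℂ) : ContinuousOn (helmRad n k) (Ioi 0) := by
  have hc : Continuous fun t : ℝ => ((√t : ℝ) : ℂ) :=
    Complex.continuous_ofReal.comp Real.continuous_sqrt
  have hP : Continuous (helmPoly n) := by
    match n with
    | 0 => exact continuous_const
    | 1 => exact (by fun_prop : Continuous fun z : ℂ => z - 1)
    | 2 => exact (by fun_prop : Continuous fun z : ℂ => z ^ 2 - 3 * z + 3)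
    | n + 3 => exact (by fun_prop : Continuous fun z : ℂ => z ^ 3 - 6 * z ^ 2 + 15 * z - 15)
  refine ContinuousOn.div ?_ ?_ ?_
  · exact ((hP.comp (continuous_const.mul hc)).mul
      (Complex.continuous_exp.comp (continuous_const.mul hc))).continuousOn
  · exact (continuous_const.mul (hc.pow _)).continuousOn
  · intro t ht
    have hs : 0 < √t := Real.sqrt_pos.2 ht
    have hpi : (Real.pi : ℂ) ≠ 0 := by exact_mod_cast Real.pi_ne_zero
    exact mul_ne_zero (mul_ne_zero (by norm_num) hpi)
      (pow_ne_zero _ (by exact_mod_cast hs.ne'))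

lemma norm_exp_sub_one_sub_le (z : ℂ) :
    ‖Complex.exp z - 1 - z‖ ≤ ‖z‖ ^ 2 * Real.exp ‖z‖ := by
  have := Complex.norm_exp_sub_sum_le_norm_mul_exp z 2
  simpa [Finset.sum_range_succ, sub_sub] using this

/-- Both expansions at 0 have no linear term: `(z-1)(1+z) = -1 + z²` and `(z²-3z+3)(1+z) = 3 +
(z-2)z²`. The rest carries the remainder `exp z - 1 - z`. -/
lemma exists_helmPoly_bound (Z : ℝ) : ∃ C : ℝ, 0 ≤ C ∧ ∀ z : ℂ, ‖z‖ ≤ Z →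
    ‖helmPoly 1 z * Complex.exp z + 1‖ ≤ C * ‖z‖ ^ 2 ∧
    ‖helmPoly 2 z * Complex.exp z - 3‖ ≤ C * ‖z‖ ^ 2 := by
  refine ⟨((|Z| + 1) * Real.exp |Z| + 1) + ((|Z| ^ 2 + 3 * |Z| + 3) * Real.exp |Z| + |Z| + 2),
    by positivity, fun z hz => ?_⟩
  have hz' : ‖z‖ ≤ |Z| := hz.trans (le_abs_self Z)
  set E := Complex.exp z - 1 - z
  have hE : ‖E‖ ≤ ‖z‖ ^ 2 * Real.exp |Z| :=
    (norm_exp_sub_one_sub_le z).trans (by gcongr)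
  have hexp : Complex.exp z = E + (1 + z) := by simp only [E]; ring
  have hz2 : 0 ≤ ‖z‖ ^ 2 := by positivity
  have hZ : 0 ≤ |Z| := abs_nonneg Z
  have hx : 0 < Real.exp |Z| := Real.exp_pos _
  constructor
  · have e : helmPoly 1 z * Complex.exp z + 1 = (z - 1) * E + z ^ 2 := by
      rw [hexp]; simp only [helmPoly]; ring
    have h1 : ‖(z - 1) * E + z ^ 2‖ ≤ (|Z| + 1) * (‖z‖ ^ 2 * Real.exp |Z|) + ‖z‖ ^ 2 := by
      refine (norm_add_le _ _).trans ?_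
      rw [norm_mul, norm_pow]
      gcongr
      exact (norm_sub_le _ _).trans (by simpa using hz')
    rw [e]
    have : 0 ≤ ((|Z| ^ 2 + 3 * |Z| + 3) * Real.exp |Z| + |Z| + 2) * ‖z‖ ^ 2 := by positivity
    linarith
  · have e : helmPoly 2 z * Complex.exp z - 3 = (z ^ 2 - 3 * z + 3) * E + (z - 2) * z ^ 2 := by
      rw [hexp]; simp only [helmPoly]; ring
    have h1 : ‖(z ^ 2 - 3 * z + 3) * E + (z - 2) * z ^ 2‖
        ≤ (|Z| ^ 2 + 3 * |Z| + 3) * (‖z‖ ^ 2 * Real.exp |Z|) + (|Z| + 2) * ‖z‖ ^ 2 := by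
      refine (norm_add_le _ _).trans ?_
      rw [norm_mul, norm_mul, norm_pow]
      gcongr
      · refine (norm_add_le _ _).trans ?_
        refine add_le_add ((norm_sub_le _ _).trans ?_) (by simp)
        rw [norm_pow, norm_mul]
        simp only [Complex.norm_ofNat]
        gcongr
      · exact (norm_sub_le _ _).trans (by simpa using hz')
    rw [e]
    have : 0 ≤ ((|Z| + 1) * Real.exp |Z| + 1) * ‖z‖ ^ 2 := by positivity
    linarith

lemma helmRad_sq (n : ℕ) (k : ℂ) {r : ℝ} (hr : 0 ≤ r) : helmRad n k (r ^ 2) =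
    helmPoly n (Complex.I * k * (r : ℂ)) * Complex.exp (Complex.I * k * (r : ℂ))
    / (4 * (Real.pi : ℂ) * (r : ℂ) ^ (2 * n + 1)) := by
  rw [helmRad, Real.sqrt_sq hr]

/-- The leading terms `-1/(4πr³)` and `3/(4πr⁵)` do not depend on `k`, and the remainders are two
orders better. Therefore combinations with coefficients of sum zero gain two orders. -/
lemma exists_helmRad_bound (k : ℂ) (R : ℝ) : ∃ C : ℝ, 0 ≤ C ∧ ∀ r, 0 < r → r ≤ R →
    ‖helmRad 0 k (r ^ 2)‖ ≤ C * r⁻¹ ∧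
    ‖helmRad 1 k (r ^ 2)‖ ≤ C * (r ^ 3)⁻¹ ∧
    ‖helmRad 1 k (r ^ 2) + 1 / (4 * (Real.pi : ℂ) * (r : ℂ) ^ 3)‖ ≤ C * r⁻¹ ∧
    ‖helmRad 2 k (r ^ 2) - 3 / (4 * (Real.pi : ℂ) * (r : ℂ) ^ 5)‖ ≤ C * (r ^ 3)⁻¹ := by
  obtain ⟨C, hC, hb⟩ := exists_helmPoly_bound (‖k‖ * R)
  have hpi : (1 : ℝ) ≤ 4 * Real.pi := by linarith [Real.pi_gt_three]
  have hpic : (Real.pi : ℂ) ≠ 0 := by exact_mod_cast Real.pi_ne_zero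
  have hdiv : ∀ (w : ℂ) (r : ℝ), 0 < r → ∀ m : ℕ,
      ‖w / (4 * (Real.pi : ℂ) * (r : ℂ) ^ m)‖ ≤ ‖w‖ * (r ^ m)⁻¹ := by
    intro w r hr m
    rw [norm_div, norm_mul, norm_mul, norm_pow, Complex.norm_real, Complex.norm_real,
      Real.norm_of_nonneg hr.le, Real.norm_of_nonneg Real.pi_pos.le, Complex.norm_ofNat,
      div_eq_mul_inv, mul_inv]
    gcongr
    have h1 : (4 * Real.pi)⁻¹ ≤ 1 := inv_le_one_of_one_le₀ hpi
    have : 0 < (r ^ m)⁻¹ := by positivity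
    nlinarith
  set K := C * (‖k‖ ^ 2) with hK
  have hK0 : 0 ≤ K := by positivity
  refine ⟨Real.exp (‖k‖ * R) + K + (K * |R| ^ 2 + 1), by positivity, fun r hr hrR => ?_⟩
  set z : ℂ := Complex.I * k * (r : ℂ) with hz
  have hzn : ‖z‖ = ‖k‖ * r := by
    rw [hz, norm_mul, norm_mul, Complex.norm_I, one_mul, Complex.norm_real,
      Real.norm_of_nonneg hr.le]
  have hzR : ‖z‖ ≤ ‖k‖ * R := by rw [hzn]; gcongr
  obtain ⟨b1, b2⟩ := hb z hzR
  rw [hzn, mul_pow, ← mul_assoc] at b1 b2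
  have hexp : ‖Complex.exp z‖ ≤ Real.exp (‖k‖ * R) :=
    (Complex.norm_exp_le_exp_norm z).trans (Real.exp_le_exp.2 hzR)
  have hrc : (r : ℂ) ≠ 0 := by exact_mod_cast hr.ne'
  have hexp0 := Real.exp_pos (‖k‖ * R)
  have hR2 : 0 ≤ K * |R| ^ 2 := by positivity
  have hrR2 : r ^ 2 ≤ |R| ^ 2 := by
    gcongr; exact hrR.trans (le_abs_self R)
  rw [helmRad_sq 0 k hr.le, helmRad_sq 1 k hr.le, helmRad_sq 2 k hr.le]
  refine ⟨?_, ?_, ?_, ?_⟩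
  · refine (hdiv _ r hr _).trans ?_
    simp only [helmPoly, one_mul, mul_zero, zero_add, pow_one]
    gcongr
    linarith
  · refine (hdiv _ r hr _).trans ?_
    gcongr
    have h3 := norm_sub_le (helmPoly 1 z * Complex.exp z + 1) 1
    rw [add_sub_cancel_right, norm_one] at h3
    have : K * r ^ 2 ≤ K * |R| ^ 2 := by gcongr
    linarith
  · rw [show 2 * 1 + 1 = 3 from rfl, ← add_div]
    refine (hdiv _ r hr _).trans ?_
    calc _ ≤ K * r ^ 2 * (r ^ 3)⁻¹ := by gcongr
      _ = K * r⁻¹ := by field_simp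
      _ ≤ _ := by gcongr; linarith
  · rw [show 2 * 2 + 1 = 5 from rfl, ← sub_div]
    refine (hdiv _ r hr _).trans ?_
    calc _ ≤ K * r ^ 2 * (r ^ 5)⁻¹ := by gcongr
      _ = K * (r ^ 3)⁻¹ := by field_simp
      _ ≤ _ := by gcongr; linarith

/-! ### Partial derivatives of functions that are smooth away from the origin -/

lemma pd_comp_sub (i : Fin 3) (F : E3 → ℂ) (y x : E3) :
    pd i (fun z => F (z - y)) x = pd i F (x - y) := by
  rw [pd, pd, fderiv_comp_sub]

lemma pd_comp_rev (i : Fin 3) (F : E3 → ℂ) (x y : E3) :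
    pd i (fun w => F (x - w)) y = -pd i F (x - y) := by
  have h1 : (fun w => F (x - w)) = fun w => (F ∘ ContinuousLinearEquiv.neg ℝ) (w - x) := by
    funext w; simp
  have h2 := pd_comp_sub i (F ∘ ContinuousLinearEquiv.neg ℝ (M := E3)) x y
  rw [h1, h2, pd, ContinuousLinearEquiv.comp_right_fderiv]
  simp [pd]

/-- The function is smooth away from the origin. -/
def SmoothOff (F : E3 → ℂ) : Prop := ∀ d, d ≠ 0 → ContDiffAt ℝ ∞ F d

namespace SmoothOff

variable {F G : E3 → ℂ}

lemma differentiableAt (hF : SmoothOff F) {d : E3} (hd : d ≠ 0) : DifferentiableAt ℝ F d :=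
  (hF d hd).differentiableAt (by simp)

lemma continuousAt (hF : SmoothOff F) {d : E3} (hd : d ≠ 0) : ContinuousAt F d :=
  (hF d hd).continuousAt

lemma pd (hF : SmoothOff F) (i : Fin 3) : SmoothOff (pd i F) := by
  intro d hd
  exact ((hF d hd).fderiv_right (m := ∞) (by simp)).clm_apply contDiffAt_const

lemma add (hF : SmoothOff F) (hG : SmoothOff G) : SmoothOff fun d => F d + G d :=
  fun d hd => (hF d hd).add (hG d hd)

lemma sub (hF : SmoothOff F) (hG : SmoothOff G) : SmoothOff fun d => F d - G d :=
  fun d hd => (hF d hd).sub (hG d hd)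

lemma const_mul (hF : SmoothOff F) (c : ℂ) : SmoothOff fun d => c * F d :=
  fun d hd => contDiffAt_const.mul (hF d hd)

lemma mul_const (hF : SmoothOff F) (c : ℂ) : SmoothOff fun d => F d * c :=
  fun d hd => (hF d hd).mul contDiffAt_const

lemma sum {ι : Type*} {s : Finset ι} {F : ι → E3 → ℂ} (hF : ∀ i ∈ s, SmoothOff (F i)) :
    SmoothOff fun d => ∑ i ∈ s, F i d :=
  fun d hd => ContDiffAt.sum fun i hi => hF i hi d hd

end SmoothOff

lemma pd_congr_off {F G : E3 → ℂ} (h : ∀ d, d ≠ 0 → F d = G d) (i : Fin 3) {d : E3}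
    (hd : d ≠ 0) : pd i F d = pd i G d := by
  have : F =ᶠ[𝓝 d] G := by filter_upwards [isOpen_ne.mem_nhds hd] with z hz using h z hz
  rw [pd, pd, this.fderiv_eq]

section linear

variable {F G : E3 → ℂ} {d : E3} (i : Fin 3)

lemma pd_add (hF : DifferentiableAt ℝ F d) (hG : DifferentiableAt ℝ G d) :
    pd i (fun z => F z + G z) d = pd i F d + pd i G d := by
  simp only [pd]
  rw [show (fun z => F z + G z) = F + G from rfl, fderiv_add hF hG]; rfl

lemma pd_sub (hF : DifferentiableAt ℝ F d) (hG : DifferentiableAt ℝ G d) :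
    pd i (fun z => F z - G z) d = pd i F d - pd i G d := by
  simp only [pd]
  rw [show (fun z => F z - G z) = F - G from rfl, fderiv_sub hF hG]; rfl

lemma pd_const_mul (hF : DifferentiableAt ℝ F d) (c : ℂ) :
    pd i (fun z => c * F z) d = c * pd i F d := by
  simp only [pd]
  rw [fderiv_const_mul hF]; rfl

lemma pd_mul_const (hF : DifferentiableAt ℝ F d) (c : ℂ) :
    pd i (fun z => F z * c) d = pd i F d * c := by
  simp_rw [mul_comm _ c]; exact pd_const_mul i hF c

lemma pd_sum {ι : Type*} (s : Finset ι) {F : ι → E3 → ℂ}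
    (hF : ∀ k ∈ s, DifferentiableAt ℝ (F k) d) :
    pd i (fun z => ∑ k ∈ s, F k z) d = ∑ k ∈ s, pd i (F k) d := by
  simp only [pd]
  rw [fderiv_fun_sum hF]; simp

end linear

lemma pd_comm {F : E3 → ℂ} (hF : SmoothOff F) (i j : Fin 3) {d : E3} (hd : d ≠ 0) :
    pd i (pd j F) d = pd j (pd i F) d := by
  have h2 : DifferentiableAt ℝ (fderiv ℝ F) d :=
    ((hF d hd).fderiv_right (m := ∞) (by simp)).differentiableAt (by simp)
  have e : ∀ a b : Fin 3, pd a (pd b F) d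
      = fderiv ℝ (fderiv ℝ F) d (EuclideanSpace.single a 1) (EuclideanSpace.single b 1) := by
    intro a b
    rw [pd]
    have : pd b F = fun z => fderiv ℝ F z (EuclideanSpace.single b 1) := rfl
    rw [this, fderiv_clm_apply h2 (differentiableAt_const _)]
    simp
  rw [e, e]
  exact (hF d hd).isSymmSndFDerivAt (by
    simpa using WithTop.coe_le_coe.2 (le_top : (2 : ℕ∞) ≤ ⊤)) _ _

lemma laplacian_pd {F G : E3 → ℂ} (hF : SmoothOff F) 
    (h : ∀ d, d ≠ 0 → ∑ l, pd l (pd l F) d = G d) (i : Fin 3) {d : E3} (hd : d ≠ 0) :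
    ∑ l, pd l (pd l (pd i F)) d = pd i G d := by
  rw [← pd_congr_off h i hd, pd_sum i _ fun l _ => ((hF.pd l).pd l).differentiableAt hd]
  refine Finset.sum_congr rfl fun l _ => ?_
  rw [pd_congr_off (fun z hz => pd_comm hF l i hz) l hd, pd_comm (hF.pd l) l i hd]

/-! ### Derivatives of radial functions -/

lemma hasFDerivAt_radial {φ : ℝ → ℂ} {φ' : ℂ} {d : E3} (hφ : HasDerivAt φ φ' (‖d‖ ^ 2)) :
    HasFDerivAt (fun z : E3 => φ (‖z‖ ^ 2))
      ((ContinuousLinearMap.toSpanSingleton ℝ φ').comp (2 • innerSL ℝ d)) d := by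
  have h := hasFDerivAt_norm_sub_sq 0 d
  simp only [sub_zero] at h
  exact hφ.hasFDerivAt.comp d h

lemma pd_radial {φ : ℝ → ℂ} {φ' : ℂ} {d : E3} (i : Fin 3)
    (hφ : HasDerivAt φ φ' (‖d‖ ^ 2)) :
    pd i (fun z => φ (‖z‖ ^ 2)) d = 2 * (d i : ℂ) * φ' := by
  rw [pd, (hasFDerivAt_radial hφ).fderiv]
  simp [EuclideanSpace.inner_single_right, mul_assoc]

/-- The Helmholtz kernel as a function of the difference. -/
def helm (k : ℂ) (d : E3) : ℂ := helmRad 0 k (‖d‖ ^ 2)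

lemma helmholtz_eq (k : ℂ) (x y : E3) : helmholtz k x y = helm k (x - y) := by
  rw [helm, helmRad_sq 0 k (norm_nonneg _), helmholtz]
  simp [helmPoly]

lemma normSq_pos {d : E3} (hd : d ≠ 0) : 0 < ‖d‖ ^ 2 := by positivity

lemma pd_helmRad (n : ℕ) (hn : n < 3) (k : ℂ) (i : Fin 3) {d : E3} (hd : d ≠ 0) :
    pd i (fun z => helmRad n k (‖z‖ ^ 2)) d = (d i : ℂ) * helmRad (n + 1) k (‖d‖ ^ 2) := by
  rw [pd_radial i (hasDerivAt_helmRad n hn k (normSq_pos hd))]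
  ring

lemma smoothOff_helm (k : ℂ) : SmoothOff (helm k) := by
  intro d hd
  have h1 : ContDiffAt ℝ ∞ (fun z : E3 => ((‖z‖ : ℝ) : ℂ)) d :=
    Complex.ofRealCLM.contDiff.contDiffAt.comp d (contDiffAt_norm ℝ hd)
  have hne : (‖d‖ : ℂ) ≠ 0 := by exact_mod_cast norm_ne_zero_iff.2 hd
  have e : helm k = fun z => Complex.exp (Complex.I * k * (‖z‖ : ℂ))
      / (4 * (Real.pi : ℂ) * (‖z‖ : ℂ)) := by
    funext z
    rw [helm, helmRad_sq 0 k (norm_nonneg _)]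
    simp [helmPoly]
  rw [e]
  simp only [div_eq_mul_inv]
  refine ((contDiffAt_const.mul h1).cexp).mul ((contDiffAt_const.mul h1).inv ?_)
  exact mul_ne_zero (mul_ne_zero (by norm_num) (by exact_mod_cast Real.pi_ne_zero)) hne

lemma pd_helm (k : ℂ) (i : Fin 3) {d : E3} (hd : d ≠ 0) :
    pd i (helm k) d = (d i : ℂ) * helmRad 1 k (‖d‖ ^ 2) := pd_helmRad 0 (by norm_num) k i hd

lemma pd_coord (i j : Fin 3) (d : E3) :
    pd j (fun z : E3 => ((z i : ℝ) : ℂ)) d = (1 : Matrix (Fin 3) (Fin 3) ℂ) i j := by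
  have h : HasFDerivAt (fun z : E3 => ((z i : ℝ) : ℂ))
      (Complex.ofRealCLM.comp (EuclideanSpace.proj (𝕜 := ℝ) i)) d :=
    (Complex.ofRealCLM.comp (EuclideanSpace.proj (𝕜 := ℝ) i)).hasFDerivAt
  rw [pd, h.fderiv]
  by_cases hij : i = j <;> simp [Matrix.one_apply, hij]

lemma pd_pd_helm (k : ℂ) (i j : Fin 3) {d : E3} (hd : d ≠ 0) :
    pd j (pd i (helm k)) d = (1 : Matrix (Fin 3) (Fin 3) ℂ) i j * helmRad 1 k (‖d‖ ^ 2)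
      + (d i : ℂ) * (d j : ℂ) * helmRad 2 k (‖d‖ ^ 2) := by
  rw [pd_congr_off (fun z hz => pd_helm k i hz) j hd]
  have h1 : HasFDerivAt (fun z : E3 => ((z i : ℝ) : ℂ))
      (Complex.ofRealCLM.comp (EuclideanSpace.proj (𝕜 := ℝ) i)) d :=
    (Complex.ofRealCLM.comp (EuclideanSpace.proj (𝕜 := ℝ) i)).hasFDerivAt
  have h2 := hasFDerivAt_radial (hasDerivAt_helmRad 1 (by norm_num) k (normSq_pos hd))
  have e1 := pd_coord i j d
  have e2 := pd_helmRad 1 (by norm_num) k j hd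
  rw [pd, h1.fderiv] at e1
  rw [pd, h2.fderiv] at e2
  have h3 : HasFDerivAt (fun z : E3 => ((z i : ℝ) : ℂ) * helmRad 1 k (‖z‖ ^ 2)) _ d := h1.mul h2
  rw [pd, h3.fderiv]
  simp only [add_apply, smul_apply, smul_eq_mul, e1, e2]
  ring

lemma normSq_eq_sum (d : E3) : ((‖d‖ ^ 2 : ℝ) : ℂ) = ∑ l, (d l : ℂ) * (d l : ℂ) := by
  rw [EuclideanSpace.norm_sq_eq]
  push_cast
  exact Finset.sum_congr rfl fun l _ => by rw [Real.norm_eq_abs, ← Complex.ofReal_pow, sq_abs]; push_cast; ring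

/-- The radial form of the Laplacian reduces the Helmholtz equation to `3 p₁ + p₂ = z²` with `z =
ikr`. -/
lemma laplacian_helm (k : ℂ) {d : E3} (hd : d ≠ 0) :
    ∑ l, pd l (pd l (helm k)) d = -k ^ 2 * helm k d := by
  have hne : (‖d‖ : ℂ) ≠ 0 := by exact_mod_cast norm_ne_zero_iff.2 hd
  have hpi : (Real.pi : ℂ) ≠ 0 := by exact_mod_cast Real.pi_ne_zero
  simp_rw [pd_pd_helm k _ _ hd]
  rw [Finset.sum_add_distrib, ← Finset.sum_mul, ← Finset.sum_mul, ← normSq_eq_sum, helm]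
  simp only [helmRad_sq _ k (norm_nonneg _), helmPoly, Matrix.one_apply_eq, Finset.sum_const,
    Finset.card_univ, Fintype.card_fin]
  push_cast
  field_simp
  ring_nf
  simp only [Complex.I_sq]
  ring

namespace Medium

variable {P : Medium} {k1 k2 : ℂ}

/-! ### Relations between the coefficients -/

lemma Admissible.lam_add_pos (hP : P.Admissible) : 0 < P.lam + 2 * P.mu := by
  linarith [hP.mu_pos, hP.lame_pos]

lemma Admissible.lam_add_ne (hP : P.Admissible) : (P.lam : ℂ) + 2 * P.mu ≠ 0 := by
  exact_mod_cast hP.lam_add_pos.ne'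

lemma Admissible.mu_ne (hP : P.Admissible) : (P.mu : ℂ) ≠ 0 := by
  exact_mod_cast hP.mu_pos.ne'

lemma Admissible.omega_ne' (hP : P.Admissible) : (P.omega : ℂ) ≠ 0 := by
  exact_mod_cast hP.omega_ne

/-- If `ρ = β ρ_f`, then `β = ρ/ρ_f` is real. Clearing the denominator in the definition of `β`, the
imaginary part gives `β φ² = 0`, so `β = 0`, and then the real part gives `ω φ² ρ_f κ = 0`, which is
excluded. -/
lemma Admissible.density_ne (hP : P.Admissible) : (P.rho : ℂ) - P.beta * P.rhof ≠ 0 := by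
  have hphi : P.phi ^ 2 ≠ 0 := pow_ne_zero _ hP.phi_ne
  have hden : Complex.I * (P.phi : ℂ) ^ 2
      + (P.omega : ℂ) * P.kappa * ((P.rhoa : ℂ) + P.phi * P.rhof) ≠ 0 := by
    intro h
    apply hphi
    have := congrArg Complex.im h
    simpa [← Complex.ofReal_pow, ← Complex.ofReal_mul, ← Complex.ofReal_add] using this
  have hb : P.beta * (Complex.I * (P.phi : ℂ) ^ 2
      + (P.omega : ℂ) * P.kappa * ((P.rhoa : ℂ) + P.phi * P.rhof))
      = (P.omega * P.phi ^ 2 * P.rhof * P.kappa : ℂ) := by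
    rw [beta, div_mul_cancel₀ _ hden]
  intro h
  have hbeta : P.beta = ((P.rho / P.rhof : ℝ) : ℂ) := by
    have : (P.rhof : ℂ) ≠ 0 := by exact_mod_cast hP.rhof_ne
    push_cast
    rw [eq_div_iff this]
    linear_combination -h
  rw [hbeta] at hb
  have h1 := congrArg Complex.im hb
  have h2 := congrArg Complex.re hb
  simp only [← Complex.ofReal_pow, ← Complex.ofReal_mul, ← Complex.ofReal_add] at h1 h2
  simp only [Complex.mul_im, Complex.add_im, Complex.I_im, Complex.I_re, Complex.ofReal_im,
    Complex.ofReal_re, Complex.mul_re, Complex.add_re] at h1 h2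
  have h3 : P.rho / P.rhof = 0 := by
    have : P.rho / P.rhof * P.phi ^ 2 = 0 := by linear_combination h1
    exact (mul_eq_zero.1 this).resolve_right hphi
  rw [h3] at h2
  have : P.omega * P.phi ^ 2 * P.rhof * P.kappa = 0 := by linear_combination -h2
  simp [hP.omega_ne, hP.phi_ne, hP.rhof_ne, hP.kappa_ne] at this

lemma cpow_half_sq (z : ℂ) : (z ^ (1 / 2 : ℂ)) ^ 2 = z := by
  rw [← Complex.cpow_nat_mul]
  simp

lemma Admissible.mu_mul_ks_sq (hP : P.Admissible) :
    (P.mu : ℂ) * P.ks ^ 2 = P.omega ^ 2 * (P.rho - P.beta * P.rhof) := by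
  rw [ks, mul_pow, cpow_half_sq]
  have := hP.mu_ne
  field_simp

lemma Admissible.lam_add_mul_kp_sq (hP : P.Admissible) :
    ((P.lam : ℂ) + 2 * P.mu) * P.kp ^ 2 = P.omega ^ 2 * (P.rho - P.beta * P.rhof) := by
  rw [kp, mul_pow, cpow_half_sq]
  have := hP.lam_add_ne
  field_simp

/-! ### The fundamental solution as a function of the difference of its arguments -/

variable (P k1 k2)

/-- The scalar potential of `E₁₁`. -/
def potH (d : E3) : ℂ :=
  helm P.ks d - (P.kp ^ 2 - k2 ^ 2) / (k1 ^ 2 - k2 ^ 2) * helm k1 d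
    + (P.kp ^ 2 - k1 ^ 2) / (k1 ^ 2 - k2 ^ 2) * helm k2 d

/-- The scalar potential of `E₁₂` and `E₂₁`. -/
def potG (k1 k2 : ℂ) (d : E3) : ℂ := helm k1 d - helm k2 d

/-- Minus the Laplacian of `potG`. -/
def potL (k1 k2 : ℂ) (d : E3) : ℂ := k1 ^ 2 * helm k1 d - k2 ^ 2 * helm k2 d

/-- The block `E₁₁` as a function of `x - y`. -/
def e11 (i j : Fin 3) (d : E3) : ℂ :=
  (1 / (P.mu : ℂ)) * helm P.ks d * (1 : Matrix (Fin 3) (Fin 3) ℂ) i j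
    + 1 / ((P.rho - P.beta * P.rhof) * (P.omega : ℂ) ^ 2) * pd i (pd j (P.potH k1 k2)) d

/-- The coefficient of `E₁₂`. -/
def c12 : ℂ := Complex.I * P.omega * P.gam / ((P.lam + 2 * P.mu) * (k1 ^ 2 - k2 ^ 2))

/-- The coefficient of the pressure in the adjoint boundary operator. -/
def cAdj : ℂ := P.rhof * (P.omega : ℂ) ^ 2 * P.alpha / P.beta

/-- The entry `E₂₂` as a function of `x - y`. -/
def e22 (d : E3) : ℂ :=
  -(1 / (k1 ^ 2 - k2 ^ 2)) * ((P.kp ^ 2 - k1 ^ 2) * helm k1 d - (P.kp ^ 2 - k2 ^ 2) * helm k2 d)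

/-- The block `E₂₁` as a function of `x - y`. -/
def e21 (i : Fin 3) (d : E3) : ℂ :=
  -((P.alpha - P.beta) / ((P.lam + 2 * P.mu) * (k1 ^ 2 - k2 ^ 2))) * pd i (potG k1 k2) d

lemma smoothOff_potH : SmoothOff (P.potH k1 k2) :=
  ((smoothOff_helm _).sub ((smoothOff_helm _).const_mul _)).add ((smoothOff_helm _).const_mul _)

lemma smoothOff_potG : SmoothOff (potG k1 k2) := (smoothOff_helm _).sub (smoothOff_helm _)

lemma smoothOff_potL : SmoothOff (potL k1 k2) :=
  ((smoothOff_helm _).const_mul _).sub ((smoothOff_helm _).const_mul _)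

lemma smoothOff_e11 (i j : Fin 3) : SmoothOff (P.e11 k1 k2 i j) :=
  (((smoothOff_helm _).const_mul _).mul_const _).add
    ((((P.smoothOff_potH k1 k2).pd j).pd i).const_mul _)

lemma smoothOff_e22 : SmoothOff (P.e22 k1 k2) :=
  (((smoothOff_helm _).const_mul _).sub ((smoothOff_helm _).const_mul _)).const_mul _

lemma E11_eq (x y : E3) (i j : Fin 3) : P.E11 k1 k2 x y i j = P.e11 k1 k2 i j (x - y) := by
  have h (z : E3) := pd_comp_sub j (P.potH k1 k2) y z
  have h' := pd_comp_sub i (pd j (P.potH k1 k2)) y x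
  rw [E11, e11, ← h', helmholtz_eq]
  simp only [← h, helmholtz_eq]
  rfl

lemma E12_eq (x y : E3) (i : Fin 3) :
    P.E12 k1 k2 x y i = P.c12 k1 k2 * pd i (potG k1 k2) (x - y) := by
  rw [E12, ← pd_comp_sub]
  simp only [helmholtz_eq]
  rfl

lemma E21_eq (x y : E3) (i : Fin 3) : P.E21 k1 k2 x y i = P.e21 k1 k2 i (x - y) := by
  rw [E21, e21, ← pd_comp_sub]
  simp only [helmholtz_eq]
  rfl

lemma E22_eq (x y : E3) : P.E22 k1 k2 x y = P.e22 k1 k2 (x - y) := by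
  simp only [E22, helmholtz_eq, e22]

/-! ### The traction -/

/-- This is `T = 2μ M + (λ+2μ) n div - μ n × curl`, the form that isolates the tangential
derivative. -/
lemma traction_eq (n : E3) (u : E3 → Fin 3 → ℂ) (x : E3) (j : Fin 3) :
    P.traction n u x j
      = 2 * P.mu * ∑ l, ((n l : ℂ) * pd j (fun z => u z l) x - n j * pd l (fun z => u z l) x)
        + (P.lam + 2 * P.mu) * n j * ∑ l, pd l (fun z => u z l) x
        - P.mu * ∑ l, (n l : ℂ) * (pd j (fun z => u z l) x - pd l (fun z => u z j) x) := by
  fin_cases j <;>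
  · simp [traction, dirDeriv, divergence, curl, cross_apply, Fin.sum_univ_three]
    ring

lemma traction_comp_rev (n : E3) (V : E3 → Fin 3 → ℂ) (x y : E3) (j : Fin 3) :
    P.traction n (fun w => V (x - w)) y j = -P.traction n V (x - y) j := by
  rw [traction_eq, traction_eq]
  have h (i l : Fin 3) := pd_comp_rev i (fun d => V d l) x y
  simp only [h, Fin.sum_univ_three]
  ring

lemma doubleLayerKernel_inl (Ω : Set E3) (x y : E3) (i j : Fin 3) :
    P.doubleLayerKernel k1 k2 Ω x y (Sum.inl i) (Sum.inl j)
      = -P.traction (outwardNormal Ω y) (fun d l => P.e11 k1 k2 l i d) (x - y) j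
        - P.cAdj * outwardNormal Ω y j * P.e21 k1 k2 i (x - y) := by
  have h := P.traction_comp_rev (outwardNormal Ω y) (fun d l => P.e11 k1 k2 l i d) x y j
  rw [← h]
  simp [doubleLayerKernel, adjBoundaryOp, fundSol, E11_eq, E21_eq, cAdj]

lemma doubleLayerKernel_inr (Ω : Set E3) (x y : E3) (j : Fin 3) :
    P.doubleLayerKernel k1 k2 Ω x y (Sum.inr ()) (Sum.inl j)
      = -P.traction (outwardNormal Ω y) (fun d l => P.c12 k1 k2 * pd l (potG k1 k2) d) (x - y) j
        - P.cAdj * outwardNormal Ω y j * P.e22 k1 k2 (x - y) := by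
  have h := P.traction_comp_rev (outwardNormal Ω y)
    (fun d l => P.c12 k1 k2 * pd l (potG k1 k2) d) x y j
  rw [← h]
  simp [doubleLayerKernel, adjBoundaryOp, fundSol, E12_eq, E22_eq, cAdj]

/-- The kernel of the pressure component, as a function of the normals and of `x - y`. -/
lemma hyperKernel_eq (Ω : Set E3) (x y : E3) (j : Fin 3) :
    P.hyperKernel k1 k2 Ω x y (Sum.inr ()) (Sum.inl j)
      = ∑ i, (outwardNormal Ω x i : ℂ) *
        (-(P.rhof * (P.omega : ℂ) ^ 2) *
          (-P.traction (outwardNormal Ω y) (fun d l => P.e11 k1 k2 l i d) (x - y) j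
            - P.cAdj * outwardNormal Ω y j * P.e21 k1 k2 i (x - y))
        + pd i (fun d =>
          -P.traction (outwardNormal Ω y) (fun d l => P.c12 k1 k2 * pd l (potG k1 k2) d) d j
            - P.cAdj * outwardNormal Ω y j * P.e22 k1 k2 d) (x - y)) := by
  simp only [hyperKernel, boundaryOp, Matrix.of_apply, Sum.elim_inr, doubleLayerKernel_inl,
    doubleLayerKernel_inr, dirDeriv]
  have h (i : Fin 3) := pd_comp_sub i (fun d =>
          -P.traction (outwardNormal Ω y) (fun d l => P.c12 k1 k2 * pd l (potG k1 k2) d) d j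
            - P.cAdj * outwardNormal Ω y j * P.e22 k1 k2 d) y x
  simp only [h, mul_add, Finset.sum_add_distrib, Finset.mul_sum]
  congr 1
  refine Finset.sum_congr rfl fun i _ => ?_
  ring

lemma laplacian_potG {d : E3} (hd : d ≠ 0) :
    ∑ l, pd l (pd l (potG k1 k2)) d = -1 * potL k1 k2 d := by
  have h1 := (smoothOff_helm k1)
  have h2 := (smoothOff_helm k2)
  have e (l : Fin 3) : pd l (pd l (potG k1 k2)) d = pd l (pd l (helm k1)) d - pd l (pd l (helm k2)) d := by
    rw [← pd_sub l ((h1.pd l).differentiableAt hd) ((h2.pd l).differentiableAt hd)]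
    exact pd_congr_off (fun z hz => pd_sub l (h1.differentiableAt hz) (h2.differentiableAt hz)) l hd
  simp only [e, Finset.sum_sub_distrib, laplacian_helm _ hd, potL]
  ring

lemma laplacian_potH {d : E3} (hd : d ≠ 0) :
    ∑ l, pd l (pd l (P.potH k1 k2)) d = -P.ks ^ 2 * helm P.ks d
      + (P.kp ^ 2 - k2 ^ 2) / (k1 ^ 2 - k2 ^ 2) * k1 ^ 2 * helm k1 d
      - (P.kp ^ 2 - k1 ^ 2) / (k1 ^ 2 - k2 ^ 2) * k2 ^ 2 * helm k2 d := by
  have h0 := (smoothOff_helm P.ks)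
  have h1 := (smoothOff_helm k1)
  have h2 := (smoothOff_helm k2)
  set a := (P.kp ^ 2 - k2 ^ 2) / (k1 ^ 2 - k2 ^ 2)
  set b := (P.kp ^ 2 - k1 ^ 2) / (k1 ^ 2 - k2 ^ 2)
  have key : ∀ (F0 F1 F2 : E3 → ℂ), SmoothOff F0 → SmoothOff F1 → SmoothOff F2 → ∀ (l : Fin 3)
      (z : E3), z ≠ 0 → pd l (fun d => F0 d - a * F1 d + b * F2 d) z
        = pd l F0 z - a * pd l F1 z + b * pd l F2 z := by
    intro F0 F1 F2 g0 g1 g2 l z hz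
    rw [pd_add l ((g0.sub (g1.const_mul a)).differentiableAt hz)
      ((g2.const_mul b).differentiableAt hz), pd_sub l (g0.differentiableAt hz)
      ((g1.const_mul a).differentiableAt hz), pd_const_mul l (g1.differentiableAt hz),
      pd_const_mul l (g2.differentiableAt hz)]
  have e (l : Fin 3) : pd l (pd l (P.potH k1 k2)) d = pd l (pd l (helm P.ks)) d
      - a * pd l (pd l (helm k1)) d + b * pd l (pd l (helm k2)) d := by
    rw [← key _ _ _ (h0.pd l) (h1.pd l) (h2.pd l) l d hd]
    exact pd_congr_off (fun z hz => key _ _ _ h0 h1 h2 l z hz) l hd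
  simp only [e, Finset.sum_add_distrib, Finset.sum_sub_distrib, ← Finset.mul_sum,
    laplacian_helm _ hd]
  ring

end Medium

/-! ### Decomposition of the hyper-singular kernel. -/

namespace Medium

variable {P : Medium} {k1 k2 : ℂ}

local notation "δ" => (1 : Matrix (Fin 3) (Fin 3) ℂ)

lemma sum_mul_one_apply (f : Fin 3 → ℂ) (i : Fin 3) : ∑ l, f l * δ l i = f i := by
  simp [Matrix.one_apply]

lemma pd_e11 (m l i : Fin 3) {d : E3} (hd : d ≠ 0) : pd m (P.e11 k1 k2 l i) d
    = (1 / (P.mu : ℂ)) * pd m (helm P.ks) d * δ l i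
      + 1 / ((P.rho - P.beta * P.rhof) * (P.omega : ℂ) ^ 2)
        * pd m (pd l (pd i (P.potH k1 k2))) d := by
  have h1 := smoothOff_helm P.ks
  have h2 := ((P.smoothOff_potH k1 k2).pd i).pd l
  have := pd_add m (((h1.const_mul (1 / (P.mu : ℂ))).mul_const (δ l i)).differentiableAt hd)
    ((h2.const_mul (1 / ((P.rho - P.beta * P.rhof) * (P.omega : ℂ) ^ 2))).differentiableAt hd)
  rw [pd_mul_const m ((h1.const_mul _).differentiableAt hd),
    pd_const_mul m (h1.differentiableAt hd), pd_const_mul m (h2.differentiableAt hd)] at this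
  exact this

lemma e11_comm (l i : Fin 3) {d : E3} (hd : d ≠ 0) :
    P.e11 k1 k2 l i d = P.e11 k1 k2 i l d := by
  rw [e11, e11, pd_comm (P.smoothOff_potH k1 k2) l i hd]
  congr 2
  rw [Matrix.one_apply, Matrix.one_apply]
  simp [eq_comm]

lemma pd_potG (i : Fin 3) {d : E3} (hd : d ≠ 0) :
    pd i (potG k1 k2) d = pd i (helm k1) d - pd i (helm k2) d :=
  pd_sub i ((smoothOff_helm k1).differentiableAt hd) ((smoothOff_helm k2).differentiableAt hd)

lemma pd_linear (i : Fin 3) (A B : ℂ) {d : E3} (hd : d ≠ 0) :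
    pd i (fun z => A * helm k1 z - B * helm k2 z) d = A * pd i (helm k1) d - B * pd i (helm k2) d := by
  have h1 := smoothOff_helm k1
  have h2 := smoothOff_helm k2
  rw [pd_sub i ((h1.const_mul A).differentiableAt hd) ((h2.const_mul B).differentiableAt hd),
    pd_const_mul i (h1.differentiableAt hd), pd_const_mul i (h2.differentiableAt hd)]

lemma pd_potL (i : Fin 3) {d : E3} (hd : d ≠ 0) :
    pd i (potL k1 k2) d = k1 ^ 2 * pd i (helm k1) d - k2 ^ 2 * pd i (helm k2) d :=
  pd_linear i _ _ hd

lemma pd_e22 (i : Fin 3) {d : E3} (hd : d ≠ 0) :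
    pd i (P.e22 k1 k2) d = -(1 / (k1 ^ 2 - k2 ^ 2)) *
      ((P.kp ^ 2 - k1 ^ 2) * pd i (helm k1) d - (P.kp ^ 2 - k2 ^ 2) * pd i (helm k2) d) := by
  have h1 := (smoothOff_helm k1).const_mul (P.kp ^ 2 - k1 ^ 2)
  have h2 := (smoothOff_helm k2).const_mul (P.kp ^ 2 - k2 ^ 2)
  rw [← pd_linear i _ _ hd, ← pd_const_mul i ((h1.sub h2).differentiableAt hd)]
  rfl

lemma laplacian_pd_potH (i : Fin 3) {d : E3} (hd : d ≠ 0) :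
    ∑ l, pd l (pd l (pd i (P.potH k1 k2))) d = -P.ks ^ 2 * pd i (helm P.ks) d
      + (P.kp ^ 2 - k2 ^ 2) / (k1 ^ 2 - k2 ^ 2) * k1 ^ 2 * pd i (helm k1) d
      - (P.kp ^ 2 - k1 ^ 2) / (k1 ^ 2 - k2 ^ 2) * k2 ^ 2 * pd i (helm k2) d := by
  have h0 := smoothOff_helm P.ks
  have h1 := smoothOff_helm k1
  have h2 := smoothOff_helm k2
  rw [laplacian_pd (P.smoothOff_potH k1 k2) (fun z hz => P.laplacian_potH k1 k2 hz) i hd,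
    pd_sub i (((h0.const_mul _).add (h1.const_mul _)).differentiableAt hd)
      ((h2.const_mul _).differentiableAt hd),
    pd_add i ((h0.const_mul _).differentiableAt hd) ((h1.const_mul _).differentiableAt hd),
    pd_const_mul i (h0.differentiableAt hd), pd_const_mul i (h1.differentiableAt hd),
    pd_const_mul i (h2.differentiableAt hd)]

/-- A column of `E₁₁` is a multiple of `γ_{k_s} e_i` plus a gradient. The divergence turns the
gradient into the Laplacian of `∂_i` of the potential, and the curl does not see it, leaving the
contribution of `γ_{k_s} e_i`. -/
lemma traction_e11 (hP : P.Admissible) (n : E3) (i j : Fin 3) {d : E3} (hd : d ≠ 0) :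
    P.traction n (fun d l => P.e11 k1 k2 l i d) d j
      = 2 * P.mu * ∑ l, ((n l : ℂ) * pd j (P.e11 k1 k2 l i) d - n j * pd l (P.e11 k1 k2 l i) d)
        + (P.lam + 2 * P.mu) * n j
          * ((1 / (P.mu : ℂ)) * pd i (helm P.ks) d
            + 1 / ((P.rho - P.beta * P.rhof) * (P.omega : ℂ) ^ 2)
              * ∑ l, pd l (pd l (pd i (P.potH k1 k2))) d)
        - ((n i : ℂ) * pd j (helm P.ks) d - δ j i * ∑ l, (n l : ℂ) * pd l (helm P.ks) d) := by
  have hmu := hP.mu_ne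
  rw [traction_eq]
  have e1 : ∑ l, pd l (P.e11 k1 k2 l i) d = (1 / (P.mu : ℂ)) * pd i (helm P.ks) d
            + 1 / ((P.rho - P.beta * P.rhof) * (P.omega : ℂ) ^ 2)
              * ∑ l, pd l (pd l (pd i (P.potH k1 k2))) d := by
    simp only [pd_e11 _ _ _ hd, Finset.sum_add_distrib, ← Finset.mul_sum]
    rw [sum_mul_one_apply (fun l => 1 / (P.mu : ℂ) * pd l (helm P.ks) d)]
  have e2 : ∑ l, (n l : ℂ) * (pd j (P.e11 k1 k2 l i) d - pd l (P.e11 k1 k2 j i) d)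
      = 1 / (P.mu : ℂ) * ((n i : ℂ) * pd j (helm P.ks) d
        - δ j i * ∑ l, (n l : ℂ) * pd l (helm P.ks) d) := by
    rw [← sum_mul_one_apply (fun l => (n l : ℂ) * pd j (helm P.ks) d) i, Finset.mul_sum,
      ← Finset.sum_sub_distrib, Finset.mul_sum]
    refine Finset.sum_congr rfl fun l _ => ?_
    rw [pd_e11 _ _ _ hd, pd_e11 _ _ _ hd, pd_comm ((P.smoothOff_potH k1 k2).pd i) l j hd]
    ring
  rw [← e1, e2]
  have e3 : (P.mu : ℂ) * (1 / (P.mu : ℂ)) = 1 := by field_simp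
  linear_combination (-((n i : ℂ) * pd j (helm P.ks) d
    - δ j i * ∑ l, (n l : ℂ) * pd l (helm P.ks) d)) * e3

/-- The field is a gradient: its curl vanishes and its divergence is a multiple of `potL`. -/
lemma traction_e12 (n : E3) (j : Fin 3) {d : E3} (hd : d ≠ 0) :
    P.traction n (fun d l => P.c12 k1 k2 * pd l (potG k1 k2) d) d j
      = P.c12 k1 k2 * (2 * P.mu * ∑ l, (n l : ℂ) * pd j (pd l (potG k1 k2)) d
        - P.lam * n j * potL k1 k2 d) := by
  have hg := smoothOff_potG k1 k2
  rw [traction_eq]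
  have e (m l : Fin 3) : pd m (fun z => P.c12 k1 k2 * pd l (potG k1 k2) z) d
      = P.c12 k1 k2 * pd m (pd l (potG k1 k2)) d := pd_const_mul m ((hg.pd l).differentiableAt hd) _
  have e1 := laplacian_potG k1 k2 hd
  have e2 : ∑ l, (n l : ℂ) * (P.c12 k1 k2 * pd j (pd l (potG k1 k2)) d
      - P.c12 k1 k2 * pd l (pd j (potG k1 k2)) d) = 0 :=
    Finset.sum_eq_zero fun l _ => by rw [pd_comm hg l j hd]; ring
  simp only [e, e2]
  simp only [← Finset.mul_sum, Finset.sum_sub_distrib, e1, mul_left_comm _ (P.c12 k1 k2)]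
  ring

lemma pd_doubleLayer_pressure (n : E3) (i j : Fin 3) {d : E3} (hd : d ≠ 0) :
    pd i (fun d => -P.traction n (fun d l => P.c12 k1 k2 * pd l (potG k1 k2) d) d j
        - P.cAdj * n j * P.e22 k1 k2 d) d
      = -(P.c12 k1 k2 * (2 * P.mu * ∑ l, (n l : ℂ) * pd i (pd j (pd l (potG k1 k2))) d
        - P.lam * n j * pd i (potL k1 k2) d)) - P.cAdj * n j * pd i (P.e22 k1 k2) d := by
  have hg := smoothOff_potG k1 k2
  have hgl (l : Fin 3) := ((hg.pd l).pd j).const_mul (n l : ℂ)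
  have hs : SmoothOff fun d => ∑ l, (n l : ℂ) * pd j (pd l (potG k1 k2)) d :=
    SmoothOff.sum fun l _ => hgl l
  have hL := smoothOff_potL k1 k2
  have h22 := P.smoothOff_e22 k1 k2
  have e : ∀ z, z ≠ 0 → -P.traction n (fun d l => P.c12 k1 k2 * pd l (potG k1 k2) d) z j
        - P.cAdj * n j * P.e22 k1 k2 z
      = (-(P.c12 k1 k2 * (2 * P.mu)) * (∑ l, (n l : ℂ) * pd j (pd l (potG k1 k2)) z)
        + P.c12 k1 k2 * P.lam * n j * potL k1 k2 z) - P.cAdj * n j * P.e22 k1 k2 z := by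
    intro z hz
    rw [traction_e12 n j hz]
    ring
  rw [pd_congr_off e i hd, pd_sub i (((hs.const_mul _).add (hL.const_mul _)).differentiableAt hd)
      ((h22.const_mul _).differentiableAt hd),
    pd_add i ((hs.const_mul _).differentiableAt hd) ((hL.const_mul _).differentiableAt hd),
    pd_const_mul i (hs.differentiableAt hd), pd_const_mul i (hL.differentiableAt hd),
    pd_const_mul i (h22.differentiableAt hd), pd_sum i _ fun l _ => (hgl l).differentiableAt hd]
  simp only [pd_const_mul i (((hg.pd _).pd j).differentiableAt hd)]
  ring

variable (P k1 k2)

/-- The kernel whose Günter derivative is the singular part of the hyper-singular kernel. -/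
def kerK (i l : Fin 3) (d : E3) : ℂ :=
  -(P.rhof * (P.omega : ℂ) ^ 2) * (2 * P.mu * P.e11 k1 k2 i l d - helm P.ks d * δ i l)
    + 2 * P.mu * P.c12 k1 k2 * pd i (pd l (potG k1 k2)) d

/-- `kerN31` as a function of the normals at `x` and `y` and of `x - y`. -/
def ker31 (n : E3) (j i : Fin 3) (d : E3) : ℂ :=
  Complex.I * P.omega * P.gam / (k1 ^ 2 - k2 ^ 2) * pd i (potL k1 k2) d * n j
    - P.rhof * (P.omega : ℂ) ^ 2
      * ((pd i (helm P.ks) d - pd i (helm k1) d) * n j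
          - (∑ l, (n l : ℂ) * pd l (helm P.ks) d) * δ j i)
    + (P.rhof * (P.omega : ℂ) ^ 2 * (k2 ^ 2 - P.q) / (k1 ^ 2 - k2 ^ 2)
        - (P.rhof : ℂ) ^ 2 * (P.omega : ℂ) ^ 4 * P.alpha * (P.alpha - P.beta)
          / (P.beta * (P.lam + 2 * P.mu) * (k1 ^ 2 - k2 ^ 2)))
      * (pd i (helm k1) d - pd i (helm k2) d) * n j
    + P.rhof * (P.omega : ℂ) ^ 2 * P.alpha / (P.beta * (k1 ^ 2 - k2 ^ 2))
      * ((P.kp ^ 2 - k1 ^ 2) * pd i (helm k1) d - (P.kp ^ 2 - k2 ^ 2) * pd i (helm k2) d) * n j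

variable {P k1 k2}

lemma smoothOff_kerK (i l : Fin 3) : SmoothOff (P.kerK k1 k2 i l) :=
  ((((P.smoothOff_e11 k1 k2 i l).const_mul _).sub
    ((smoothOff_helm _).mul_const _)).const_mul _).add
    ((((smoothOff_potG k1 k2).pd l).pd i).const_mul _)

lemma pd_kerK (m i l : Fin 3) {d : E3} (hd : d ≠ 0) : pd m (P.kerK k1 k2 i l) d
    = -(P.rhof * (P.omega : ℂ) ^ 2)
        * (2 * P.mu * pd m (P.e11 k1 k2 i l) d - pd m (helm P.ks) d * δ i l)
      + 2 * P.mu * P.c12 k1 k2 * pd m (pd i (pd l (potG k1 k2))) d := by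
  have h1 := P.smoothOff_e11 k1 k2 i l
  have h2 := smoothOff_helm P.ks
  have h3 := ((smoothOff_potG k1 k2).pd l).pd i
  have h4 := (h1.const_mul (2 * P.mu)).sub (h2.mul_const (δ i l))
  have := pd_add m ((h4.const_mul (-(P.rhof * (P.omega : ℂ) ^ 2))).differentiableAt hd)
    ((h3.const_mul (2 * P.mu * P.c12 k1 k2)).differentiableAt hd)
  rw [pd_const_mul m (h4.differentiableAt hd), pd_const_mul m (h3.differentiableAt hd),
    pd_sub m ((h1.const_mul _).differentiableAt hd) ((h2.mul_const _).differentiableAt hd),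
    pd_const_mul m (h1.differentiableAt hd), pd_mul_const m (h2.differentiableAt hd)] at this
  exact this

/-- The decomposition of the hyper-singular kernel, for each component of the normal at `x`. -/
lemma kernel_component_identity (hP : P.Admissible) (hk : P.IsCompressionalPair k1 k2)
    (hne : k1 ^ 2 ≠ k2 ^ 2) (n : E3) (i j : Fin 3) {d : E3} (hd : d ≠ 0) :
    -(P.rhof * (P.omega : ℂ) ^ 2) *
          (-P.traction n (fun d l => P.e11 k1 k2 l i d) d j
            - P.cAdj * n j * P.e21 k1 k2 i d)
        + pd i (fun d =>
          -P.traction n (fun d l => P.c12 k1 k2 * pd l (potG k1 k2) d) d j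
            - P.cAdj * n j * P.e22 k1 k2 d) d
      = P.ker31 k1 k2 n j i d
        - ∑ l, ((n l : ℂ) * pd j (P.kerK k1 k2 i l) d - n j * pd l (P.kerK k1 k2 i l) d) := by
  have hg := smoothOff_potG k1 k2
  have hD := hP.density_ne
  have hw := hP.omega_ne'
  have hl := hP.lam_add_ne
  have hmu := hP.mu_ne
  have hΔ : k1 ^ 2 - k2 ^ 2 ≠ 0 := sub_ne_zero.2 hne
  -- the Günter derivative of `kerK`
  have eK : ∑ l, ((n l : ℂ) * pd j (P.kerK k1 k2 i l) d - n j * pd l (P.kerK k1 k2 i l) d)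
      = -(P.rhof * (P.omega : ℂ) ^ 2) * (2 * P.mu
          * ∑ l, ((n l : ℂ) * pd j (P.e11 k1 k2 l i) d - n j * pd l (P.e11 k1 k2 l i) d)
          - (n i * pd j (helm P.ks) d - n j * pd i (helm P.ks) d))
        + 2 * P.mu * P.c12 k1 k2 * (∑ l, (n l : ℂ) * pd i (pd j (pd l (potG k1 k2))) d
          + n j * pd i (potL k1 k2) d) := by
    -- `potL` is minus the Laplacian of `potG`; written as a sum of third derivatives, this term can
    -- be matched summand by summand with the Günter derivative of `kerK`.
    have h1 : n j * pd i (potL k1 k2) d = -∑ l, (n j : ℂ) * pd l (pd l (pd i (potG k1 k2))) d := by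
      rw [← Finset.mul_sum, laplacian_pd hg (fun z hz => laplacian_potG k1 k2 hz) i hd,
        pd_const_mul i ((smoothOff_potL k1 k2).differentiableAt hd)]
      ring
    have h2 : n i * pd j (helm P.ks) d - n j * pd i (helm P.ks) d
        = ∑ l, (n l * pd j (helm P.ks) d - n j * pd l (helm P.ks) d) * δ l i :=
      (sum_mul_one_apply (fun l => n l * pd j (helm P.ks) d - n j * pd l (helm P.ks) d) i).symm
    rw [h1, h2, ← sub_eq_add_neg, ← Finset.sum_sub_distrib, Finset.mul_sum, Finset.mul_sum,
      ← Finset.sum_sub_distrib, Finset.mul_sum, ← Finset.sum_add_distrib]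
    refine Finset.sum_congr rfl fun l _ => ?_
    have h3 (m : Fin 3) : pd m (P.e11 k1 k2 l i) d = pd m (P.e11 k1 k2 i l) d :=
      pd_congr_off (fun z hz => e11_comm l i hz) m hd
    have h4 : δ l i = δ i l := by simp [Matrix.one_apply, eq_comm]
    have h5 : pd i (pd j (pd l (potG k1 k2))) d = pd j (pd i (pd l (potG k1 k2))) d :=
      pd_comm (hg.pd l) i j hd
    have h6 : pd l (pd i (pd l (potG k1 k2))) d = pd l (pd l (pd i (potG k1 k2))) d :=
      pd_congr_off (fun z hz => pd_comm hg i l hz) l hd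
    rw [h3, h3, h4, h5, ← h6, pd_kerK _ _ _ hd, pd_kerK _ _ _ hd]
    ring
  rw [traction_e11 hP n i j hd, pd_doubleLayer_pressure n i j hd, eK, laplacian_pd_potH i hd,
    pd_e22 i hd, ker31, pd_potL i hd, e21, pd_potG i hd]
  -- The higher-derivative sums now occur on both sides in the same form and cancel. What is left is
  -- an identity linear in the first derivatives of the three Helmholtz kernels, a matter of the
  -- coefficients alone.
  generalize pd i (helm P.ks) d = s
  generalize pd i (helm k1) d = a
  generalize pd i (helm k2) d = b
  generalize pd j (helm P.ks) d = s'
  generalize (∑ l, (n l : ℂ) * pd l (helm P.ks) d) = t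
  generalize (∑ l, (n l : ℂ) * pd i (pd j (pd l (potG k1 k2))) d) = w
  generalize (∑ l, ((n l : ℂ) * pd j (P.e11 k1 k2 l i) d - n j * pd l (P.e11 k1 k2 l i) d)) = v
  -- This relation removes `γ_{k_s}` from the divergence of `E₁₁`. The remaining coefficients of
  -- `γ_{k₁}` and `γ_{k₂}` are matched by the normalisation `f2` and the dispersion relation `k₁²
  -- k₂² = q k_p²`.
  have f1 : (1 / (P.mu : ℂ)) = 1 / ((P.rho - P.beta * P.rhof) * (P.omega : ℂ) ^ 2) * P.ks ^ 2 := by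
    field_simp
    linear_combination -hP.mu_mul_ks_sq
  have f2 : ((P.lam : ℂ) + 2 * P.mu) * (1 / ((P.rho - P.beta * P.rhof) * (P.omega : ℂ) ^ 2))
      * P.kp ^ 2 = 1 := by
    field_simp
    linear_combination hP.lam_add_mul_kp_sq
  have f3 : ((P.lam : ℂ) + 2 * P.mu) * P.c12 k1 k2
      = Complex.I * P.omega * P.gam / (k1 ^ 2 - k2 ^ 2) := by
    rw [c12]; field_simp
  have f4 := hk.prod_sq
  have f5 : (k1 ^ 2 - k2 ^ 2) * (k1 ^ 2 - k2 ^ 2)⁻¹ = 1 := mul_inv_cancel₀ hΔ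
  rw [f1, ← f3]
  generalize 1 / ((P.rho - P.beta * P.rhof) * (P.omega : ℂ) ^ 2) = c at *
  generalize P.c12 k1 k2 = e at *
  rw [cAdj]
  simp only [div_eq_mul_inv, mul_inv]
  linear_combination (-(P.rhof * (P.omega : ℂ) ^ 2) * (P.lam + 2 * P.mu) * c
      * (k1 ^ 2 - k2 ^ 2)⁻¹ * n j * (a - b)) * f4
    + (P.rhof * (P.omega : ℂ) ^ 2 * (k1 ^ 2 - k2 ^ 2)⁻¹ * n j
      * ((k1 ^ 2 - P.q) * a - (k2 ^ 2 - P.q) * b)) * f2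
    + (P.rhof * (P.omega : ℂ) ^ 2 * a * n j) * f5

end Medium

/-! ### Linear combinations of Helmholtz kernels in which the leading singularities cancel -/

/-- The `n`-th radial derivative of a linear combination of Helmholtz kernels. -/
def comb (c κ : Fin 3 → ℂ) (n : ℕ) (t : ℝ) : ℂ := ∑ m, c m * helmRad n (κ m) t

/-- A linear combination of Helmholtz kernels. -/
def pot (c κ : Fin 3 → ℂ) (d : E3) : ℂ := comb c κ 0 (‖d‖ ^ 2)

variable {c κ : Fin 3 → ℂ}

lemma hasDerivAt_comb (n : ℕ) (hn : n < 3) {t : ℝ} (ht : 0 < t) :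
    HasDerivAt (comb c κ n) (comb c κ (n + 1) t / 2) t := by
  have := HasDerivAt.fun_sum (u := Finset.univ) fun m _ =>
    (hasDerivAt_helmRad n hn (κ m) ht).const_mul (c m)
  refine this.congr_deriv ?_
  rw [comb, Finset.sum_div]
  exact Finset.sum_congr rfl fun m _ => by ring

lemma continuousOn_comb (n : ℕ) : ContinuousOn (comb c κ n) (Ioi 0) :=
  continuousOn_finsetSum _ fun m _ => continuousOn_const.mul (continuousOn_helmRad n (κ m))

lemma pot_eq (d : E3) : pot c κ d = ∑ m, c m * helm (κ m) d := rfl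

lemma smoothOff_pot : SmoothOff (pot c κ) :=
  SmoothOff.sum (s := Finset.univ) (F := fun m d => c m * helm (κ m) d) fun _ _ => (smoothOff_helm _).const_mul _

lemma pd_pot (i : Fin 3) {d : E3} (hd : d ≠ 0) :
    pd i (pot c κ) d = (d i : ℂ) * comb c κ 1 (‖d‖ ^ 2) := by
  have h (m : Fin 3) := (smoothOff_helm (κ m))
  rw [show pot c κ = fun d => ∑ m, c m * helm (κ m) d from rfl,
    pd_sum i _ fun m _ => ((h m).const_mul _).differentiableAt hd, comb, Finset.mul_sum]
  refine Finset.sum_congr rfl fun m _ => ?_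
  rw [pd_const_mul i ((h m).differentiableAt hd), pd_helm _ _ hd]
  ring

lemma pd_pd_pot (i j : Fin 3) {d : E3} (hd : d ≠ 0) :
    pd j (pd i (pot c κ)) d = (1 : Matrix (Fin 3) (Fin 3) ℂ) i j * comb c κ 1 (‖d‖ ^ 2)
      + (d i : ℂ) * (d j : ℂ) * comb c κ 2 (‖d‖ ^ 2) := by
  have h (m : Fin 3) := (smoothOff_helm (κ m)).pd i
  have e : ∀ z, z ≠ 0 → pd i (pot c κ) z = ∑ m, c m * pd i (helm (κ m)) z := by
    intro z hz
    rw [pd_pot i hz, comb, Finset.mul_sum]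
    refine Finset.sum_congr rfl fun m _ => ?_
    rw [pd_helm _ _ hz]; ring
  rw [pd_congr_off e j hd, pd_sum j _ fun m _ => ((h m).const_mul _).differentiableAt hd, comb,
    comb, Finset.mul_sum, Finset.mul_sum, ← Finset.sum_add_distrib]
  refine Finset.sum_congr rfl fun m _ => ?_
  rw [pd_const_mul j ((h m).differentiableAt hd), pd_pd_helm _ _ _ hd]
  ring

/-- Since the coefficients sum to zero, the leading term common to all wave numbers may be
subtracted from every summand. -/
lemma exists_comb_bound (hc : ∑ m, c m = 0) (R : ℝ) : ∃ C : ℝ, 0 ≤ C ∧ ∀ r, 0 < r → r ≤ R →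
    ‖comb c κ 1 (r ^ 2)‖ ≤ C * r⁻¹ ∧ ‖comb c κ 2 (r ^ 2)‖ ≤ C * (r ^ 3)⁻¹ := by
  choose C hC hb using fun m => exists_helmRad_bound (κ m) R
  refine ⟨∑ m, ‖c m‖ * C m, Finset.sum_nonneg fun m _ => mul_nonneg (norm_nonneg _) (hC m),
    fun r hr hrR => ⟨?_, ?_⟩⟩
  · have e : comb c κ 1 (r ^ 2)
        = ∑ m, c m * (helmRad 1 (κ m) (r ^ 2) + 1 / (4 * (Real.pi : ℂ) * (r : ℂ) ^ 3)) := by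
      simp only [mul_add, Finset.sum_add_distrib, ← Finset.sum_mul, hc, zero_mul, add_zero]
      rfl
    rw [e, Finset.sum_mul]
    refine (norm_sum_le _ _).trans (Finset.sum_le_sum fun m _ => ?_)
    rw [norm_mul, mul_assoc ‖c m‖]
    exact mul_le_mul_of_nonneg_left (hb m r hr hrR).2.2.1 (norm_nonneg _)
  · have e : comb c κ 2 (r ^ 2)
        = ∑ m, c m * (helmRad 2 (κ m) (r ^ 2) - 3 / (4 * (Real.pi : ℂ) * (r : ℂ) ^ 5)) := by
      simp only [mul_sub, Finset.sum_sub_distrib, ← Finset.sum_mul, hc, zero_mul, sub_zero]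
      rfl
    rw [e, Finset.sum_mul]
    refine (norm_sum_le _ _).trans (Finset.sum_le_sum fun m _ => ?_)
    rw [norm_mul, mul_assoc ‖c m‖]
    exact mul_le_mul_of_nonneg_left (hb m r hr hrR).2.2.2 (norm_nonneg _)

lemma exists_pd_pot_bound (hc : ∑ m, c m = 0) (R : ℝ) : ∃ C : ℝ, 0 ≤ C ∧ ∀ d : E3, d ≠ 0 →
    ‖d‖ ≤ R → ∀ i j, ‖pd i (pot c κ) d‖ ≤ C ∧ ‖pd j (pd i (pot c κ)) d‖ ≤ C * ‖d‖⁻¹ := by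
  obtain ⟨C, hC, hb⟩ := exists_comb_bound (κ := κ) hc R
  refine ⟨C + C, by positivity, fun d hd hR i j => ?_⟩
  have hr : 0 < ‖d‖ := norm_pos_iff.2 hd
  obtain ⟨b1, b2⟩ := hb _ hr hR
  have hn (i : Fin 3) : ‖(d i : ℂ)‖ ≤ ‖d‖ := norm_coord_le d i
  constructor
  · rw [pd_pot i hd, norm_mul]
    calc _ ≤ ‖d‖ * (C * ‖d‖⁻¹) := mul_le_mul (hn i) b1 (norm_nonneg _) hr.le
      _ = C := by field_simp
      _ ≤ _ := by linarith
  · rw [pd_pd_pot i j hd, add_mul]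
    refine (norm_add_le _ _).trans (add_le_add ?_ ?_)
    · rw [norm_mul]
      calc _ ≤ 1 * (C * ‖d‖⁻¹) := by
            refine mul_le_mul ?_ b1 (norm_nonneg _) zero_le_one
            rw [Matrix.one_apply]; split_ifs <;> simp
        _ = _ := one_mul _
    · rw [norm_mul, norm_mul]
      calc _ ≤ ‖d‖ * ‖d‖ * (C * (‖d‖ ^ 3)⁻¹) := by
            gcongr
            · exact hn i
            · exact hn j
        _ = _ := by field_simp

/-! ### Kernels with a singularity of order one -/

/-- The kernel is continuous off the diagonal of `Γ` and bounded there by `C / |x - y|`. -/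
def OrderOne (Γ : Set E3) (K : E3 → E3 → ℂ) : Prop :=
  ContinuousOn (fun z : E3 × E3 => K z.1 z.2) {z | z.1 ∈ Γ ∧ z.2 ∈ Γ ∧ z.1 ≠ z.2} ∧
    ∃ C : ℝ, 0 ≤ C ∧ ∀ x ∈ Γ, ∀ y ∈ Γ, x ≠ y → ‖K x y‖ ≤ C * ‖x - y‖⁻¹

namespace OrderOne

variable {Γ : Set E3} {K L : E3 → E3 → ℂ}

lemma isWeaklySingular (h : OrderOne Γ K) : IsWeaklySingular Γ K := by
  obtain ⟨hc, C, -, hb⟩ := h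
  refine ⟨hc, C, 1, one_pos, fun x hx y hy hxy => (hb x hx y hy hxy).trans_eq ?_⟩
  rw [dist_eq_norm, show (1 : ℝ) - 2 = -1 by norm_num, Real.rpow_neg_one]

lemma congr (h : OrderOne Γ K) (hL : ∀ x ∈ Γ, ∀ y ∈ Γ, x ≠ y → L x y = K x y) :
    OrderOne Γ L := by
  obtain ⟨hc, C, hC, hb⟩ := h
  refine ⟨hc.congr fun z hz => hL _ hz.1 _ hz.2.1 hz.2.2, C, hC, fun x hx y hy hxy => ?_⟩
  rw [hL x hx y hy hxy]; exact hb x hx y hy hxy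

lemma add (h : OrderOne Γ K) (h' : OrderOne Γ L) : OrderOne Γ fun x y => K x y + L x y := by
  obtain ⟨hc, C, hC, hb⟩ := h
  obtain ⟨hc', C', hC', hb'⟩ := h'
  refine ⟨hc.add hc', C + C', by positivity, fun x hx y hy hxy => ?_⟩
  rw [add_mul]
  exact (norm_add_le _ _).trans (add_le_add (hb x hx y hy hxy) (hb' x hx y hy hxy))

lemma mul_bounded (h : OrderOne Γ K) {f : E3 → E3 → ℂ} {B : ℝ}
    (hf : ContinuousOn (fun z : E3 × E3 => f z.1 z.2) {z | z.1 ∈ Γ ∧ z.2 ∈ Γ ∧ z.1 ≠ z.2})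
    (hB : ∀ x ∈ Γ, ∀ y ∈ Γ, ‖f x y‖ ≤ B) : OrderOne Γ fun x y => f x y * K x y := by
  obtain ⟨hc, C, hC, hb⟩ := h
  refine ⟨hf.mul hc, |B| * C, by positivity, fun x hx y hy hxy => ?_⟩
  rw [norm_mul, mul_assoc]
  exact mul_le_mul ((hB x hx y hy).trans (le_abs_self B)) (hb x hx y hy hxy) (norm_nonneg _)
    (abs_nonneg _)

lemma const_mul (h : OrderOne Γ K) (a : ℂ) : OrderOne Γ fun x y => a * K x y :=
  h.mul_bounded continuousOn_const fun _ _ _ _ => le_rfl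

lemma sub (h : OrderOne Γ K) (h' : OrderOne Γ L) : OrderOne Γ fun x y => K x y - L x y :=
  (h.add (h'.const_mul (-1))).congr fun x _ y _ _ => by ring

lemma sum {ι : Type*} (s : Finset ι) {K : ι → E3 → E3 → ℂ} (h : ∀ i, OrderOne Γ (K i)) :
    OrderOne Γ fun x y => ∑ i ∈ s, K i x y := by
  classical
  induction s using Finset.induction_on with
  | empty =>
    simp only [Finset.sum_empty]
    exact ⟨continuousOn_const, 0, le_rfl, fun x _ y _ _ => by simp⟩
  | insert a s ha ih =>
    simp only [Finset.sum_insert ha]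
    exact (h a).add ih

end OrderOne

lemma SmoothOff.measurable {F : E3 → ℂ} (hF : SmoothOff F) : Measurable F :=
  measurable_of_continuousOn_compl_singleton 0
    fun _ hd => (hF.continuousAt hd).continuousWithinAt

lemma SmoothOff.continuousOn_sub {F : E3 → ℂ} (hF : SmoothOff F) (Γ : Set E3) :
    ContinuousOn (fun z : E3 × E3 => F (z.1 - z.2)) {z | z.1 ∈ Γ ∧ z.2 ∈ Γ ∧ z.1 ≠ z.2} := by
  intro z hz
  have h : ContinuousAt (fun z : E3 × E3 => z.1 - z.2) z := by fun_prop
  exact (ContinuousAt.comp (f := fun z : E3 × E3 => z.1 - z.2)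
    (hF.continuousAt (sub_ne_zero.2 hz.2.2)) h).continuousWithinAt

section surface

variable {Ω : Set E3}

lemma exists_norm_sub_le (hΩ : IsSmoothBoundedDomain Ω) :
    ∃ R : ℝ, 0 < R ∧ ∀ x ∈ frontier Ω, ∀ y ∈ frontier Ω, ‖x - y‖ ≤ R := by
  obtain ⟨R, hR⟩ := (isCompact_frontier hΩ).isBounded.exists_norm_le
  refine ⟨|R| + |R| + 1, by positivity, fun x hx y hy => ?_⟩
  have h1 := (hR x hx).trans (le_abs_self R)
  have h2 := (hR y hy).trans (le_abs_self R)
  linarith [norm_sub_le x y]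

lemma SmoothOff.orderOne (hΩ : IsSmoothBoundedDomain Ω) {F : E3 → ℂ} (hF : SmoothOff F)
    (hb : ∀ R : ℝ, ∃ C : ℝ, 0 ≤ C ∧ ∀ d : E3, d ≠ 0 → ‖d‖ ≤ R → ‖F d‖ ≤ C * ‖d‖⁻¹) :
    OrderOne (frontier Ω) fun x y => F (x - y) := by
  obtain ⟨R, -, hR⟩ := exists_norm_sub_le hΩ
  obtain ⟨C, hC, h⟩ := hb R
  exact ⟨hF.continuousOn_sub _, C, hC, fun x hx y hy hxy => h _ (sub_ne_zero.2 hxy) (hR x hx y hy)⟩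

lemma orderOne_helm (hΩ : IsSmoothBoundedDomain Ω) (k : ℂ) :
    OrderOne (frontier Ω) fun x y => helm k (x - y) := by
  refine (smoothOff_helm k).orderOne hΩ fun R => ?_
  obtain ⟨C, hC, h⟩ := exists_helmRad_bound k R
  exact ⟨C, hC, fun d hd hR => (h _ (norm_pos_iff.2 hd) hR).1⟩

lemma orderOne_pd_pd_pot (hΩ : IsSmoothBoundedDomain Ω) (hc : ∑ m, c m = 0) (i j : Fin 3) :
    OrderOne (frontier Ω) fun x y => pd j (pd i (pot c κ)) (x - y) := by
  refine ((smoothOff_pot.pd i).pd j).orderOne hΩ fun R => ?_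
  obtain ⟨C, hC, h⟩ := exists_pd_pot_bound (κ := κ) hc R
  exact ⟨C, hC, fun d hd hR => (h d hd hR i j).2⟩

lemma orderOne_pd_pot (hΩ : IsSmoothBoundedDomain Ω) (hc : ∑ m, c m = 0) (i : Fin 3) :
    OrderOne (frontier Ω) fun x y => pd i (pot c κ) (x - y) := by
  refine (smoothOff_pot.pd i).orderOne hΩ fun R => ?_
  obtain ⟨C, hC, h⟩ := exists_pd_pot_bound (κ := κ) hc R
  refine ⟨C * |R|, by positivity, fun d hd hR => ((h d hd hR i 0).1).trans ?_⟩
  have hr : 0 < ‖d‖ := norm_pos_iff.2 hd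
  rw [mul_assoc]
  refine le_mul_of_one_le_right hC ?_
  rw [← div_eq_mul_inv, one_le_div hr]
  exact hR.trans (le_abs_self R)

/-- The derivative of the Helmholtz kernel in the direction `n`. -/
def dirHelm (n : E3) (k : ℂ) (d : E3) : ℂ := ∑ l, (n l : ℂ) * pd l (helm k) d

lemma dirHelm_eq (n : E3) (k : ℂ) {d : E3} (hd : d ≠ 0) :
    dirHelm n k d = ((inner ℝ n d : ℝ) : ℂ) * helmRad 1 k (‖d‖ ^ 2) := by
  rw [dirHelm, inner_E3, Fin.sum_univ_three]
  simp only [pd_helm k _ hd]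
  push_cast
  ring

/-- The gradient has size `r⁻²`, but it is radial, so its normal component carries the factor `n·d /
r = O(r)`. -/
lemma norm_dirHelm_le (k : ℂ) (R B : ℝ) (hB : 0 ≤ B) : ∃ C : ℝ, 0 ≤ C ∧ ∀ n d : E3, d ≠ 0 →
    ‖d‖ ≤ R → |inner ℝ n d| ≤ B * ‖d‖ ^ 2 → ‖dirHelm n k d‖ ≤ C * ‖d‖⁻¹ := by
  obtain ⟨C, hC, h⟩ := exists_helmRad_bound k R
  refine ⟨B * C, by positivity, fun n d hd hR hn => ?_⟩
  have hr : 0 < ‖d‖ := norm_pos_iff.2 hd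
  rw [dirHelm_eq n k hd, norm_mul, Complex.norm_real, Real.norm_eq_abs]
  calc _ ≤ B * ‖d‖ ^ 2 * (C * (‖d‖ ^ 3)⁻¹) :=
        mul_le_mul hn (h _ hr hR).2.1 (norm_nonneg _) (by positivity)
    _ = _ := by field_simp

lemma continuousOn_normal_fst (hΩ : IsSmoothBoundedDomain Ω) (i : Fin 3) :
    ContinuousOn (fun z : E3 × E3 => (outwardNormal Ω z.1 i : ℂ))
      {z | z.1 ∈ frontier Ω ∧ z.2 ∈ frontier Ω ∧ z.1 ≠ z.2} :=
  (continuousOn_normal_coord hΩ i).comp continuous_fst.continuousOn fun _ hz => hz.1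

lemma continuousOn_normal_snd (hΩ : IsSmoothBoundedDomain Ω) (i : Fin 3) :
    ContinuousOn (fun z : E3 × E3 => (outwardNormal Ω z.2 i : ℂ))
      {z | z.1 ∈ frontier Ω ∧ z.2 ∈ frontier Ω ∧ z.1 ≠ z.2} :=
  (continuousOn_normal_coord hΩ i).comp continuous_snd.continuousOn fun _ hz => hz.2.1

lemma norm_normal_coord_le (hΩ : IsSmoothBoundedDomain Ω) {x : E3} (hx : x ∈ frontier Ω)
    (i : Fin 3) : ‖(outwardNormal Ω x i : ℂ)‖ ≤ 1 := by
  rw [← norm_outwardNormal hΩ hx]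
  exact norm_coord_le _ i

lemma OrderOne.mul_normal_fst (hΩ : IsSmoothBoundedDomain Ω) {K : E3 → E3 → ℂ}
    (h : OrderOne (frontier Ω) K) (i : Fin 3) :
    OrderOne (frontier Ω) fun x y => (outwardNormal Ω x i : ℂ) * K x y :=
  h.mul_bounded (f := fun x _ => (outwardNormal Ω x i : ℂ)) (continuousOn_normal_fst hΩ i)
    fun _ hx _ _ => norm_normal_coord_le hΩ hx i

lemma OrderOne.mul_normal_snd (hΩ : IsSmoothBoundedDomain Ω) {K : E3 → E3 → ℂ}
    (h : OrderOne (frontier Ω) K) (i : Fin 3) :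
    OrderOne (frontier Ω) fun x y => (outwardNormal Ω y i : ℂ) * K x y :=
  h.mul_bounded (f := fun _ y => (outwardNormal Ω y i : ℂ)) (continuousOn_normal_snd hΩ i)
    fun _ _ _ hy => norm_normal_coord_le hΩ hy i

lemma orderOne_dirHelm_fst (hΩ : IsSmoothBoundedDomain Ω) (k : ℂ) :
    OrderOne (frontier Ω) fun x y => dirHelm (outwardNormal Ω x) k (x - y) := by
  obtain ⟨R, -, hR⟩ := exists_norm_sub_le hΩ
  obtain ⟨B, hB, hn⟩ := exists_inner_normal_le hΩ
  obtain ⟨C, hC, h⟩ := norm_dirHelm_le k R B hB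
  refine ⟨?_, C, hC, fun x hx y hy hxy =>
    h _ _ (sub_ne_zero.2 hxy) (hR x hx y hy) (hn x hx y hy)⟩
  exact continuousOn_finsetSum _ fun l _ => (continuousOn_normal_fst hΩ l).mul
    (((smoothOff_helm k).pd l).continuousOn_sub _)

lemma orderOne_dirHelm_snd (hΩ : IsSmoothBoundedDomain Ω) (k : ℂ) :
    OrderOne (frontier Ω) fun x y => dirHelm (outwardNormal Ω y) k (x - y) := by
  obtain ⟨R, -, hR⟩ := exists_norm_sub_le hΩ
  obtain ⟨B, hB, hn⟩ := exists_inner_normal_le hΩ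
  obtain ⟨C, hC, h⟩ := norm_dirHelm_le k R B hB
  refine ⟨?_, C, hC, fun x hx y hy hxy =>
    h _ _ (sub_ne_zero.2 hxy) (hR x hx y hy) ?_⟩
  · exact continuousOn_finsetSum _ fun l _ => (continuousOn_normal_snd hΩ l).mul
      (((smoothOff_helm k).pd l).continuousOn_sub _)
  · rw [← neg_sub y x, inner_neg_right, abs_neg, norm_neg]
    exact hn y hy x hx

end surface

/-! ### Weak singularity of the kernels -/

namespace Medium

variable {P : Medium} {k1 k2 : ℂ} {Ω : Set E3}

/-- The zero coefficient pads the difference to the three-term format; the wave number beside it is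
irrelevant. -/
lemma potG_eq_pot : potG k1 k2 = pot ![0, 1, -1] ![0, k1, k2] := by
  funext d
  simp [potG, pot_eq, Fin.sum_univ_three, sub_eq_add_neg]

lemma potH_eq_pot : P.potH k1 k2 = pot
    ![1, -((P.kp ^ 2 - k2 ^ 2) / (k1 ^ 2 - k2 ^ 2)), (P.kp ^ 2 - k1 ^ 2) / (k1 ^ 2 - k2 ^ 2)]
    ![P.ks, k1, k2] := by
  funext d
  simp [potH, pot_eq, Fin.sum_univ_three, sub_eq_add_neg]

/-- This cancellation lowers the singularity of the Hessian in `E₁₁` from order three to order one.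
-/
lemma sum_coeff_potH (hne : k1 ^ 2 ≠ k2 ^ 2) : ∑ m, (![1, -((P.kp ^ 2 - k2 ^ 2) / (k1 ^ 2 - k2 ^ 2)),
    (P.kp ^ 2 - k1 ^ 2) / (k1 ^ 2 - k2 ^ 2)] : Fin 3 → ℂ) m = 0 := by
  have hΔ : k1 ^ 2 - k2 ^ 2 ≠ 0 := sub_ne_zero.2 hne
  simp only [Fin.sum_univ_three, Matrix.cons_val]
  field_simp
  ring

lemma sum_coeff_potG : ∑ m, (![0, 1, -1] : Fin 3 → ℂ) m = 0 := by
  simp [Fin.sum_univ_three]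

lemma orderOne_pd_potG (hΩ : IsSmoothBoundedDomain Ω) (i : Fin 3) :
    OrderOne (frontier Ω) fun x y => pd i (potG k1 k2) (x - y) := by
  rw [potG_eq_pot]; exact orderOne_pd_pot hΩ sum_coeff_potG i

lemma orderOne_pd_pd_potG (hΩ : IsSmoothBoundedDomain Ω) (i j : Fin 3) :
    OrderOne (frontier Ω) fun x y => pd j (pd i (potG k1 k2)) (x - y) := by
  rw [potG_eq_pot]; exact orderOne_pd_pd_pot hΩ sum_coeff_potG i j

lemma orderOne_pd_pd_potH (hΩ : IsSmoothBoundedDomain Ω) (hne : k1 ^ 2 ≠ k2 ^ 2) (i j : Fin 3) :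
    OrderOne (frontier Ω) fun x y => pd j (pd i (P.potH k1 k2)) (x - y) := by
  rw [potH_eq_pot]; exact orderOne_pd_pd_pot hΩ (sum_coeff_potH hne) i j

lemma orderOne_e11 (hΩ : IsSmoothBoundedDomain Ω) (hne : k1 ^ 2 ≠ k2 ^ 2) (i j : Fin 3) :
    OrderOne (frontier Ω) fun x y => P.e11 k1 k2 i j (x - y) :=
  ((((orderOne_helm hΩ P.ks).const_mul (1 / (P.mu : ℂ) * (1 : Matrix (Fin 3) (Fin 3) ℂ) i j))).add
    ((orderOne_pd_pd_potH hΩ hne j i).const_mul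
      (1 / ((P.rho - P.beta * P.rhof) * (P.omega : ℂ) ^ 2)))).congr
    fun x _ y _ _ => by rw [e11]; ring

lemma orderOne_kerK (hΩ : IsSmoothBoundedDomain Ω) (hne : k1 ^ 2 ≠ k2 ^ 2) (i l : Fin 3) :
    OrderOne (frontier Ω) fun x y => P.kerK k1 k2 i l (x - y) :=
  ((((orderOne_e11 hΩ hne i l).const_mul (2 * P.mu)).sub ((orderOne_helm hΩ P.ks).const_mul
    ((1 : Matrix (Fin 3) (Fin 3) ℂ) i l))).const_mul (-(P.rhof * (P.omega : ℂ) ^ 2))).add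
    ((orderOne_pd_pd_potG hΩ l i).const_mul (2 * P.mu * P.c12 k1 k2)) |>.congr
    fun x _ y _ _ => by rw [kerK]; ring

lemma orderOne_potL (hΩ : IsSmoothBoundedDomain Ω) :
    OrderOne (frontier Ω) fun x y => potL k1 k2 (x - y) :=
  ((orderOne_helm hΩ k1).const_mul _).sub ((orderOne_helm hΩ k2).const_mul _)

lemma kerN33_eq (x y : E3) (j : Fin 3) : P.kerN33 k1 k2 x y j
    = 2 * P.mu * P.c12 k1 k2 * pd j (potG k1 k2) (x - y) := by
  rw [← pd_comp_sub, kerN33, c12]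
  simp only [helmholtz_eq, potG]
  ring

lemma kerN32_eq (x y : E3) (j : Fin 3) : P.kerN32 k1 k2 Ω x y j
    = -(P.rhof * (P.omega : ℂ) ^ 2) * (∑ i, (outwardNormal Ω x i : ℂ)
          * (2 * P.mu * P.e11 k1 k2 i j (x - y)
              - (1 : Matrix (Fin 3) (Fin 3) ℂ) i j * helm P.ks (x - y)))
      - 2 * P.mu * P.c12 k1 k2 * (outwardNormal Ω x j * potL k1 k2 (x - y)) := by
  rw [kerN32, c12]
  simp only [helmholtz_eq, potL, E11_eq, mul_comm (helm P.ks (x - y))]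
  ring

lemma sum_normal_ker31 (m n : E3) (j : Fin 3) (d : E3) (hd : d ≠ 0) :
    ∑ i, (m i : ℂ) * P.ker31 k1 k2 n j i d
      = Complex.I * P.omega * P.gam / (k1 ^ 2 - k2 ^ 2)
          * (n j * (k1 ^ 2 * dirHelm m k1 d - k2 ^ 2 * dirHelm m k2 d))
        - P.rhof * (P.omega : ℂ) ^ 2
          * (n j * (dirHelm m P.ks d - dirHelm m k1 d) - m j * dirHelm n P.ks d)
        + (P.rhof * (P.omega : ℂ) ^ 2 * (k2 ^ 2 - P.q) / (k1 ^ 2 - k2 ^ 2)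
          - (P.rhof : ℂ) ^ 2 * (P.omega : ℂ) ^ 4 * P.alpha * (P.alpha - P.beta)
            / (P.beta * (P.lam + 2 * P.mu) * (k1 ^ 2 - k2 ^ 2)))
          * (n j * (dirHelm m k1 d - dirHelm m k2 d))
        + P.rhof * (P.omega : ℂ) ^ 2 * P.alpha / (P.beta * (k1 ^ 2 - k2 ^ 2))
          * (n j * ((P.kp ^ 2 - k1 ^ 2) * dirHelm m k1 d - (P.kp ^ 2 - k2 ^ 2) * dirHelm m k2 d)) := by
  have h : (m j : ℂ) = ∑ i, (m i : ℂ) * (1 : Matrix (Fin 3) (Fin 3) ℂ) j i := by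
    simp [Matrix.one_apply]
  rw [h]
  simp only [ker31, pd_potL _ hd, dirHelm, Fin.sum_univ_three]
  ring

lemma kerN31_eq {x y : E3} (hxy : x ≠ y) (j : Fin 3) : P.kerN31 k1 k2 Ω x y j
    = ∑ i, (outwardNormal Ω x i : ℂ) * P.ker31 k1 k2 (outwardNormal Ω y) j i (x - y) := by
  have hd : x - y ≠ 0 := sub_ne_zero.2 hxy
  have key (A B a b : ℂ) (n : E3) : dirDeriv n (fun z => A * helmholtz a z y - B * helmholtz b z y) x
      = A * dirHelm n a (x - y) - B * dirHelm n b (x - y) := by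
    simp only [dirDeriv, dirHelm, helmholtz_eq, Finset.mul_sum, ← Finset.sum_sub_distrib]
    refine Finset.sum_congr rfl fun l _ => ?_
    rw [pd_comp_sub l (fun d => A * helm a d - B * helm b d) y x, pd_linear l A B hd]
    ring
  have key' (a b : ℂ) (n : E3) : dirDeriv n (fun z => helmholtz a z y - helmholtz b z y) x
      = dirHelm n a (x - y) - dirHelm n b (x - y) := by
    simpa using key 1 1 a b n
  have key'' (a : ℂ) (n : E3) : dirDeriv n (fun w => helmholtz a x w) y
      = - dirHelm n a (x - y) := by
    simp only [dirDeriv, dirHelm, helmholtz_eq, ← Finset.sum_neg_distrib]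
    refine Finset.sum_congr rfl fun l _ => ?_
    rw [pd_comp_rev l (helm a) x y, mul_neg]
  rw [sum_normal_ker31 _ _ _ _ hd, kerN31, key, key', key', key, key'']
  ring

lemma orderOne_kerN31 (hΩ : IsSmoothBoundedDomain Ω) (j : Fin 3) :
    OrderOne (frontier Ω) fun x y => P.kerN31 k1 k2 Ω x y j := by
  have h (k : ℂ) := orderOne_dirHelm_fst hΩ k
  have h' := orderOne_dirHelm_snd hΩ P.ks
  have h1 := ((((h k1).const_mul (k1 ^ 2)).sub ((h k2).const_mul (k2 ^ 2))).mul_normal_snd hΩ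
    j).const_mul (Complex.I * P.omega * P.gam / (k1 ^ 2 - k2 ^ 2))
  have h2 := ((((h P.ks).sub (h k1)).mul_normal_snd hΩ j).sub (h'.mul_normal_fst hΩ j)).const_mul
    (P.rhof * (P.omega : ℂ) ^ 2)
  have h3 := (((h k1).sub (h k2)).mul_normal_snd hΩ j).const_mul
    (P.rhof * (P.omega : ℂ) ^ 2 * (k2 ^ 2 - P.q) / (k1 ^ 2 - k2 ^ 2)
      - (P.rhof : ℂ) ^ 2 * (P.omega : ℂ) ^ 4 * P.alpha * (P.alpha - P.beta)
        / (P.beta * (P.lam + 2 * P.mu) * (k1 ^ 2 - k2 ^ 2)))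
  have h4 := ((((h k1).const_mul (P.kp ^ 2 - k1 ^ 2)).sub
    ((h k2).const_mul (P.kp ^ 2 - k2 ^ 2))).mul_normal_snd hΩ j).const_mul
    (P.rhof * (P.omega : ℂ) ^ 2 * P.alpha / (P.beta * (k1 ^ 2 - k2 ^ 2)))
  refine (((h1.sub h2).add h3).add h4).congr fun x _ y _ hxy => ?_
  rw [kerN31_eq hxy, sum_normal_ker31 _ _ _ _ (sub_ne_zero.2 hxy)]

lemma orderOne_kerN32 (hΩ : IsSmoothBoundedDomain Ω) (hne : k1 ^ 2 ≠ k2 ^ 2) (j : Fin 3) :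
    OrderOne (frontier Ω) fun x y => P.kerN32 k1 k2 Ω x y j := by
  have h1 := (OrderOne.sum Finset.univ fun i => (((orderOne_e11 (P := P) hΩ hne i j).const_mul
    (2 * P.mu)).sub ((orderOne_helm hΩ P.ks).const_mul
      ((1 : Matrix (Fin 3) (Fin 3) ℂ) i j))).mul_normal_fst hΩ i).const_mul
    (-(P.rhof * (P.omega : ℂ) ^ 2))
  have h2 := ((orderOne_potL (k1 := k1) (k2 := k2) hΩ).mul_normal_fst hΩ j).const_mul
    (2 * P.mu * P.c12 k1 k2)
  exact (h1.sub h2).congr fun x _ y _ _ => kerN32_eq x y j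

lemma orderOne_kerN33 (hΩ : IsSmoothBoundedDomain Ω) (j : Fin 3) :
    OrderOne (frontier Ω) fun x y => P.kerN33 k1 k2 x y j :=
  ((orderOne_pd_potG hΩ j).const_mul _).congr fun x _ y _ _ => kerN33_eq x y j

end Medium

/-! ### Integrability -/

section surface

variable {Ω : Set E3}

lemma surfaceMeasure_singleton (hΩ : IsSmoothBoundedDomain Ω) {x : E3} (hx : x ∈ frontier Ω) :
    surfaceMeasure Ω {x} = 0 := by
  have := isFiniteMeasure_surfaceMeasure hΩ
  obtain ⟨C, hC, h⟩ := exists_measureReal_ball_le hΩ hx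
  have hle : ∀ ε > 0, (surfaceMeasure Ω).real {x} ≤ C * ε ^ 2 := fun ε hε =>
    (measureReal_mono (singleton_subset_iff.2 (mem_ball_self hε))).trans (h ε hε)
  have hlim : Tendsto (fun ε : ℝ => C * ε ^ 2) (𝓝[>] 0) (𝓝 0) := by
    have : Tendsto (fun ε : ℝ => C * ε ^ 2) (𝓝 0) (𝓝 (C * 0 ^ 2)) :=
      (by fun_prop : Continuous fun ε : ℝ => C * ε ^ 2).tendsto 0
    simpa using this.mono_left nhdsWithin_le_nhds
  have h0 : (surfaceMeasure Ω).real {x} ≤ 0 :=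
    ge_of_tendsto hlim (by filter_upwards [self_mem_nhdsWithin] with ε hε using hle ε hε)
  exact (measureReal_eq_zero_iff).1 (le_antisymm h0 measureReal_nonneg)

lemma ae_ne_surfaceMeasure (hΩ : IsSmoothBoundedDomain Ω) {x : E3} (hx : x ∈ frontier Ω) :
    ∀ᵐ y ∂surfaceMeasure Ω, x ≠ y := by
  have := measure_eq_zero_iff_ae_notMem.1 (surfaceMeasure_singleton hΩ hx)
  filter_upwards [this] with y hy h
  exact hy h.symm

/-- By the layer-cake formula: the set where `|x-y|⁻¹ > t` lies in the ball of radius `1/t`, of area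
at most `C t⁻²`, which is integrable for `t > 1`. For `t ≤ 1` the total area is enough. -/
lemma integrable_inv_norm_sub (hΩ : IsSmoothBoundedDomain Ω) {x : E3} (hx : x ∈ frontier Ω) :
    Integrable (fun y => ‖x - y‖⁻¹) (surfaceMeasure Ω) := by
  have := isFiniteMeasure_surfaceMeasure hΩ
  have hm : Measurable fun y : E3 => ‖x - y‖⁻¹ := by fun_prop
  refine ⟨hm.aestronglyMeasurable, ?_⟩
  rw [hasFiniteIntegral_iff_ofReal (ae_of_all _ fun y => by positivity),
    lintegral_eq_lintegral_meas_lt _ (ae_of_all _ fun y => by positivity) hm.aemeasurable]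
  obtain ⟨C, hC, h⟩ := exists_measureReal_ball_le hΩ hx
  have hsub : ∀ t : ℝ, 0 < t → {y : E3 | t < ‖x - y‖⁻¹} ⊆ ball x t⁻¹ := by
    intro t ht y hy
    have h0 : 0 < ‖x - y‖ := by
      by_contra hcon
      have : ‖x - y‖ = 0 := le_antisymm (not_lt.1 hcon) (norm_nonneg _)
      simp only [mem_ofPred_eq, this, inv_zero] at hy
      exact absurd hy (not_lt.2 ht.le)
    rw [mem_ball, dist_comm, dist_eq_norm]
    exact (lt_inv_comm₀ ht h0).1 hy
  have h1 : ∀ t ∈ Ioi (1 : ℝ), surfaceMeasure Ω {y | t < ‖x - y‖⁻¹}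
      ≤ ENNReal.ofReal (C * t ^ (-2 : ℝ)) := by
    intro t ht
    have ht0 : 0 < t := zero_lt_one.trans ht
    refine (measure_mono (hsub t ht0)).trans ?_
    rw [← ofReal_measureReal]
    refine ENNReal.ofReal_le_ofReal ((h _ (inv_pos.2 ht0)).trans_eq ?_)
    rw [Real.rpow_neg ht0.le, Real.rpow_two, inv_pow]
  rw [← Ioc_union_Ioi_eq_Ioi (zero_le_one' ℝ)]
  refine (lintegral_union_le _ _ _).trans_lt (ENNReal.add_lt_top.2 ⟨?_, ?_⟩)
  · refine (lintegral_mono fun t => measure_mono (subset_univ _)).trans_lt ?_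
    rw [setLIntegral_const]
    simp
  · refine (setLIntegral_mono' measurableSet_Ioi h1).trans_lt ?_
    have hi := ((integrableOn_Ioi_rpow_of_lt (by norm_num : (-2 : ℝ) < -1) zero_lt_one).const_mul C)
    exact hi.lintegral_lt_top

lemma OrderOne.integrable_mul (hΩ : IsSmoothBoundedDomain Ω) {K : E3 → E3 → ℂ}
    (hK : OrderOne (frontier Ω) K) {x : E3} (hx : x ∈ frontier Ω) {v : E3 → ℂ}
    (hv : ContinuousOn v (frontier Ω)) :
    Integrable (fun y => K x y * v y) (surfaceMeasure Ω) := by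
  obtain ⟨hc, C, hC, hb⟩ := hK
  obtain ⟨B, hB⟩ := (isCompact_frontier hΩ).exists_bound_of_continuousOn hv
  have hcx : ContinuousOn (fun y => K x y * v y) (frontier Ω ∩ {x}ᶜ) := by
    refine ContinuousOn.mul ?_ (hv.mono inter_subset_left)
    exact hc.comp (by fun_prop : Continuous fun y : E3 => (x, y)).continuousOn
      fun y hy => ⟨hx, hy.1, fun h => hy.2 h.symm⟩
  -- Continuity is known only off `x`, but `{x}` has area zero.
  have hms : AEStronglyMeasurable (fun y => K x y * v y) (surfaceMeasure Ω) := by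
    have h1 := hcx.aestronglyMeasurable (μ := (μHE[2] : Measure E3))
      (isClosed_frontier.measurableSet.inter (measurableSet_singleton x).compl)
    rw [inter_comm, ← Measure.restrict_restrict (measurableSet_singleton x).compl] at h1
    have h2 : (surfaceMeasure Ω).restrict {x}ᶜ = surfaceMeasure Ω :=
      Measure.restrict_eq_self_of_ae_mem (by
        filter_upwards [ae_ne_surfaceMeasure hΩ hx] with y hy h using hy h.symm)
    rw [← h2]; exact h1
  refine ((integrable_inv_norm_sub hΩ hx).const_mul (C * |B|)).mono' hms ?_
  filter_upwards [ae_ne_surfaceMeasure hΩ hx, ae_mem_frontier Ω] with y hxy hy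
  rw [norm_mul]
  calc _ ≤ C * ‖x - y‖⁻¹ * |B| := mul_le_mul (hb x hx y hy hxy)
        ((hB y hy).trans (le_abs_self B)) (norm_nonneg _) (by positivity)
    _ = _ := by ring

lemma continuousOn_gunter (hΩ : IsSmoothBoundedDomain Ω) {u : E3 → Fin 3 → ℂ}
    (hu : ContDiffOn ℝ 1 u (frontier Ω)) (i : Fin 3) :
    ContinuousOn (fun y => gunter Ω u y i) (frontier Ω) :=
  continuousOn_finsetSum _ fun j _ => continuousOn_gunterEntry hΩ (contDiffOn_pi.1 hu j) i j

end surface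

/-! ### Differentiability of potentials with bounded kernel -/

lemma norm_fderiv_le_of_pd {F : E3 → ℂ} {d : E3} {B : ℝ} (h : ∀ j, ‖pd j F d‖ ≤ B) :
    ‖fderiv ℝ F d‖ ≤ 3 * B := by
  have hB : 0 ≤ B := (norm_nonneg _).trans (h 0)
  refine ContinuousLinearMap.opNorm_le_bound _ (by positivity) fun v => ?_
  have hv : v = ∑ j, v j • EuclideanSpace.single j (1 : ℝ) := by
    ext i
    simp [Pi.single_apply]
  have e : fderiv ℝ F d v = ∑ j, (v j : ℂ) * pd j F d := by
    conv_lhs => rw [hv]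
    simp [pd, map_sum]
  rw [e]
  calc _ ≤ ∑ _j : Fin 3, ‖v‖ * B := (norm_sum_le _ _).trans (Finset.sum_le_sum fun j _ => by
        rw [norm_mul]
        exact mul_le_mul (norm_coord_le v j) (h j) (norm_nonneg _) (norm_nonneg _))
    _ = _ := by simp; ring

/-- For `‖h‖ ≤ ‖d‖/2` the ball around `d` stays away from the origin and the mean value inequality
applies with the bound `O(1/|d|)` for the second derivatives. For larger `h` boundedness of the
first derivative suffices, since `1 ≤ 2‖h‖/‖d‖`. The result allows differentiation under the
integral although `d + h` may hit the singularity. -/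
lemma exists_pd_pot_lipschitz {c κ : Fin 3 → ℂ} (hc : ∑ m, c m = 0) (R : ℝ) (j : Fin 3) :
    ∃ C : ℝ, 0 ≤ C ∧ ∀ d h : E3, d ≠ 0 → ‖d‖ ≤ R → ‖h‖ ≤ 1 →
      ‖pd j (pot c κ) (d + h) - pd j (pot c κ) d‖ ≤ C * ‖d‖⁻¹ * ‖h‖ := by
  obtain ⟨C, hC, hb⟩ := exists_pd_pot_bound (κ := κ) hc (2 * |R| + 1)
  set w := pd j (pot c κ) with hw
  have hws : SmoothOff w := smoothOff_pot.pd j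
  -- The summand `6 * C` serves small `h`, the other one large `h`. The value `w 0` enters because
  -- `d + h = 0` is allowed and the bound on derivatives says nothing about the origin.
  refine ⟨6 * C + 4 * (C + ‖w 0‖), by positivity, fun d h hd hdR hh => ?_⟩
  have hr : 0 < ‖d‖ := norm_pos_iff.2 hd
  have hdR' : ‖d‖ ≤ |R| := hdR.trans (le_abs_self R)
  have hR : 0 ≤ |R| := abs_nonneg R
  rcases le_or_gt ‖h‖ (‖d‖ / 2) with hle | hgt
  · have hz : ∀ z ∈ closedBall d (‖d‖ / 2), ‖d‖ / 2 ≤ ‖z‖ ∧ ‖z‖ ≤ 2 * |R| + 1 := by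
      intro z hz
      rw [mem_closedBall, dist_eq_norm] at hz
      have h1 := norm_sub_norm_le d z
      have h2 := norm_sub_norm_le z d
      rw [norm_sub_rev] at h1
      constructor <;> linarith
    have hz0 : ∀ z ∈ closedBall d (‖d‖ / 2), z ≠ 0 := fun z hz' =>
      norm_pos_iff.1 (by linarith [(hz z hz').1])
    have key := (convex_closedBall d (‖d‖ / 2)).norm_image_sub_le_of_norm_fderiv_le (𝕜 := ℝ)
      (f := w) (C := 3 * (C * (‖d‖ / 2)⁻¹)) (x := d) (y := d + h)
      (fun z hz' => hws.differentiableAt (hz0 z hz'))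
      (fun z hz' => norm_fderiv_le_of_pd fun i =>
        ((hb z (hz0 z hz') (hz z hz').2 j i).2).trans (by gcongr; exact (hz z hz').1))
      (mem_closedBall_self (by positivity))
      (by simpa [mem_closedBall, dist_eq_norm] using hle)
    rw [add_sub_cancel_left] at key
    refine key.trans ?_
    have : 3 * (C * (‖d‖ / 2)⁻¹) = 6 * C * ‖d‖⁻¹ := by field_simp; ring
    rw [this]
    gcongr
    have := norm_nonneg (w 0)
    linarith
  · have hwb : ∀ z : E3, ‖z‖ ≤ 2 * |R| + 1 → ‖w z‖ ≤ C + ‖w 0‖ := by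
      intro z hz
      rcases eq_or_ne z 0 with rfl | hz0
      · linarith
      · linarith [(hb z hz0 hz j 0).1, norm_nonneg (w 0)]
    have h1 := hwb d (by linarith)
    have h2 := hwb (d + h) ((norm_add_le _ _).trans (by linarith))
    have h3 : ‖w (d + h) - w d‖ ≤ 2 * (C + ‖w 0‖) := (norm_sub_le _ _).trans (by linarith)
    have h4 : 1 ≤ 2 * (‖d‖⁻¹ * ‖h‖) := by
      rw [inv_mul_eq_div, ← mul_div_assoc, one_le_div hr]; linarith
    have h5 : 0 ≤ C + ‖w 0‖ := by positivity
    calc _ ≤ 2 * (C + ‖w 0‖) * 1 := by rw [mul_one]; exact h3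
      _ ≤ 2 * (C + ‖w 0‖) * (2 * (‖d‖⁻¹ * ‖h‖)) := by gcongr
      _ = 4 * (C + ‖w 0‖) * ‖d‖⁻¹ * ‖h‖ := by ring
      _ ≤ _ := by gcongr; linarith

section surface

variable {Ω : Set E3} {c κ : Fin 3 → ℂ}

/-- The potential of a continuous density with kernel `∂_j (pot c κ) (z - y)` is differentiable at
the points of the surface, with the derivative given by differentiation under the integral. -/
lemma hasFDerivAt_integral_pd_pot (hΩ : IsSmoothBoundedDomain Ω) (hc : ∑ m, c m = 0) (j : Fin 3)
    {v : E3 → ℂ} (hv : ContinuousOn v (frontier Ω)) {x : E3} (hx : x ∈ frontier Ω) :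
    Integrable (fun y => v y • fderiv ℝ (pd j (pot c κ)) (x - y)) (surfaceMeasure Ω) ∧
    HasFDerivAt (fun z => ∫ y, v y * pd j (pot c κ) (z - y) ∂surfaceMeasure Ω)
      (∫ y, v y • fderiv ℝ (pd j (pot c κ)) (x - y) ∂surfaceMeasure Ω) x := by
  have := isFiniteMeasure_surfaceMeasure hΩ
  obtain ⟨R, hR0, hR⟩ := exists_norm_sub_le hΩ
  obtain ⟨C, hC, hl⟩ := exists_pd_pot_lipschitz (κ := κ) hc R j
  obtain ⟨B, hB⟩ := (isCompact_frontier hΩ).exists_bound_of_continuousOn hv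
  have hws : SmoothOff (pd j (pot c κ)) := smoothOff_pot.pd j
  have hvm : AEStronglyMeasurable v (surfaceMeasure Ω) :=
    hv.aestronglyMeasurable isClosed_frontier.measurableSet
  have hsub : ∀ z : E3, Measurable fun y : E3 => z - y := fun z => by fun_prop
  have hfm : Measurable (fderiv ℝ (pd j (pot c κ))) := measurable_fderiv ℝ _
  -- This version asks for differentiability of the integrand only at the point `x` and for a
  -- Lipschitz bound relative to `x`, both of which hold for `y ≠ x`.
  refine hasFDerivAt_integral_of_dominated_loc_of_lip' (s := ball x 1)
    (bound := fun y => |B| * C * ‖x - y‖⁻¹) (ball_mem_nhds x one_pos) ?_ ?_ ?_ ?_ ?_ ?_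
  · exact fun z _ => hvm.mul (hws.measurable.comp (hsub z)).aestronglyMeasurable
  · exact ((orderOne_pd_pot hΩ hc j).integrable_mul hΩ hx hv).congr
      (ae_of_all _ fun y => mul_comm _ _)
  · exact hvm.smul (hfm.comp (hsub x)).aestronglyMeasurable
  · filter_upwards [ae_ne_surfaceMeasure hΩ hx, ae_mem_frontier Ω] with y hxy hy z hz
    rw [mem_ball, dist_eq_norm] at hz
    have h := hl (x - y) (z - x) (sub_ne_zero.2 hxy) (hR x hx y hy) hz.le
    rw [show x - y + (z - x) = z - y by abel] at h
    rw [← mul_sub, norm_mul, mul_assoc |B|, mul_assoc |B|]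
    exact mul_le_mul ((hB y hy).trans (le_abs_self B)) h (norm_nonneg _) (abs_nonneg B)
  · exact (integrable_inv_norm_sub hΩ hx).const_mul _
  · filter_upwards [ae_ne_surfaceMeasure hΩ hx] with y hxy
    have h1 := (hws.differentiableAt (sub_ne_zero.2 hxy)).hasFDerivAt
    exact ((hasFDerivAt_comp_sub y).2 h1).const_mul (v y)

namespace Medium

variable {P : Medium} {k1 k2 : ℂ}

lemma hasFDerivAt_N33 (hΩ : IsSmoothBoundedDomain Ω) {v : E3 → Fin 3 → ℂ}
    (hv : ∀ i, ContinuousOn (fun y => v y i) (frontier Ω)) {x : E3} (hx : x ∈ frontier Ω)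
    (i j : Fin 3) :
    Integrable (fun y => v y i • fderiv ℝ (pd j (potG k1 k2)) (x - y)) (surfaceMeasure Ω) ∧
    HasFDerivAt (fun z => P.N33 k1 k2 Ω v z i j) ((2 * P.mu * P.c12 k1 k2) •
      ∫ y, v y i • fderiv ℝ (pd j (potG k1 k2)) (x - y) ∂surfaceMeasure Ω) x := by
  have h := hasFDerivAt_integral_pd_pot (κ := ![0, k1, k2]) hΩ sum_coeff_potG j (hv i) hx
  rw [← potG_eq_pot] at h
  refine ⟨h.1, ?_⟩
  have h2 := h.2.const_mul (2 * P.mu * P.c12 k1 k2)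
  have e : (fun z => P.N33 k1 k2 Ω v z i j) = fun z => (2 * P.mu * P.c12 k1 k2)
      * ∫ y, v y i * pd j (potG k1 k2) (z - y) ∂surfaceMeasure Ω := by
    funext z
    rw [N33, ← integral_const_mul]
    refine integral_congr_ae (ae_of_all _ fun y => ?_)
    simp only [kerN33_eq]
    ring
  rw [e]
  exact h2

lemma gunterColon_N33 (hΩ : IsSmoothBoundedDomain Ω) {v : E3 → Fin 3 → ℂ}
    (hv : ∀ i, ContinuousOn (fun y => v y i) (frontier Ω)) {x : E3} (hx : x ∈ frontier Ω) :
    gunterColon Ω (P.N33 k1 k2 Ω v) x = 2 * P.mu * P.c12 k1 k2 *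
      ∑ i, ∑ j, ∫ y, v y i * ((outwardNormal Ω x j : ℂ) * pd i (pd j (potG k1 k2)) (x - y)
        - outwardNormal Ω x i * pd j (pd j (potG k1 k2)) (x - y)) ∂surfaceMeasure Ω := by
  rw [gunterColon, Finset.mul_sum]
  refine Finset.sum_congr rfl fun i _ => ?_
  rw [Finset.mul_sum]
  refine Finset.sum_congr rfl fun j _ => ?_
  obtain ⟨hi, hd⟩ := hasFDerivAt_N33 (P := P) (k1 := k1) (k2 := k2) hΩ hv hx i j
  rw [gunterEntry_eq hΩ hx hd.hasFDerivWithinAt, smul_apply, smul_eq_mul,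
    ContinuousLinearMap.integral_apply hi]
  congr 1
  refine integral_congr_ae (ae_of_all _ fun y => ?_)
  simp only [smul_apply, smul_eq_mul, gunterVec, map_sub, map_smul]
  simp only [pd, Complex.real_smul]
  ring

end Medium

end surface

open Asymptotics

section surface

variable {Ω : Set E3}

/-! ### Rules for the Günter derivative -/

lemma gunterEntry_add (hΩ : IsSmoothBoundedDomain Ω) {y : E3} (hy : y ∈ frontier Ω) {f g : E3 → ℂ}
    (hf : DifferentiableWithinAt ℝ f (frontier Ω) y)
    (hg : DifferentiableWithinAt ℝ g (frontier Ω) y) (i j : Fin 3) :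
    gunterEntry Ω i j (fun z => f z + g z) y = gunterEntry Ω i j f y + gunterEntry Ω i j g y := by
  rw [gunterEntry_eq hΩ hy hf.hasFDerivWithinAt, gunterEntry_eq hΩ hy hg.hasFDerivWithinAt,
    gunterEntry_eq hΩ hy (hf.hasFDerivWithinAt.fun_add hg.hasFDerivWithinAt), add_apply]

lemma gunterEntry_congr_ne {x y : E3} (hxy : x ≠ y) {f g : E3 → ℂ}
    (h : ∀ z, z ≠ x → f z = g z) (i j : Fin 3) :
    gunterEntry Ω i j f y = gunterEntry Ω i j g y := by
  have : f =ᶠ[𝓝[frontier Ω] y] g := by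
    filter_upwards [mem_nhdsWithin_of_mem_nhds (isOpen_ne.mem_nhds hxy.symm)] with z hz using h z hz
  rw [gunterEntry, gunterEntry, this.fderivWithin_eq (h y hxy.symm)]

lemma gunterEntry_antisymm (f : E3 → ℂ) (i j : Fin 3) (x : E3) :
    gunterEntry Ω i j f x = -gunterEntry Ω j i f x := by
  rw [gunterEntry, gunterEntry, ← map_neg, neg_sub]

lemma gunterEntry_comp_sub_mul (hΩ : IsSmoothBoundedDomain Ω) {x y : E3} (hy : y ∈ frontier Ω)
    {F : E3 → ℂ} (hF : DifferentiableAt ℝ F (x - y)) {v : E3 → ℂ}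
    (hv : DifferentiableWithinAt ℝ v (frontier Ω) y) (i j : Fin 3) :
    gunterEntry Ω i j (fun z => F (x - z) * v z) y
      = -((outwardNormal Ω y j : ℂ) * pd i F (x - y) - outwardNormal Ω y i * pd j F (x - y)) * v y
        + F (x - y) * gunterEntry Ω i j v y := by
  have h1 := (hF.hasFDerivAt.comp y ((hasFDerivAt_id y).const_sub x)).hasFDerivWithinAt
    (s := frontier Ω)
  have h3 : HasFDerivWithinAt (fun z => F (x - z) * v z) _ (frontier Ω) y :=
    h1.mul hv.hasFDerivWithinAt
  rw [gunterEntry_eq hΩ hy h3, gunterEntry_eq hΩ hy hv.hasFDerivWithinAt]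
  simp [gunterVec, pd]
  ring

/-! ### Integrals outside of small balls -/

lemma integrableOn_gunterEntry_radial_mul (hΩ : IsSmoothBoundedDomain Ω) (x : E3) {ε : ℝ}
    (hε : 0 < ε) {φ φ' : ℝ → ℂ} (hφ : ∀ t, 0 < t → HasDerivAt φ (φ' t) t)
    (hφ' : ContinuousOn φ' (Ioi 0)) {G : E3 → ℂ} (hG : ContDiffOn ℝ 1 G (frontier Ω))
    (i j : Fin 3) :
    IntegrableOn (gunterEntry Ω i j fun z => φ (‖z - x‖ ^ 2) * G z) (ball x ε)ᶜ
      (surfaceMeasure Ω) := by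
  have hφc : ContinuousOn φ (Ioi 0) := fun t ht => (hφ t ht).continuousAt.continuousWithinAt
  have hmaps : MapsTo (fun y : E3 => ‖y - x‖ ^ 2) (frontier Ω ∩ (ball x ε)ᶜ) (Ioi 0) := by
    intro y hy
    have : ε ≤ ‖y - x‖ := by simpa [dist_eq_norm] using hy.2
    exact pow_pos (hε.trans_le this) 2
  have hρ : ContinuousOn (fun y : E3 => ‖y - x‖ ^ 2) (frontier Ω ∩ (ball x ε)ᶜ) := by fun_prop
  have hm : ContinuousOn (fun y => ((2 * inner ℝ (y - x) (gunterVec Ω i j y) : ℝ) : ℂ))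
      (frontier Ω) := by
    refine Complex.continuous_ofReal.comp_continuousOn (continuousOn_const.mul ?_)
    exact ContinuousOn.inner (by fun_prop) (continuousOn_gunterVec hΩ i j)
  refine integrableOn_compl_ball hΩ ?_
  refine ContinuousOn.congr (f := fun y => φ' (‖y - x‖ ^ 2)
    * ((2 * inner ℝ (y - x) (gunterVec Ω i j y) : ℝ) : ℂ) * G y
    + φ (‖y - x‖ ^ 2) * gunterEntry Ω i j G y) ?_ fun y hy =>
      gunterEntry_radial_mul hΩ hy.1 (hφ _ (hmaps hy)) (hG.differentiableOn one_ne_zero y hy.1) i j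
  exact (((hφ'.comp hρ hmaps).mul (hm.mono inter_subset_left)).mul
    (hG.continuousOn.mono inter_subset_left)).add
    ((hφc.comp hρ hmaps).mul ((continuousOn_gunterEntry hΩ hG i j).mono inter_subset_left))

lemma tendsto_setIntegral_compl_ball (hΩ : IsSmoothBoundedDomain Ω) {x : E3}
    (hx : x ∈ frontier Ω) {f : E3 → ℂ} (hf : Integrable f (surfaceMeasure Ω)) :
    Tendsto (fun ε => ∫ y in (ball x ε)ᶜ, f y ∂(surfaceMeasure Ω)) (𝓝[>] 0)
      (𝓝 (∫ y, f y ∂(surfaceMeasure Ω))) := by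
  have hm (ε : ℝ) : MeasurableSet (ball x ε)ᶜ := measurableSet_ball.compl
  simp only [← integral_indicator (hm _)]
  refine tendsto_integral_filter_of_dominated_convergence (fun y => ‖f y‖)
    (Eventually.of_forall fun ε => hf.aestronglyMeasurable.indicator (hm ε))
    (Eventually.of_forall fun ε => ae_of_all _ fun y => norm_indicator_le_norm_self _ _) hf.norm ?_
  filter_upwards [ae_ne_surfaceMeasure hΩ hx] with y hxy
  refine tendsto_const_nhds.congr' ?_
  have h0 : 0 < dist y x := dist_pos.2 hxy.symm
  filter_upwards [mem_nhdsWithin_of_mem_nhds (Iio_mem_nhds h0)] with ε hε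
  rw [indicator_of_mem]
  simpa using le_of_lt hε

/-- The boundary term of a kernel `δ φ(|d|²) + d_a d_b ψ(|d|²)` of order `1/|d|` vanishes in the
limit. -/
lemma tendsto_setIntegral_gunterEntry_kernel (hΩ : IsSmoothBoundedDomain Ω) {x : E3}
    (hx : x ∈ frontier Ω) {φ φ' ψ ψ' : ℝ → ℂ} (hφ : ∀ t, 0 < t → HasDerivAt φ (φ' t) t)
    (hφ' : ContinuousOn φ' (Ioi 0)) (hψ : ∀ t, 0 < t → HasDerivAt ψ (ψ' t) t)
    (hψ' : ContinuousOn ψ' (Ioi 0))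
    (hφO : (fun ε : ℝ => φ (ε ^ 2)) =O[𝓝[>] 0] fun ε : ℝ => ε⁻¹)
    (hψO : (fun ε : ℝ => ψ (ε ^ 2)) =O[𝓝[>] 0] fun ε : ℝ => (ε ^ 3)⁻¹)
    {K : E3 → ℂ} {δ : ℂ} {a b : Fin 3}
    (hK : ∀ d, d ≠ 0 → K d = δ * φ (‖d‖ ^ 2) + (d a : ℂ) * (d b : ℂ) * ψ (‖d‖ ^ 2))
    {u : E3 → ℂ} (hu : ContDiffOn ℝ 1 u (frontier Ω)) (i j : Fin 3) :
    (∀ ε, 0 < ε → IntegrableOn (gunterEntry Ω i j fun z => K (x - z) * u z) (ball x ε)ᶜ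
      (surfaceMeasure Ω)) ∧
    Tendsto (fun ε => ∫ y in (ball x ε)ᶜ, gunterEntry Ω i j (fun z => K (x - z) * u z) y
      ∂(surfaceMeasure Ω)) (𝓝[>] 0) (𝓝 0) := by
  have hG1 : ContDiffOn ℝ 1 (fun z => δ * u z) (frontier Ω) := contDiffOn_const.mul hu
  have hG2 : ContDiffOn ℝ 1 (fun z : E3 => (((z - x) a : ℝ) : ℂ) * (((z - x) b : ℝ) : ℂ) * u z)
      (frontier Ω) := by
    have hd : ∀ k : Fin 3, ContDiff ℝ 1 (fun z : E3 => (((z - x) k : ℝ) : ℂ)) := fun k =>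
      Complex.ofRealCLM.contDiff.comp
        ((EuclideanSpace.proj (𝕜 := ℝ) k).contDiff.comp (contDiff_id.sub contDiff_const))
    exact ((hd a).mul (hd b)).contDiffOn.mul hu
  have hdiff : ∀ {χ χ' : ℝ → ℂ}, (∀ t, 0 < t → HasDerivAt χ (χ' t) t) → ∀ {G : E3 → ℂ},
      ContDiffOn ℝ 1 G (frontier Ω) → ∀ y ∈ frontier Ω, x ≠ y →
      DifferentiableWithinAt ℝ (fun z => χ (‖z - x‖ ^ 2) * G z) (frontier Ω) y := by
    intro χ χ' hχ G hG y hy hxy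
    have h0 : 0 < ‖y - x‖ ^ 2 := normSq_pos (sub_ne_zero.2 hxy.symm)
    exact (((hχ _ h0).hasFDerivAt.comp y (hasFDerivAt_norm_sub_sq x y)).differentiableAt
      |>.differentiableWithinAt).mul (hG.differentiableOn one_ne_zero y hy)
  have hsplit : ∀ y ∈ frontier Ω, x ≠ y → gunterEntry Ω i j (fun z => K (x - z) * u z) y
      = gunterEntry Ω i j (fun z => φ (‖z - x‖ ^ 2) * (δ * u z)) y
        + gunterEntry Ω i j (fun z => ψ (‖z - x‖ ^ 2)
          * ((((z - x) a : ℝ) : ℂ) * (((z - x) b : ℝ) : ℂ) * u z)) y := by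
    intro y hy hxy
    rw [← gunterEntry_add hΩ hy (hdiff hφ hG1 y hy hxy) (hdiff hψ hG2 y hy hxy)]
    -- The formula for `K` fails possibly at the origin, but the Günter derivative at `y ≠ x` does
    -- not see the point `x`.
    refine gunterEntry_congr_ne hxy (fun z hz => ?_) i j
    rw [hK _ (sub_ne_zero.2 hz.symm), norm_sub_rev x z]
    simp
    ring
  have hne : ∀ ε > 0, ∀ y ∈ (ball x ε)ᶜ, x ≠ y := by
    rintro ε hε y hy rfl
    exact hy (mem_ball_self hε)
  have hi1 := fun ε (hε : 0 < ε) => integrableOn_gunterEntry_radial_mul hΩ x hε hφ hφ' hG1 i j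
  have hi2 := fun ε (hε : 0 < ε) => integrableOn_gunterEntry_radial_mul hΩ x hε hψ hψ' hG2 i j
  constructor
  · intro ε hε
    refine ((hi1 ε hε).add (hi2 ε hε)).congr ?_
    filter_upwards [ae_restrict_mem measurableSet_ball.compl,
      ae_restrict_of_ae (ae_mem_frontier Ω)] with y hy hyΩ
    exact (hsplit y hyΩ (hne ε hε y hy)).symm
  · have h := (tendsto_setIntegral_compl_ball_gunterEntry hΩ hx hφ hφ' hφO hG1 i j).add
      (tendsto_setIntegral_compl_ball_gunterEntry' hΩ hx hψ hψ' hψO hu a b i j)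
    rw [add_zero] at h
    refine h.congr' (eventually_mem_nhdsWithin.mono fun ε (hε : 0 < ε) => ?_)
    rw [← integral_add (hi1 ε hε) (hi2 ε hε)]
    exact setIntegral_congr_surface measurableSet_ball.compl fun y hy hyε =>
      (hsplit y hy (hne ε hε y hyε)).symm

end surface

/-! ### The boundary terms of `kerK`. -/

namespace Medium

variable {P : Medium} {k1 k2 : ℂ} {Ω : Set E3}

/-- Hessians of radial functions have the form `δ_ab φ + d_a d_b ψ`. The coefficients of both
potentials sum to zero, which gives `φ = O(1/r)` and `ψ = O(1/r³)`. -/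
lemma tendsto_setIntegral_gunterEntry_kerK (hΩ : IsSmoothBoundedDomain Ω)
    (hne : k1 ^ 2 ≠ k2 ^ 2) {x : E3} (hx : x ∈ frontier Ω)
    {u : E3 → ℂ} (hu : ContDiffOn ℝ 1 u (frontier Ω)) (a b i j : Fin 3) :
    (∀ ε, 0 < ε → IntegrableOn (gunterEntry Ω i j fun z => P.kerK k1 k2 a b (x - z) * u z)
      (ball x ε)ᶜ (surfaceMeasure Ω)) ∧
    Tendsto (fun ε => ∫ y in (ball x ε)ᶜ, gunterEntry Ω i j
      (fun z => P.kerK k1 k2 a b (x - z) * u z) y ∂(surfaceMeasure Ω)) (𝓝[>] 0) (𝓝 0) := by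
  set cH : Fin 3 → ℂ := ![1, -((P.kp ^ 2 - k2 ^ 2) / (k1 ^ 2 - k2 ^ 2)),
    (P.kp ^ 2 - k1 ^ 2) / (k1 ^ 2 - k2 ^ 2)]
  set κH : Fin 3 → ℂ := ![P.ks, k1, k2]
  set cG : Fin 3 → ℂ := ![0, 1, -1]
  set κG : Fin 3 → ℂ := ![0, k1, k2]
  -- The coefficients with which `γ_{k_s} δ_ab` and the Hessians of `potH` and `potG` enter `kerK`.
  -- In `α₀` the term `-1` accounts for the subtracted `γ_{k_s} I`.
  set α₀ : ℂ := -(P.rhof * (P.omega : ℂ) ^ 2) * (2 * P.mu * (1 / (P.mu : ℂ)) - 1)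
  set α₁ : ℂ := -(P.rhof * (P.omega : ℂ) ^ 2) * (2 * P.mu
    * (1 / ((P.rho - P.beta * P.rhof) * (P.omega : ℂ) ^ 2)))
  set α₂ : ℂ := 2 * P.mu * P.c12 k1 k2
  obtain ⟨C, -, hb⟩ := exists_helmRad_bound P.ks 1
  obtain ⟨CH, -, hbH⟩ := exists_comb_bound (κ := κH) (sum_coeff_potH (P := P) hne) 1
  obtain ⟨CG, -, hbG⟩ := exists_comb_bound (κ := κG) sum_coeff_potG 1
  have hO : ∀ {f : ℝ → ℂ} {h : ℝ → ℝ} (c : ℝ), (∀ r, 0 < r → r ≤ 1 → ‖f (r ^ 2)‖ ≤ c * h r) →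
      (∀ r, 0 < r → 0 ≤ h r) → (fun ε : ℝ => f (ε ^ 2)) =O[𝓝[>] 0] h := by
    intro f h c hf hh
    refine IsBigO.of_bound c ?_
    filter_upwards [self_mem_nhdsWithin, mem_nhdsWithin_of_mem_nhds (Iic_mem_nhds one_pos)]
      with r hr hr1
    rw [Real.norm_of_nonneg (hh r hr)]
    exact hf r hr hr1
  have hi : ∀ r : ℝ, 0 < r → 0 ≤ r⁻¹ := fun r hr => by positivity
  have hi3 : ∀ r : ℝ, 0 < r → 0 ≤ (r ^ 3)⁻¹ := fun r hr => by positivity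
  refine tendsto_setIntegral_gunterEntry_kernel hΩ hx
    (φ := fun t => α₀ * helmRad 0 P.ks t + α₁ * comb cH κH 1 t + α₂ * comb cG κG 1 t)
    (ψ := fun t => α₁ * comb cH κH 2 t + α₂ * comb cG κG 2 t)
    (δ := (1 : Matrix (Fin 3) (Fin 3) ℂ) a b) (a := a) (b := b)
    (fun t ht => (((hasDerivAt_helmRad 0 (by norm_num) P.ks ht).const_mul α₀).add
      ((hasDerivAt_comb 1 (by norm_num) ht).const_mul α₁)).add
      ((hasDerivAt_comb 1 (by norm_num) ht).const_mul α₂)) ?_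
    (fun t ht => ((hasDerivAt_comb 2 (by norm_num) ht).const_mul α₁).add
      ((hasDerivAt_comb 2 (by norm_num) ht).const_mul α₂)) ?_ ?_ ?_ ?_ hu i j
  · exact ((continuousOn_const.mul ((continuousOn_helmRad _ _).div_const _)).add
      (continuousOn_const.mul ((continuousOn_comb _).div_const _))).add
      (continuousOn_const.mul ((continuousOn_comb _).div_const _))
  · exact (continuousOn_const.mul ((continuousOn_comb _).div_const _)).add
      (continuousOn_const.mul ((continuousOn_comb _).div_const _))
  · exact (((hO C (fun r hr h1 => (hb r hr h1).1) hi).const_mul_left α₀).add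
      ((hO CH (fun r hr h1 => (hbH r hr h1).1) hi).const_mul_left α₁)).add
      ((hO CG (fun r hr h1 => (hbG r hr h1).1) hi).const_mul_left α₂)
  · exact ((hO CH (fun r hr h1 => (hbH r hr h1).2) hi3).const_mul_left α₁).add
      ((hO CG (fun r hr h1 => (hbG r hr h1).2) hi3).const_mul_left α₂)
  · intro d hd
    have hsymm : (1 : Matrix (Fin 3) (Fin 3) ℂ) b a = (1 : Matrix (Fin 3) (Fin 3) ℂ) a b := by
      simp [Matrix.one_apply, eq_comm]
    rw [kerK, e11, potG_eq_pot, potH_eq_pot, pd_pd_pot _ _ hd, pd_pd_pot _ _ hd, hsymm]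
    simp only [helm, α₀, α₁, α₂]
    ring

end Medium

namespace Medium

variable {P : Medium} {k1 k2 : ℂ} {Ω : Set E3}

/-! ### The finite part -/

/-- The decomposition of the hyper-singular kernel applied to a vector field. -/
lemma hyperKernel_mulVec (hP : P.Admissible) (hk : P.IsCompressionalPair k1 k2)
    (hne : k1 ^ 2 ≠ k2 ^ 2) (hΩ : IsSmoothBoundedDomain Ω) {u : E3 → Fin 3 → ℂ}
    (hu : ContDiffOn ℝ 1 u (frontier Ω)) {x y : E3} (hy : y ∈ frontier Ω) (hxy : x ≠ y) :
    (P.hyperKernel k1 k2 Ω x y *ᵥ Sum.elim (u y) 0) (Sum.inr ())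
      = P.kerN31 k1 k2 Ω x y ⬝ᵥ u y
        + ∑ i, ∑ l, (outwardNormal Ω x i : ℂ) * (P.kerK k1 k2 i l (x - y) * gunter Ω u y l)
        + ∑ i, ∑ l, ∑ j, (outwardNormal Ω x i : ℂ)
          * gunterEntry Ω j l (fun z => P.kerK k1 k2 i l (x - z) * u z j) y := by
  have hd : x - y ≠ 0 := sub_ne_zero.2 hxy
  have huj : ∀ j, DifferentiableWithinAt ℝ (fun z => u z j) (frontier Ω) y := fun j =>
    (contDiffOn_pi.1 hu j).differentiableOn one_ne_zero y hy
  have e1 : (P.hyperKernel k1 k2 Ω x y *ᵥ Sum.elim (u y) 0) (Sum.inr ())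
      = ∑ j, P.hyperKernel k1 k2 Ω x y (Sum.inr ()) (Sum.inl j) * u y j := by
    simp [Matrix.mulVec, dotProduct]
  have e2 (j : Fin 3) : P.hyperKernel k1 k2 Ω x y (Sum.inr ()) (Sum.inl j)
      = P.kerN31 k1 k2 Ω x y j - ∑ i, ∑ l, (outwardNormal Ω x i : ℂ)
        * ((outwardNormal Ω y l : ℂ) * pd j (P.kerK k1 k2 i l) (x - y)
          - outwardNormal Ω y j * pd l (P.kerK k1 k2 i l) (x - y)) := by
    rw [hyperKernel_eq, kerN31_eq hxy, ← Finset.sum_sub_distrib]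
    refine Finset.sum_congr rfl fun i _ => ?_
    rw [kernel_component_identity hP hk hne _ _ _ hd, mul_sub, Finset.mul_sum]
  have e3 (i l j : Fin 3) := gunterEntry_comp_sub_mul hΩ hy
    ((smoothOff_kerK (P := P) (k1 := k1) (k2 := k2) i l).differentiableAt hd) (huj j) j l
  -- The product rule produces `m^{jl} u_j`, with the indices in the reverse of the order in
  -- `(Mu)_l`. The antisymmetry of `m` supplies the sign that makes `K (Mu)` appear with a plus.
  have e4 (l : Fin 3) : gunter Ω u y l = -∑ j, gunterEntry Ω j l (fun z => u z j) y := by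
    rw [gunter, ← Finset.sum_neg_distrib]
    exact Finset.sum_congr rfl fun j _ => gunterEntry_antisymm _ _ _ _
  rw [e1]
  simp only [e2, e3, e4, dotProduct, sub_mul, Finset.sum_sub_distrib, Finset.sum_mul]
  rw [sub_eq_add_neg, add_assoc]
  congr 1
  rw [Finset.sum_comm, ← Finset.sum_neg_distrib, ← Finset.sum_add_distrib]
  refine Finset.sum_congr rfl fun i _ => ?_
  rw [Finset.sum_comm, ← Finset.sum_neg_distrib, ← Finset.sum_add_distrib]
  refine Finset.sum_congr rfl fun l _ => ?_
  rw [mul_neg, mul_neg, Finset.mul_sum, Finset.mul_sum, ← Finset.sum_neg_distrib,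
    ← Finset.sum_neg_distrib, ← Finset.sum_add_distrib]
  refine Finset.sum_congr rfl fun j _ => ?_
  ring

/-- With `G = potG`, the sum of `ν_j ∂_j ∂_l G` over `j` equals that of `(ν_j ∂_l - ν_l ∂_j) ∂_j G`
plus `ν_l ΔG`. The first part is tangential in `x` and becomes `M : N₃³`; the second, with `ΔG =
-potL`, is the last term of `kerN32`. -/
lemma kerN32_dotProduct {x y : E3} (hxy : x ≠ y) (v : Fin 3 → ℂ) :
    ∑ i, ∑ l, (outwardNormal Ω x i : ℂ) * (P.kerK k1 k2 i l (x - y) * v l)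
      = P.kerN32 k1 k2 Ω x y ⬝ᵥ v + 2 * P.mu * P.c12 k1 k2 *
        ∑ i, ∑ j, v i * ((outwardNormal Ω x j : ℂ) * pd i (pd j (potG k1 k2)) (x - y)
          - outwardNormal Ω x i * pd j (pd j (potG k1 k2)) (x - y)) := by
  have hd : x - y ≠ 0 := sub_ne_zero.2 hxy
  have hg := smoothOff_potG k1 k2
  rw [Finset.sum_comm, dotProduct, Finset.mul_sum, ← Finset.sum_add_distrib]
  refine Finset.sum_congr rfl fun l _ => ?_
  have e1 : ∑ j, v l * ((outwardNormal Ω x j : ℂ) * pd l (pd j (potG k1 k2)) (x - y)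
          - outwardNormal Ω x l * pd j (pd j (potG k1 k2)) (x - y))
      = v l * (∑ j, (outwardNormal Ω x j : ℂ) * pd j (pd l (potG k1 k2)) (x - y)
        + outwardNormal Ω x l * potL k1 k2 (x - y)) := by
    rw [← Finset.mul_sum, Finset.sum_sub_distrib, ← Finset.mul_sum, laplacian_potG k1 k2 hd]
    simp only [pd_comm hg l _ hd]
    ring
  rw [e1, kerN32_eq]
  simp only [kerK, Fin.sum_univ_three]
  ring

lemma integral_kerK (hΩ : IsSmoothBoundedDomain Ω) (hne : k1 ^ 2 ≠ k2 ^ 2)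
    {v : E3 → Fin 3 → ℂ} (hv : ∀ i, ContinuousOn (fun y => v y i) (frontier Ω)) {x : E3}
    (hx : x ∈ frontier Ω) :
    Integrable (fun y => ∑ i, ∑ l, (outwardNormal Ω x i : ℂ)
      * (P.kerK k1 k2 i l (x - y) * v y l)) (surfaceMeasure Ω) ∧
    ∫ y, ∑ i, ∑ l, (outwardNormal Ω x i : ℂ) * (P.kerK k1 k2 i l (x - y) * v y l)
      ∂surfaceMeasure Ω = P.N32 k1 k2 Ω v x + gunterColon Ω (P.N33 k1 k2 Ω v) x := by
  have hK : Integrable (fun y => ∑ i, ∑ l, (outwardNormal Ω x i : ℂ)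
      * (P.kerK k1 k2 i l (x - y) * v y l)) (surfaceMeasure Ω) :=
    integrable_finsetSum _ fun i _ => integrable_finsetSum _ fun l _ =>
      ((orderOne_kerK hΩ hne i l).integrable_mul hΩ hx (hv l)).const_mul _
  have h32 : Integrable (fun y => P.kerN32 k1 k2 Ω x y ⬝ᵥ v y) (surfaceMeasure Ω) :=
    integrable_finsetSum _ fun l _ => (orderOne_kerN32 hΩ hne l).integrable_mul hΩ hx (hv l)
  have h33 (i j : Fin 3) : Integrable (fun y => v y i
      * ((outwardNormal Ω x j : ℂ) * pd i (pd j (potG k1 k2)) (x - y)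
        - outwardNormal Ω x i * pd j (pd j (potG k1 k2)) (x - y))) (surfaceMeasure Ω) :=
    ((((orderOne_pd_pd_potG hΩ j i).const_mul (outwardNormal Ω x j : ℂ)).sub
      ((orderOne_pd_pd_potG hΩ j j).const_mul (outwardNormal Ω x i : ℂ))).integrable_mul hΩ hx
        (hv i)).congr (ae_of_all _ fun y => mul_comm _ _)
  have hs (i : Fin 3) := integrable_finsetSum Finset.univ fun j _ => h33 i j
  refine ⟨hK, ?_⟩
  rw [gunterColon_N33 hΩ hv hx, N32]
  simp only [← integral_finsetSum Finset.univ fun j _ => h33 _ j]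
  rw [← integral_finsetSum Finset.univ fun i _ => hs i, ← integral_const_mul,
    ← integral_add h32 ((integrable_finsetSum Finset.univ fun i _ => hs i).const_mul _)]
  refine integral_congr_ae ?_
  filter_upwards [ae_ne_surfaceMeasure hΩ hx] with y hxy using kerN32_dotProduct hxy (v y)

theorem hasN3Value (hP : P.Admissible) (hk : P.IsCompressionalPair k1 k2)
    (hne : k1 ^ 2 ≠ k2 ^ 2) (hΩ : IsSmoothBoundedDomain Ω) {u : E3 → Fin 3 → ℂ}
    (hu : ContDiffOn ℝ 1 u (frontier Ω)) {x : E3} (hx : x ∈ frontier Ω) :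
    P.HasN3Value k1 k2 Ω u x
      (P.N31 k1 k2 Ω u x + P.N32 k1 k2 Ω (gunter Ω u) x
        + gunterColon Ω (P.N33 k1 k2 Ω (gunter Ω u)) x) := by
  have huj (j : Fin 3) : ContDiffOn ℝ 1 (fun z => u z j) (frontier Ω) := contDiffOn_pi.1 hu j
  have hT (i l j : Fin 3) := tendsto_setIntegral_gunterEntry_kerK (P := P) hΩ hne hx (huj j) i l j l
  obtain ⟨hK, hKeq⟩ := integral_kerK (P := P) hΩ hne (continuousOn_gunter hΩ hu) hx
  have h31 : Integrable (fun y => P.kerN31 k1 k2 Ω x y ⬝ᵥ u y) (surfaceMeasure Ω) :=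
    integrable_finsetSum _ fun l _ =>
      (orderOne_kerN31 hΩ l).integrable_mul hΩ hx (huj l).continuousOn
  -- No divergent term has to be discarded: the truncated integrals converge.
  refine ⟨0, 0, ?_⟩
  simp only [zero_div, zero_mul, sub_zero]
  have hlim : Tendsto (fun ε : ℝ => ∫ y in (ball x ε)ᶜ, P.kerN31 k1 k2 Ω x y ⬝ᵥ u y
        ∂(surfaceMeasure Ω)
      + ∫ y in (ball x ε)ᶜ, ∑ i, ∑ l, (outwardNormal Ω x i : ℂ)
          * (P.kerK k1 k2 i l (x - y) * gunter Ω u y l) ∂(surfaceMeasure Ω)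
      + ∑ i, ∑ l, ∑ j, (outwardNormal Ω x i : ℂ) * ∫ y in (ball x ε)ᶜ,
          gunterEntry Ω j l (fun z => P.kerK k1 k2 i l (x - z) * u z j) y ∂(surfaceMeasure Ω))
      (𝓝[>] 0) (𝓝 (P.N31 k1 k2 Ω u x + (P.N32 k1 k2 Ω (gunter Ω u) x
        + gunterColon Ω (P.N33 k1 k2 Ω (gunter Ω u)) x)
        + ∑ i, ∑ _l : Fin 3, ∑ _j : Fin 3, (outwardNormal Ω x i : ℂ) * 0)) := by
    rw [← hKeq]
    exact ((tendsto_setIntegral_compl_ball hΩ hx h31).add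
      (tendsto_setIntegral_compl_ball hΩ hx hK)).add
      (tendsto_finsetSum _ fun i _ => tendsto_finsetSum _ fun l _ => tendsto_finsetSum _ fun j _ =>
        (hT i l j).2.const_mul _)
  simp only [mul_zero, Finset.sum_const_zero, add_zero, ← add_assoc] at hlim
  refine hlim.congr' (eventually_mem_nhdsWithin.mono fun ε (hε : 0 < ε) => ?_)
  have hsum : Integrable (fun y => P.kerN31 k1 k2 Ω x y ⬝ᵥ u y + ∑ i, ∑ l,
      (outwardNormal Ω x i : ℂ) * (P.kerK k1 k2 i l (x - y) * gunter Ω u y l))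
      (surfaceMeasure Ω) := h31.add hK
  have hi (i l j : Fin 3) : IntegrableOn (fun y => (outwardNormal Ω x i : ℂ)
      * gunterEntry Ω j l (fun z => P.kerK k1 k2 i l (x - z) * u z j) y) (ball x ε)ᶜ
      (surfaceMeasure Ω) := ((hT i l j).1 ε hε).const_mul _
  have hj (i l : Fin 3) := integrable_finsetSum Finset.univ fun j _ => hi i l j
  have hl (i : Fin 3) := integrable_finsetSum Finset.univ fun l _ => hj i l
  simp only [← integral_const_mul]
  simp only [← integral_finsetSum Finset.univ fun j _ => hi _ _ j]
  simp only [← integral_finsetSum Finset.univ fun l _ => hj _ l]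
  rw [← integral_finsetSum Finset.univ fun i _ => hl i,
    ← integral_add h31.integrableOn hK.integrableOn,
    ← integral_add hsum.integrableOn (integrable_finsetSum Finset.univ fun i _ => hl i)]
  refine setIntegral_congr_surface measurableSet_ball.compl fun y hy hyε => ?_
  have hxy : x ≠ y := by
    rintro rfl
    exact hyε (mem_ball_self hε)
  exact (hyperKernel_mulVec hP hk hne hΩ hu hy hxy).symm

end Medium

end Poro

end

theorem mainTheorem7 (P : Poro.Medium) (hP : P.Admissible)
    (k1 k2 : ℂ) (hk : P.IsCompressionalPair k1 k2) (hne : k1 ^ 2 ≠ k2 ^ 2)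
    (Ω : Set Poro.E3) (hΩ : Poro.IsSmoothBoundedDomain Ω) :
    (∀ j : Fin 3,
      Poro.IsWeaklySingular (frontier Ω) (fun x y => P.kerN31 k1 k2 Ω x y j) ∧
      Poro.IsWeaklySingular (frontier Ω) (fun x y => P.kerN32 k1 k2 Ω x y j) ∧
      Poro.IsWeaklySingular (frontier Ω) (fun x y => P.kerN33 k1 k2 x y j)) ∧
    ∀ u : Poro.E3 → Fin 3 → ℂ, ContDiffOn ℝ 1 u (frontier Ω) → ∀ x ∈ frontier Ω,
      MeasureTheory.Integrable (fun y => P.kerN31 k1 k2 Ω x y ⬝ᵥ u y)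
        (Poro.surfaceMeasure Ω) ∧
      MeasureTheory.Integrable (fun y => P.kerN32 k1 k2 Ω x y ⬝ᵥ Poro.gunter Ω u y)
        (Poro.surfaceMeasure Ω) ∧
      (∀ i j : Fin 3,
        MeasureTheory.Integrable (fun y => Poro.gunter Ω u y i * P.kerN33 k1 k2 x y j)
          (Poro.surfaceMeasure Ω) ∧
        DifferentiableWithinAt ℝ (fun z => P.N33 k1 k2 Ω (Poro.gunter Ω u) z i j)
          (frontier Ω) x) ∧
      P.HasN3Value k1 k2 Ω u x
        (P.N31 k1 k2 Ω u x + P.N32 k1 k2 Ω (Poro.gunter Ω u) x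
          + Poro.gunterColon Ω (P.N33 k1 k2 Ω (Poro.gunter Ω u)) x) := by
  refine ⟨fun j => ⟨(Poro.Medium.orderOne_kerN31 hΩ j).isWeaklySingular,
    (Poro.Medium.orderOne_kerN32 hΩ hne j).isWeaklySingular,
    (Poro.Medium.orderOne_kerN33 hΩ j).isWeaklySingular⟩, fun u hu x hx => ?_⟩
  have hg := Poro.continuousOn_gunter hΩ hu
  refine ⟨?_, ?_, fun i j => ⟨?_, ?_⟩, Poro.Medium.hasN3Value hP hk hne hΩ hu hx⟩
  · exact MeasureTheory.integrable_finsetSum _ fun l _ =>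
      (Poro.Medium.orderOne_kerN31 hΩ l).integrable_mul hΩ hx (contDiffOn_pi.1 hu l).continuousOn
  · exact MeasureTheory.integrable_finsetSum _ fun l _ =>
      (Poro.Medium.orderOne_kerN32 hΩ hne l).integrable_mul hΩ hx (hg l)
  · exact ((Poro.Medium.orderOne_kerN33 hΩ j).integrable_mul hΩ hx (hg i)).congr
      (MeasureTheory.ae_of_all _ fun y => mul_comm _ _)
  · exact (Poro.Medium.hasFDerivAt_N33 hΩ hg hx i j).2.differentiableAt.differentiableWithinAt
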